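/- **Setting.** Let $\Omega\subset\mathbb R^2$, and let $\mathcal T_u$ be a finite conforming primal mesh of $\Omega$ by (strictly) convex polygons $T$: $\Omega$ is the interior of the union of the closed elements, and two different closed elements have in common nothing, one common vertex, or one common edge. In each $T$ an interior point $x_*$ is selected and joined to the vertices, which splits $T$ into triangles; $\mathcal T_h$ is the set of all these triangles, $\mathcal F_u$ the set of edges of the polygons, $\mathcal F_u^0$ the set of those not contained in $\partial\Omega$, and $\mathcal F_p$ the set of the new edges $[x_*,\mathsf v]$. With $h_T=\operatorname{diam}T$ the mesh is called regular with constants $\rho_B,\rho_E,\theta>0$ if every $T$ is star-shaped with respect to the ball of radius $\rho_Bh_T$ about $x_*$, every edge $e$ of $T$ satisfies $|e|\ge\rho_Eh_T$, and every interior angle of $T$ is at most $\pi-\theta$. For $e\in\mathcal F_u$ let $D(e)$ be the union of the (one or two) triangles in $\mathcal T_h$ having $e$ as an edge. On an edge shared by the triangles $\tau_1,\tau_2$, $\bm n$ is the unit normal pointing from $\tau_1$ to $\tau_2$ and $[\cdot]=\cdot|_{\tau_1}-\cdot|_{\tau_2}$. Let - $S_h$ be the space of vector fields $\bm v$ that are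 constant on each $D(e)$, $e\in\mathcal F_u$, and vanish on $D(e)$ if $e\subset\partial\Omega$, with $\|\bm v\|_h^2=\sum_{e\in\mathcal F_p}|e|^{-1}\|[\bm v]\|_{0,e}^2$; - $V_h$ be the space of $2\times2$ matrix fields $\bm\psi$ that are constant on each $\tau\in\mathcal T_h$, with $[\bm\psi\bm n]=0$ on every $e\in\mathcal F_p$; - $P_h$ be the space of functions $q$ that are constant on each $T\in\mathcal T_u$, with $\int_\Omega q=0$. *Velocity reconstruction.* Let $T$ have the vertices $\mathsf v_1,\dots,\mathsf v_m$ (counterclockwise, indices modulo $m$), the edges $e_i=[\mathsf v_i,\mathsf v_{i+1}]$ with outward unit normals $\bm n_i$, and the subtriangles $T_i=\operatorname{conv}(x_*,\mathsf v_i,\mathsf v_{i+1})$. The Wachspress coordinates are $\lambda_i=w_i/\sum_jw_j$, where $w_i(x)=\det(\tilde{\bm n}_{i-1},\tilde{\bm n}_i)$ and $\tilde{\bm n}_i=\bm n_i/((\mathsf v_i-x)\cdot\bm n_i)$. With $\operatorname{curl}\phi=(-\partial_y\phi,\partial_x\phi)$ put $$\bm\varphi_i(x)=\frac{|e_i|}{2|T|}(x-x_*)+\sum_{k=1}^mc_{i,k}\operatorname{curl}\lambda_k(x),\quad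 c_{i,k}=-\frac1m\sum_{l=1}^{m-1}l\,b_{i,k+l},\quad b_{i,l}=\delta_{i,l}|e_l|-|e_i|\frac{|T_l|}{|T|},$$ and $\Pi^{RT}\bm v|_T=\sum_{i=1}^m\Big(\frac1{|e_i|}\int_{e_i}\bm v\cdot\bm n_i\,ds\Big)\bm\varphi_i$ for $\bm v\in S_h$. *Discrete problem.* For $\nu>0$ and $\bm f\in[L^2(\Omega)]^2$, $(\bm\omega_h,\bm u_h,p_h)\in V_h\times S_h\times P_h$ is a solution of the PR-SDG scheme if $$\begin{aligned}B_h(\bm\omega_h,\bm v)+b_h^*(p_h,\bm v)&=(\bm f,\Pi^{RT}\bm v)&&\forall\bm v\in S_h,\\ B_h^*(\bm u_h,\bm\psi)&=\nu^{-1}(\bm\omega_h,\bm\psi)&&\forall\bm\psi\in V_h,\\ b_h(\bm u_h,q)&=0&&\forall q\in P_h,\end{aligned}$$ where $B_h(\bm\omega,\bm v)=-\sum_{e\in\mathcal F_p}(\bm\omega\bm n,[\bm v])_e$, $B_h^*(\bm u,\bm\psi)=\sum_{e\in\mathcal F_u^0}(\bm u,[\bm\psi\bm n])_e$, $b_h^*(p,\bm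 v)=-\sum_{T\in\mathcal T_u}(p,\nabla\cdot\Pi^{RT}\bm v)_T$ and $b_h(\bm u,q)=-\sum_{e\in\mathcal F_u^0}(\bm u\cdot\bm n,[q])_e$. **Lemma (uniform a priori bound on the discrete velocity).** For all $\Omega$ and all $\rho_B,\rho_E,\theta>0$ there is a constant $C>0$, depending on nothing else, such that the following holds for every regular mesh of $\Omega$ with these constants, every $\nu>0$, and every $\bm f\in[L^2(\Omega)]^2$ decomposed as $\bm f=\bm g+\lambda\nabla\chi$, where $\bm g=\operatorname{curl}\zeta$ with $\zeta\in H_0^1(\Omega)$, $\chi\in H^1(\Omega)$ with $\|\nabla\chi\|_0=1$, and $\lambda\ge0$: every solution $(\bm\omega_h,\bm u_h,p_h)$ of the PR-SDG scheme satisfies $$\|\bm u_h\|_h\le C\,\nu^{-1}\,\|\bm g\|_0 .$$ In particular, the bound is independent of the gradient part $\lambda\nabla\chi$ of the force. -/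

import Mathlib

open MeasureTheory Filter Topology
open scoped RealInnerProductSpace

namespace PRSDG

/-! ### Plane vectors and first-order operators -/

/-- The Euclidean plane. -/
abbrev Plane : Type := EuclideanSpace ℝ (Fin 2)

/-- The coordinate unit vectors. -/
noncomputable def unitVec (i : Fin 2) : Plane := EuclideanSpace.single i 1

/-- `det (a, b)`. -/
def det2 (a b : Plane) : ℝ := a 0 * b 1 - a 1 * b 0

/-- Counterclockwise rotation by a right angle. -/
noncomputable def rot (a : Plane) : Plane := !₂[-(a 1), a 0]

/-- Classical gradient of a scalar function. -/
noncomputable def grad (φ : Plane → ℝ) (x : Plane) : Plane :=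
  !₂[fderiv ℝ φ x (unitVec 0), fderiv ℝ φ x (unitVec 1)]

/-- `curl φ = (-∂_y φ, ∂_x φ)`, the gradient rotated counterclockwise by a right angle. -/
noncomputable def curl (φ : Plane → ℝ) (x : Plane) : Plane := rot (grad φ x)

/-- Classical divergence of a vector field. -/
noncomputable def div (F : Plane → Plane) (x : Plane) : ℝ :=
  ∑ i : Fin 2, (fderiv ℝ F x (unitVec i)) i

/-! ### Lebesgue and Sobolev spaces on an open set `Ω` -/

/-- The norm of `L²(Ω)` for vector fields. -/
noncomputable def l2Norm (Ω : Set Plane) (g : Plane → Plane) : ℝ :=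
  (eLpNorm g 2 (volume.restrict Ω)).toReal

/-- `φ ∈ C_c^∞(Ω)`. -/
def IsTestFunction (Ω : Set Plane) (φ : Plane → ℝ) : Prop :=
  ContDiff ℝ (⊤ : ℕ∞) φ ∧ HasCompactSupport φ ∧ tsupport φ ⊆ Ω

/-- `χ ∈ H¹(Ω)` and `G` is its (weak) gradient. -/
def HasWeakGradient (Ω : Set Plane) (χ : Plane → ℝ) (G : Plane → Plane) : Prop :=
  MemLp χ 2 (volume.restrict Ω) ∧ MemLp G 2 (volume.restrict Ω) ∧
    ∀ φ : Plane → ℝ, IsTestFunction Ω φ → ∀ i : Fin 2,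
      ∫ x in Ω, χ x * fderiv ℝ φ x (unitVec i) = -∫ x in Ω, G x i * φ x

/-- `ζ ∈ H¹₀(Ω)` (the closure of `C_c^∞(Ω)` in `H¹(Ω)`), with weak gradient `G`. -/
def IsH10WithGradient (Ω : Set Plane) (ζ : Plane → ℝ) (G : Plane → Plane) : Prop :=
  HasWeakGradient Ω ζ G ∧
    ∃ φ : ℕ → Plane → ℝ, (∀ n, IsTestFunction Ω (φ n)) ∧
      Tendsto (fun n => eLpNorm (fun x => φ n x - ζ x) 2 (volume.restrict Ω)) atTop (𝓝 0) ∧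
      Tendsto (fun n => eLpNorm (fun x => grad (φ n) x - G x) 2 (volume.restrict Ω))
        atTop (𝓝 0)

/-- `g` is the curl of a function whose (tangential) trace vanishes on `∂Ω`. In the plane a
curl-potential is a scalar function `ζ`, for which `H(curl; Ω) = H¹(Ω)`, and the vanishing of the
trace means `ζ ∈ H¹₀(Ω)`. -/
def IsSolenoidalPart (Ω : Set Plane) (g : Plane → Plane) : Prop :=
  ∃ (ζ : Plane → ℝ) (G : Plane → Plane), IsH10WithGradient Ω ζ G ∧
    g =ᵐ[volume.restrict Ω] fun x => rot (G x)

/-! ### Convex polygons, Wachspress coordinates and `H(div)` basis functions -/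

/-- A convex polygon with `m = extra + 3` vertices, listed counterclockwise; the indices are taken
modulo `m` (the arithmetic of `Fin m` is cyclic). Convexity together with the orientation: every
vertex which is not an end point of the edge `e_i = [v_i, v_{i+1}]` lies strictly to the left of
that edge. -/
structure ConvexPolygon where
  /-- number of vertices in excess of three -/
  extra : ℕ
  /-- the vertices `v_i` -/
  vert : Fin (extra + 3) → Plane
  convex_ccw : ∀ i k : Fin (extra + 3), k ≠ i → k ≠ i + 1 →
    0 < det2 (vert (i + 1) - vert i) (vert k - vert i)

namespace ConvexPolygon

variable (T : ConvexPolygon)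

/-- Index set of the vertices, and of the edges. -/
abbrev Idx : Type := Fin (T.extra + 3)

/-- The closed polygonal region. -/
def carrier : Set Plane := convexHull ℝ (Set.range T.vert)

/-- The diameter `h_T`. -/
noncomputable def diam : ℝ := Metric.diam T.carrier

/-- The area `|T|`. -/
noncomputable def area : ℝ := volume.real T.carrier

/-- The edge `e_i`, connecting `v_i` and `v_{i+1}`. -/
def edge (i : T.Idx) : Set Plane := segment ℝ (T.vert i) (T.vert (i + 1))

/-- The length `|e_i|`. -/
noncomputable def edgeLength (i : T.Idx) : ℝ := dist (T.vert i) (T.vert (i + 1))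

/-- The outward unit normal `n_i` on `e_i`: the unit tangent in counterclockwise direction,
rotated clockwise by a right angle. -/
noncomputable def normal (i : T.Idx) : Plane :=
  (T.edgeLength i)⁻¹ • -rot (T.vert (i + 1) - T.vert i)

/-- The distance `d_i(x) = (v_i - x) · n_i` of `x ∈ T` to the edge `e_i`. -/
noncomputable def edgeDist (i : T.Idx) (x : Plane) : ℝ := ⟪T.vert i - x, T.normal i⟫

/-- The scaled normal `n_i / d_i(x)`. -/
noncomputable def scaledNormal (i : T.Idx) (x : Plane) : Plane :=
  (T.edgeDist i x)⁻¹ • T.normal i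

/-- The Wachspress weight of the vertex `v_i`, which is the common end point of the edges
`e_{i-1}` and `e_i`. -/
noncomputable def weight (i : T.Idx) (x : Plane) : ℝ :=
  det2 (T.scaledNormal (i - 1) x) (T.scaledNormal i x)

/-- The Wachspress coordinates `λ_i` (in the interior of `T`). -/
noncomputable def wachspress (i : T.Idx) (x : Plane) : ℝ :=
  T.weight i x / ∑ j, T.weight j x

/-- The triangle `T_i` with vertices `y`, `v_i`, `v_{i+1}`. -/
def subTriangle (y : Plane) (i : T.Idx) : Set Plane :=
  convexHull ℝ {y, T.vert i, T.vert (i + 1)}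

/-- The area `|T_i|`. -/
noncomputable def subArea (y : Plane) (i : T.Idx) : ℝ := volume.real (T.subTriangle y i)

/-- `b_{i,l} = δ_{i,l} |e_l| - |e_i| |T_l| / |T|`. -/
noncomputable def bCoeff (y : Plane) (i l : T.Idx) : ℝ :=
  (if i = l then T.edgeLength l else 0) - T.edgeLength i * (T.subArea y l / T.area)

/-- `c_{i,k} = -(1/m) ∑_{l=1}^{m-1} l b_{i,k+l}` (the summand with `l = 0` vanishes). -/
noncomputable def cCoeff (y : Plane) (i k : T.Idx) : ℝ :=
  -(1 / ((T.extra + 3 : ℕ) : ℝ)) * ∑ l : T.Idx, (l.val : ℝ) * T.bCoeff y i (k + l)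

/-- The `H(div)` basis function
`φ_i(x) = |e_i| / (2 |T|) (x - y) + ∑_k c_{i,k} curl λ_k(x)` (in the interior of `T`). -/
noncomputable def basisFun (y : Plane) (i : T.Idx) (x : Plane) : Plane :=
  (T.edgeLength i / (2 * T.area)) • (x - y) + ∑ k, T.cCoeff y i k • curl (T.wachspress k) x

end ConvexPolygon

/-! ### Staggered meshes -/

/-- A primal mesh of `Ω` by finitely many convex polygons, with an interior point `x_*` selected in
every polygon. Two different polygons have in common nothing, a vertex of both, or an edge of both;
`Ω` is the interior of the union of the (closed) polygons. -/
structure StaggeredMesh (Ω : Set Plane) where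
  /-- number of primal elements -/
  card : ℕ
  /-- the primal elements -/
  elem : Fin card → ConvexPolygon
  /-- the selected interior points `x_*` -/
  center : Fin card → Plane
  center_mem : ∀ K, center K ∈ interior (elem K).carrier
  domain_eq : Ω = interior (⋃ K, (elem K).carrier)
  conforming : ∀ K L, K ≠ L →
    (elem K).carrier ∩ (elem L).carrier = ∅ ∨
    (∃ i j, (elem K).vert i = (elem L).vert j ∧
      (elem K).carrier ∩ (elem L).carrier = {(elem K).vert i}) ∨
    (∃ i j, (elem K).edge i = (elem L).edge j ∧
      (elem K).carrier ∩ (elem L).carrier = (elem K).edge i)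

namespace StaggeredMesh

variable {Ω : Set Plane} (M : StaggeredMesh Ω)

/-- Index set of the triangles of the sub-triangulation: `(K, i)` stands for the triangle
with vertices `x_*`, `v_i`, `v_{i+1}` of the element `K`. The same indices enumerate the edges `e_i`
of the elements `K` (an interior primal edge occurs twice) and the dual edges `[x_*, v_i]`. -/
abbrev Tri : Type := Σ K : Fin M.card, (M.elem K).Idx

/-- The primal edge contained in the triangle `s`. -/
def primalEdge (s : M.Tri) : Set Plane := (M.elem s.1).edge s.2

/-- Its length. -/
noncomputable def primalLength (s : M.Tri) : ℝ := (M.elem s.1).edgeLength s.2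

/-- Its unit normal pointing out of the element to which the triangle `s` belongs. -/
noncomputable def primalNormal (s : M.Tri) : Plane := (M.elem s.1).normal s.2

/-- The area of the triangle `s`. -/
noncomputable def triArea (s : M.Tri) : ℝ := (M.elem s.1).subArea (M.center s.1) s.2

/-- The other triangle of the same element containing the dual edge `[x_*, v_i]`: that edge is
shared by the triangles with indices `i - 1` and `i`. -/
def prevTri (s : M.Tri) : M.Tri := ⟨s.1, s.2 - 1⟩

/-- The length of the dual edge `[x_*, v_i]`. -/
noncomputable def dualLength (s : M.Tri) : ℝ := dist (M.center s.1) ((M.elem s.1).vert s.2)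

/-- The unit normal of the dual edge `[x_*, v_i]` pointing from the triangle `i - 1` to the
triangle `i`. -/
noncomputable def dualNormal (s : M.Tri) : Plane :=
  (M.dualLength s)⁻¹ • rot ((M.elem s.1).vert s.2 - M.center s.1)

open Classical in
/-- The interior primal edges, each one represented by the pair of the two triangles `τ₁, τ₂`
sharing it; as `τ₁` we take the one whose element has the smaller number. The unit normal `n_e` and
the jumps `[·]` are oriented from `τ₁` to `τ₂`. -/
noncomputable def interiorEdges : Finset (M.Tri × M.Tri) :=
  Finset.univ.filter fun e => e.1.1 < e.2.1 ∧ M.primalEdge e.1 = M.primalEdge e.2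

/-- Mesh regularity: every element is star-shaped with respect to the ball of radius `ρB * h_T`
about its selected point, every edge has length at least `ρE * h_T`, and every interior angle
is at most `π - θ`. -/
def IsRegular (ρB ρE θ : ℝ) : Prop :=
  ∀ K : Fin M.card,
    (∀ y ∈ Metric.ball (M.center K) (ρB * (M.elem K).diam), StarConvex ℝ y (M.elem K).carrier) ∧
    (∀ i, ρE * (M.elem K).diam ≤ (M.elem K).edgeLength i) ∧
    (∀ i, EuclideanGeometry.angle ((M.elem K).vert (i - 1)) ((M.elem K).vert i)
      ((M.elem K).vert (i + 1)) ≤ Real.pi - θ)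

/-! ### Discrete spaces

Piecewise constant functions are represented by their values on the triangles (on the elements, for
the pressure). -/

/-- The velocity space `S_h`: constant on the dual elements `D(e)`, and zero on `D(e)` if `e` is a
boundary edge. -/
def IsVelocity (v : M.Tri → Plane) : Prop :=
  (∀ s t, M.primalEdge s = M.primalEdge t → v s = v t) ∧
    ∀ s, M.primalEdge s ⊆ frontier Ω → v s = 0

/-- The velocity gradient space `V_h`: the jump of `ψ n` vanishes on all the dual edges. -/
def IsGradient (ψ : M.Tri → Matrix (Fin 2) (Fin 2) ℝ) : Prop :=
  ∀ s, Matrix.toEuclideanLin (ψ (M.prevTri s)) (M.dualNormal s) =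
    Matrix.toEuclideanLin (ψ s) (M.dualNormal s)

/-- The pressure space `P_h`: constant on the elements, with mean value zero. -/
def IsPressure (q : Fin M.card → ℝ) : Prop := ∑ K, (M.elem K).area * q K = 0

/-- The jump `[v] = v|_{τ₁} - v|_{τ₂}` on a dual edge. -/
def dualJump (v : M.Tri → Plane) (s : M.Tri) : Plane := v (M.prevTri s) - v s

/-- The discrete `H¹` norm: `‖v‖_h² = ∑_{e dual} h_e⁻¹ ‖[v]‖²_{0,e}`, where `h_e = |e|`. -/
noncomputable def hNorm (v : M.Tri → Plane) : ℝ :=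
  √(∑ s, (M.dualLength s)⁻¹ * (M.dualLength s * ‖M.dualJump v s‖ ^ 2))

/-- The `L²` inner product of piecewise constant matrix fields. -/
noncomputable def matInner (ω ψ : M.Tri → Matrix (Fin 2) (Fin 2) ℝ) : ℝ :=
  ∑ s, M.triArea s * ∑ i, ∑ j, ω s i j * ψ s i j

/-- The velocity reconstruction `Π^{RT} v = ∑_i r_i(v) φ_i` on the element `K`, where `r_i(v)` is
the mean value over `e_i` of `v · n_i`, which is constant along `e_i`. -/
noncomputable def recon (v : M.Tri → Plane) (K : Fin M.card) (x : Plane) : Plane :=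
  ∑ i, ⟪v ⟨K, i⟩, (M.elem K).normal i⟫ • (M.elem K).basisFun (M.center K) i x

/-- The load functional `(f, Π^{RT} v)`. -/
noncomputable def load (f : Plane → Plane) (v : M.Tri → Plane) : ℝ :=
  ∑ K, ∫ x in interior (M.elem K).carrier, ⟪f x, M.recon v K x⟫

/-- `B_h(ω, v) = -∑_{e dual} (ω n, [v])_e`. -/
noncomputable def formB (ω : M.Tri → Matrix (Fin 2) (Fin 2) ℝ) (v : M.Tri → Plane) : ℝ :=
  -∑ s, M.dualLength s * ⟪Matrix.toEuclideanLin (ω s) (M.dualNormal s), M.dualJump v s⟫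

/-- `B_h^*(u, ψ) = ∑_{e interior primal} (u, [ψ n])_e`. -/
noncomputable def formBstar (u : M.Tri → Plane) (ψ : M.Tri → Matrix (Fin 2) (Fin 2) ℝ) : ℝ :=
  ∑ e ∈ M.interiorEdges, M.primalLength e.1 *
    ⟪u e.1, Matrix.toEuclideanLin (ψ e.1) (M.primalNormal e.1) -
      Matrix.toEuclideanLin (ψ e.2) (M.primalNormal e.1)⟫

/-- `b_h^*(p, v) = -∑_T (p, ∇ · Π^{RT} v)_T`. -/
noncomputable def formbstar (p : Fin M.card → ℝ) (v : M.Tri → Plane) : ℝ :=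
  -∑ K, ∫ x in interior (M.elem K).carrier, p K * div (M.recon v K) x

/-- `b_h(u, q) = -∑_{e interior primal} (u · n, [q])_e`. -/
noncomputable def formb (u : M.Tri → Plane) (q : Fin M.card → ℝ) : ℝ :=
  -∑ e ∈ M.interiorEdges, M.primalLength e.1 *
    (⟪u e.1, M.primalNormal e.1⟫ * (q e.1.1 - q e.2.1))

/-- `(ω, u, p) ∈ V_h × S_h × P_h` solves the discrete problem with viscosity `ν` and force `f`. -/
structure IsSolution (ν : ℝ) (f : Plane → Plane) (ω : M.Tri → Matrix (Fin 2) (Fin 2) ℝ)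
    (u : M.Tri → Plane) (p : Fin M.card → ℝ) : Prop where
  gradient_mem : M.IsGradient ω
  velocity_mem : M.IsVelocity u
  pressure_mem : M.IsPressure p
  momentum : ∀ v, M.IsVelocity v → M.formB ω v + M.formbstar p v = M.load f v
  constitutive : ∀ ψ, M.IsGradient ψ → M.formBstar u ψ = ν⁻¹ * M.matInner ω ψ
  incompressible : ∀ q, M.IsPressure q → M.formb u q = 0

end StaggeredMesh

end PRSDG

/-!
The bound is an energy estimate, made independent of the gradient part of the force by the
orthogonality of `Π^{RT} u_h` to all gradients.

*Energy.* `B_h` and `B_h^*` are adjoint (`formBstar_eq_formB`), because the outer normals of a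
triangle, weighted with the edge lengths, add up to zero. The incompressibility condition makes the
total flux of `u_h` out of each element vanish (`sum_flux_eq_zero`). Then the affine parts of the
basis functions cancel, and on each element `Π^{RT} u_h` is the curl of the Wachspress interpolant
of vertex values whose increments along the edges are minus the fluxes (`recon_eq`,
`streamCoeff_succ_sub`). It is therefore divergence-free, the pressure term drops out, and testing
with `u_h` gives `ν⁻¹ ‖ω_h‖² = (f, Π^{RT} u_h)`. An explicit test field in `V_h` gives
`‖u_h‖_h ≤ C ν⁻¹ ‖ω_h‖` (`hNorm_le_of_constitutive`).

*Orthogonality to gradients* (`sum_integral_inner_recon_eq_zero`). Around any point `x` the stream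
functions of the adjacent elements, normalized to vanish at `x`, agree along common edges and vanish
on `∂Ω`, by continuity of the normal fluxes. Glued together they form a Lipschitz function which
vanishes off `Ω` (`exists_local_stream`). The curl of such a function is orthogonal to `∇(θ χ)` for
`χ ∈ H¹(Ω)` and smooth `θ`: after a cutoff near `∂Ω` and mollification it is the curl of a test
function. Summation over a smooth partition of unity `θ` gives the claim without any topological
assumption on `Ω`.

*Bound for the load.* Linear precision of the Wachspress coordinates turns a lower bound `c h_T`
for the distances of the vertices from the other edges into `|∇λ_k| ≤ C / h_T`
(`HeightBound.norm_grad_wachspress_le`); the lower bound follows from shape regularity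
(`heightBound_of_regular`), and it also limits the number of vertices (`HeightBound.card_le`). Hence
`‖Π^{RT} u_h‖² ≤ C ∑_s h_s² |u_s|²`, and a discrete Poincaré inequality, obtained from `div x = 2`
and elementwise integration by parts (`sum_triDet_mul_normSq`), bounds this by `C ‖u_h‖_h²`.
-/

namespace PRSDG

/-! ### Plane vectors -/

theorem inner_plane (a b : Plane) : ⟪a, b⟫ = a 0 * b 0 + a 1 * b 1 := by
  simp [PiLp.inner_apply, Fin.sum_univ_two, mul_comm]

theorem norm_sq_plane (a : Plane) : ‖a‖ ^ 2 = a 0 ^ 2 + a 1 ^ 2 := by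
  simp [EuclideanSpace.norm_sq_eq, Fin.sum_univ_two]

theorem plane_ext {a b : Plane} (h0 : a 0 = b 0) (h1 : a 1 = b 1) : a = b := by
  ext i; fin_cases i <;> assumption

@[simp] theorem rot_zero_coord (a : Plane) : rot a 0 = -(a 1) := rfl

@[simp] theorem rot_one_coord (a : Plane) : rot a 1 = a 0 := rfl

theorem norm_rot (a : Plane) : ‖rot a‖ = ‖a‖ := by
  have h : ‖rot a‖ ^ 2 = ‖a‖ ^ 2 := by
    rw [norm_sq_plane, norm_sq_plane, rot_zero_coord, rot_one_coord]; ring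
  exact (sq_eq_sq₀ (norm_nonneg _) (norm_nonneg _)).1 h

theorem det2_sq_add_inner_sq (a b : Plane) :
    det2 a b ^ 2 + ⟪a, b⟫ ^ 2 = ‖a‖ ^ 2 * ‖b‖ ^ 2 := by
  rw [inner_plane, norm_sq_plane, norm_sq_plane, det2]; ring

theorem abs_det2_le (a b : Plane) : |det2 a b| ≤ ‖a‖ * ‖b‖ := by
  refine abs_le_of_sq_le_sq ?_ (by positivity)
  rw [mul_pow, ← det2_sq_add_inner_sq]
  nlinarith [sq_nonneg (⟪a, b⟫)]

/-- Rotation by a right angle, as a linear map. -/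
noncomputable def rotL : Plane →ₗ[ℝ] Plane where
  toFun := rot
  map_add' a b := plane_ext (by simp; ring) (by simp)
  map_smul' c a := plane_ext (by simp) (by simp)

theorem rotL_apply (a : Plane) : rotL a = rot a := rfl

theorem rot_sum_smul {ι : Type*} (s : Finset ι) (c : ι → ℝ) (a : ι → Plane) :
    rot (∑ i ∈ s, c i • a i) = ∑ i ∈ s, c i • rot (a i) := by
  simp [← rotL_apply]

theorem rot_sub (a b : Plane) : rot (a - b) = rot a - rot b := by simp [← rotL_apply]

theorem rot_neg (a : Plane) : rot (-a) = -rot a := by simp [← rotL_apply]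

theorem fin_sub_one_add_one {n : ℕ} (i : Fin (n + 3)) : i - 1 + 1 = i := sub_add_cancel i 1

theorem fin_add_one_ne {n : ℕ} (i : Fin (n + 3)) : i + 1 ≠ i := by
  intro h; exact absurd (add_eq_left.1 h) (by simp)

theorem fin_add_two_ne {n : ℕ} (i : Fin (n + 3)) : i + 1 + 1 ≠ i := by
  intro h
  rw [add_assoc] at h
  have := add_eq_left.1 h
  rw [Fin.ext_iff, Fin.val_add] at this
  simp only [Fin.val_one, Nat.reduceAdd, Fin.val_zero] at this
  rw [Nat.mod_eq_of_lt (by omega)] at this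
  omega

theorem fin_sub_one_ne {n : ℕ} (i : Fin (n + 3)) : i - 1 ≠ i := by
  intro h; exact fin_add_one_ne (i - 1) (by rw [fin_sub_one_add_one]; exact h.symm)

theorem fin_sub_one_ne_add_one {n : ℕ} (i : Fin (n + 3)) : i - 1 ≠ i + 1 := by
  intro h; exact fin_add_two_ne (i - 1) (by rw [fin_sub_one_add_one]; exact h.symm)

namespace ConvexPolygon

variable (T : ConvexPolygon)

/-! ### Half-plane description of a convex polygon -/

theorem vert_succ_ne (i : T.Idx) : T.vert (i + 1) ≠ T.vert i := by
  intro h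
  have := T.convex_ccw i (i - 1) (fin_sub_one_ne i) (fin_sub_one_ne_add_one i)
  rw [h] at this
  simp [det2] at this

theorem edgeLength_pos (i : T.Idx) : 0 < T.edgeLength i :=
  dist_pos.2 (T.vert_succ_ne i).symm

theorem edgeLength_eq_norm (i : T.Idx) : T.edgeLength i = ‖T.vert (i + 1) - T.vert i‖ := by
  rw [edgeLength, dist_comm, dist_eq_norm]

theorem normal_zero_coord (i : T.Idx) :
    T.normal i 0 = (T.edgeLength i)⁻¹ * (T.vert (i + 1) 1 - T.vert i 1) := by
  simp [normal]; ring

theorem normal_one_coord (i : T.Idx) :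
    T.normal i 1 = -((T.edgeLength i)⁻¹ * (T.vert (i + 1) 0 - T.vert i 0)) := by
  simp [normal]

theorem edgeLength_smul_normal (i : T.Idx) :
    T.edgeLength i • T.normal i = -rot (T.vert (i + 1) - T.vert i) := by
  rw [normal, smul_smul, mul_inv_cancel₀ (T.edgeLength_pos i).ne', one_smul]

theorem norm_normal (i : T.Idx) : ‖T.normal i‖ = 1 := by
  rw [normal, norm_smul, norm_neg, norm_rot, norm_inv, ← edgeLength_eq_norm, Real.norm_eq_abs,
    abs_of_pos (T.edgeLength_pos i), inv_mul_cancel₀ (T.edgeLength_pos i).ne']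

theorem edgeDist_eq (i : T.Idx) (x : Plane) :
    T.edgeDist i x = (T.edgeLength i)⁻¹ * det2 (T.vert (i + 1) - T.vert i) (x - T.vert i) := by
  rw [edgeDist, inner_plane, normal_zero_coord, normal_one_coord, det2]
  simp; ring

theorem edgeLength_mul_edgeDist (i : T.Idx) (x : Plane) :
    T.edgeLength i * T.edgeDist i x = det2 (T.vert (i + 1) - T.vert i) (x - T.vert i) := by
  rw [edgeDist_eq, ← mul_assoc, mul_inv_cancel₀ (T.edgeLength_pos i).ne', one_mul]

theorem edgeDist_vert_self (i : T.Idx) : T.edgeDist i (T.vert i) = 0 := by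
  rw [edgeDist_eq]; simp [det2]

theorem edgeDist_vert_succ (i : T.Idx) : T.edgeDist i (T.vert (i + 1)) = 0 := by
  rw [edgeDist_eq]; simp [det2]; right; ring

theorem edgeDist_vert_pos {i k : T.Idx} (h1 : k ≠ i) (h2 : k ≠ i + 1) :
    0 < T.edgeDist i (T.vert k) := by
  rw [edgeDist_eq]
  exact mul_pos (inv_pos.2 (T.edgeLength_pos i)) (T.convex_ccw i k h1 h2)

theorem edgeDist_vert_nonneg (i k : T.Idx) : 0 ≤ T.edgeDist i (T.vert k) := by
  by_cases h1 : k = i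
  · rw [h1, edgeDist_vert_self]
  · by_cases h2 : k = i + 1
    · rw [h2, edgeDist_vert_succ]
    · exact (T.edgeDist_vert_pos h1 h2).le

theorem edgeDist_add (i : T.Idx) (x y : Plane) :
    T.edgeDist i (x + y) = T.edgeDist i x - ⟪y, T.normal i⟫ := by
  rw [edgeDist, edgeDist, ← inner_sub_left]; congr 1; abel

theorem edgeDist_affine (i : T.Idx) {ι : Type*} (s : Finset ι) (c : ι → ℝ) (z : ι → Plane)
    (hc : ∑ k ∈ s, c k = 1) :
    T.edgeDist i (∑ k ∈ s, c k • z k) = ∑ k ∈ s, c k * T.edgeDist i (z k) := by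
  simp only [edgeDist, inner_sub_left, mul_sub, Finset.sum_sub_distrib, ← Finset.sum_mul, hc,
    one_mul, sum_inner, inner_smul_left]
  simp

theorem edgeDist_combo (i : T.Idx) (x y : Plane) {a b : ℝ} (hab : a + b = 1) :
    T.edgeDist i (a • x + b • y) = a * T.edgeDist i x + b * T.edgeDist i y := by
  have hb : b = 1 - a := by linarith
  subst hb
  simp only [edgeDist_eq, det2]
  simp
  ring

theorem continuous_edgeDist (i : T.Idx) : Continuous (T.edgeDist i) := by
  unfold edgeDist; fun_prop

theorem vert_mem_carrier (i : T.Idx) : T.vert i ∈ T.carrier :=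
  subset_convexHull ℝ _ ⟨i, rfl⟩

theorem convex_carrier : Convex ℝ T.carrier := convex_convexHull ℝ _

theorem isCompact_carrier : IsCompact T.carrier :=
  (Set.finite_range T.vert).isCompact_convexHull ℝ

theorem isClosed_carrier : IsClosed T.carrier := T.isCompact_carrier.isClosed

theorem mem_carrier_iff_exists {x : Plane} : x ∈ T.carrier ↔
    ∃ c : T.Idx → ℝ, (∀ k, 0 ≤ c k) ∧ ∑ k, c k = 1 ∧ ∑ k, c k • T.vert k = x := by
  constructor
  · intro hx
    rw [carrier, convexHull_range_eq_exists_affineCombination] at hx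
    obtain ⟨s, w, hw0, hw1, hx⟩ := hx
    classical
    refine ⟨fun k => if k ∈ s then w k else 0, fun k => ?_, ?_, ?_⟩
    · dsimp only; split_ifs with h
      exacts [hw0 k h, le_rfl]
    · simp [hw1]
    · rw [s.affineCombination_eq_linear_combination _ _ hw1] at hx
      simp [← hx, ite_smul]
  · rintro ⟨c, h0, h1, rfl⟩
    exact T.convex_carrier.sum_mem (fun k _ => h0 k) h1 (fun k _ => T.vert_mem_carrier k)

theorem edgeDist_nonneg_of_mem {x : Plane} (hx : x ∈ T.carrier) (i : T.Idx) :
    0 ≤ T.edgeDist i x := by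
  obtain ⟨c, h0, h1, rfl⟩ := T.mem_carrier_iff_exists.1 hx
  rw [T.edgeDist_affine i _ _ _ h1]
  exact Finset.sum_nonneg fun k _ => mul_nonneg (h0 k) (T.edgeDist_vert_nonneg i k)

/-- Barycentric weights of a point on the line through `e_i` live on the two end points. -/
theorem eq_combo_of_edgeDist_eq_zero {c : T.Idx → ℝ} (h0 : ∀ k, 0 ≤ c k) (h1 : ∑ k, c k = 1)
    {i : T.Idx} (hd : T.edgeDist i (∑ k, c k • T.vert k) = 0) :
    (∀ k, k ≠ i → k ≠ i + 1 → c k = 0) ∧ c i + c (i + 1) = 1 ∧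
      ∑ k, c k • T.vert k = c i • T.vert i + c (i + 1) • T.vert (i + 1) := by
  rw [T.edgeDist_affine i _ _ _ h1] at hd
  have hz : ∀ k, k ≠ i → k ≠ i + 1 → c k = 0 := by
    intro k hk1 hk2
    have := (Finset.sum_eq_zero_iff_of_nonneg
      (fun k _ => mul_nonneg (h0 k) (T.edgeDist_vert_nonneg i k))).1 hd k (Finset.mem_univ k)
    exact (mul_eq_zero.1 this).resolve_right (T.edgeDist_vert_pos hk1 hk2).ne'
  refine ⟨hz, ?_, ?_⟩
  · rw [← h1, Finset.sum_eq_add (a := i) (b := i + 1) (fin_add_one_ne i).symm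
      (fun k _ hk => hz k hk.1 hk.2) (by simp) (by simp)]
  · rw [Finset.sum_eq_add (a := i) (b := i + 1) (fin_add_one_ne i).symm
      (fun k _ hk => by rw [hz k hk.1 hk.2, zero_smul]) (by simp) (by simp)]

theorem mem_edge_iff {x : Plane} {i : T.Idx} :
    x ∈ T.edge i ↔ x ∈ T.carrier ∧ T.edgeDist i x = 0 := by
  constructor
  · intro hx
    have hx' := T.convex_carrier.segment_subset (T.vert_mem_carrier i) (T.vert_mem_carrier (i + 1))
      hx
    obtain ⟨a, b, _, _, hab, rfl⟩ := hx
    exact ⟨hx', by rw [T.edgeDist_combo i _ _ hab, edgeDist_vert_self, edgeDist_vert_succ]; simp⟩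
  · rintro ⟨hx, hd⟩
    obtain ⟨c, h0, h1, rfl⟩ := T.mem_carrier_iff_exists.1 hx
    obtain ⟨-, h2, h3⟩ := T.eq_combo_of_edgeDist_eq_zero h0 h1 hd
    rw [h3]
    exact ⟨_, _, h0 _, h0 _, h2, rfl⟩

theorem edge_subset_carrier (i : T.Idx) : T.edge i ⊆ T.carrier := fun _ hx =>
  (T.mem_edge_iff.1 hx).1

theorem isClosed_edge (i : T.Idx) : IsClosed (T.edge i) := by
  have : T.edge i = T.carrier ∩ {x | T.edgeDist i x = 0} := by
    ext x; exact T.mem_edge_iff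
  rw [this]
  exact T.isClosed_carrier.inter (isClosed_eq (T.continuous_edgeDist i) continuous_const)

theorem vert_mem_edge (i : T.Idx) : T.vert i ∈ T.edge i := left_mem_segment ℝ _ _

theorem vert_succ_mem_edge (i : T.Idx) : T.vert (i + 1) ∈ T.edge i := right_mem_segment ℝ _ _

theorem vert_mem_edge_iff {i k : T.Idx} : T.vert k ∈ T.edge i ↔ k = i ∨ k = i + 1 := by
  constructor
  · intro h
    by_contra! hk
    exact (T.edgeDist_vert_pos hk.1 hk.2).ne' (T.mem_edge_iff.1 h).2
  · rintro (rfl | rfl)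
    exacts [T.vert_mem_edge _, T.vert_succ_mem_edge _]

theorem edge_injective : Function.Injective T.edge := by
  intro i j h
  have h1 := T.vert_mem_edge_iff.1 (h ▸ T.vert_mem_edge i)
  have h2 := T.vert_mem_edge_iff.1 (h ▸ T.vert_succ_mem_edge i)
  rcases h1 with h1 | h1
  · exact h1
  · rcases h2 with h2 | h2
    · rw [h1] at h2
      exact absurd h2 (fin_add_two_ne j)
    · exact add_right_cancel h2

theorem edgeDist_pos_of_mem_interior {x : Plane} (hx : x ∈ interior T.carrier) (i : T.Idx) :
    0 < T.edgeDist i x := by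
  rw [mem_interior_iff_mem_nhds, Metric.mem_nhds_iff] at hx
  obtain ⟨r, hr, hb⟩ := hx
  have hmem : x + (r / 2) • T.normal i ∈ T.carrier := hb (by
    rw [Metric.mem_ball, dist_eq_norm, add_sub_cancel_left, norm_smul, norm_normal, mul_one,
      Real.norm_eq_abs, abs_of_pos (by positivity)]
    linarith)
  have := T.edgeDist_nonneg_of_mem hmem i
  rw [edgeDist_add, inner_smul_left, real_inner_self_eq_norm_sq, norm_normal] at this
  simp at this
  linarith

/-! ### Wachspress coordinates: partition of unity and linear precision -/

theorem normal_det_pos (i : T.Idx) : 0 < det2 (T.normal (i - 1)) (T.normal i) := by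
  have h := T.convex_ccw (i - 1) (i + 1) (fin_sub_one_ne_add_one i).symm
    (by rw [fin_sub_one_add_one]; exact fin_add_one_ne i)
  rw [fin_sub_one_add_one] at h
  have : det2 (T.normal (i - 1)) (T.normal i) = (T.edgeLength (i - 1))⁻¹ * (T.edgeLength i)⁻¹ *
      det2 (T.vert i - T.vert (i - 1)) (T.vert (i + 1) - T.vert (i - 1)) := by
    simp only [det2, normal_zero_coord, normal_one_coord, fin_sub_one_add_one]
    simp; ring
  rw [this]
  have h1 := T.edgeLength_pos (i - 1)
  have h2 := T.edgeLength_pos i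
  positivity

theorem weight_eq (i : T.Idx) (x : Plane) : T.weight i x =
    det2 (T.normal (i - 1)) (T.normal i) * ((T.edgeDist (i - 1) x)⁻¹ * (T.edgeDist i x)⁻¹) := by
  simp only [weight, scaledNormal, det2]; simp; ring

variable {T} {x : Plane}

theorem weight_pos (hx : ∀ i, 0 < T.edgeDist i x) (i : T.Idx) : 0 < T.weight i x := by
  rw [weight_eq]
  exact mul_pos (T.normal_det_pos i) (mul_pos (inv_pos.2 (hx _)) (inv_pos.2 (hx _)))

theorem sum_weight_pos (hx : ∀ i, 0 < T.edgeDist i x) : 0 < ∑ j, T.weight j x :=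
  Finset.sum_pos (fun i _ => weight_pos hx i) Finset.univ_nonempty

theorem wachspress_nonneg (hx : ∀ i, 0 < T.edgeDist i x) (i : T.Idx) : 0 ≤ T.wachspress i x :=
  div_nonneg (weight_pos hx i).le (sum_weight_pos hx).le

theorem sum_wachspress (hx : ∀ i, 0 < T.edgeDist i x) : ∑ i, T.wachspress i x = 1 := by
  simp only [wachspress, ← Finset.sum_div]
  exact div_self (sum_weight_pos hx).ne'

/-- `v_i - x` is the solution `p` of `p · ñ_{i-1} = 1 = p · ñ_i`, so `w_i(x) (v_i - x)` is a
difference of consecutive rotated scaled normals. -/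
theorem weight_smul_vert_sub (hx : ∀ i, 0 < T.edgeDist i x) (i : T.Idx) :
    T.weight i x • (T.vert i - x) = rot (T.scaledNormal (i - 1) x) - rot (T.scaledNormal i x) := by
  have key : ∀ p a b : Plane, ⟪p, a⟫ = 1 → ⟪p, b⟫ = 1 → det2 a b • p = rot a - rot b := by
    intro p a b ha hb
    rw [inner_plane] at ha hb
    refine plane_ext ?_ ?_ <;> simp [det2]
    · linear_combination b 1 * ha - a 1 * hb
    · linear_combination (-b 0) * ha + a 0 * hb
  refine key _ _ _ ?_ ?_
  · have h : ⟪T.vert i - x, T.normal (i - 1)⟫ = T.edgeDist (i - 1) x := by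
      have h2 := T.edgeDist_vert_succ (i - 1)
      rw [fin_sub_one_add_one, edgeDist] at h2
      rw [edgeDist, ← sub_eq_zero, ← inner_sub_left, ← neg_eq_zero, ← inner_neg_left, ← h2]
      congr 1; abel
    rw [scaledNormal, inner_smul_right, h, inv_mul_cancel₀ (hx _).ne']
  · rw [scaledNormal, inner_smul_right]
    exact inv_mul_cancel₀ (hx i).ne'

theorem sum_wachspress_smul_vert (hx : ∀ i, 0 < T.edgeDist i x) :
    ∑ i, T.wachspress i x • T.vert i = x := by
  have h0 : ∑ i, T.weight i x • (T.vert i - x) = 0 := by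
    simp only [weight_smul_vert_sub hx, Finset.sum_sub_distrib]
    rw [sub_eq_zero]
    exact Equiv.sum_comp (Equiv.subRight (1 : T.Idx)) fun i => rot (T.scaledNormal i x)
  have h1 : ∑ i, T.wachspress i x • (T.vert i - x) = 0 := by
    have : ∀ i, T.wachspress i x • (T.vert i - x) =
        (∑ j, T.weight j x)⁻¹ • (T.weight i x • (T.vert i - x)) := fun i => by
      rw [smul_smul, wachspress, div_eq_inv_mul]
    simp only [this, ← Finset.smul_sum, h0, smul_zero]
  simpa [smul_sub, Finset.sum_sub_distrib, ← Finset.sum_smul, sum_wachspress hx, sub_eq_zero]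
    using h1

variable (T)

/-- Half of the half-plane description: where all the edge distances are positive, the Wachspress
coordinates exhibit the point as a convex combination of the vertices. -/
theorem mem_carrier_of_edgeDist_pos (hx : ∀ i, 0 < T.edgeDist i x) : x ∈ T.carrier :=
  T.mem_carrier_iff_exists.2
    ⟨fun i => T.wachspress i x, wachspress_nonneg hx, sum_wachspress hx,
      sum_wachspress_smul_vert hx⟩

theorem isOpen_edgeDist_pos : IsOpen {x | ∀ i, 0 < T.edgeDist i x} := by
  simp only [Set.ofPred_forall]
  exact isOpen_iInter_of_finite fun i => isOpen_lt continuous_const (T.continuous_edgeDist i)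

theorem mem_interior_iff : x ∈ interior T.carrier ↔ ∀ i, 0 < T.edgeDist i x :=
  ⟨fun h => T.edgeDist_pos_of_mem_interior h, fun h =>
    interior_maximal (fun _ hy => T.mem_carrier_of_edgeDist_pos hy) T.isOpen_edgeDist_pos h⟩

variable {T}

/-- The half-plane description of the closed polygon; the hypothesis `hy` supplies an interior
point to move towards, where all the edge distances are positive. -/
theorem mem_carrier_iff {y : Plane} (hy : y ∈ interior T.carrier) :
    x ∈ T.carrier ↔ ∀ i, 0 ≤ T.edgeDist i x := by
  refine ⟨fun h => T.edgeDist_nonneg_of_mem h, fun h => ?_⟩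
  have hlim : Tendsto (fun t : ℝ => (1 - t) • x + t • y) (𝓝[>] 0) (𝓝 x) := by
    have : Tendsto (fun t : ℝ => (1 - t) • x + t • y) (𝓝 0) (𝓝 ((1 - (0 : ℝ)) • x + (0 : ℝ) • y)) :=
      Continuous.tendsto (by fun_prop) 0
    simp only [sub_zero, one_smul, zero_smul, add_zero] at this
    exact this.mono_left nhdsWithin_le_nhds
  refine T.isClosed_carrier.mem_of_tendsto hlim ?_
  filter_upwards [Ioo_mem_nhdsGT (zero_lt_one' ℝ)] with t ht
  refine T.mem_carrier_of_edgeDist_pos fun i => ?_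
  rw [T.edgeDist_combo i _ _ (by ring)]
  have := T.edgeDist_pos_of_mem_interior hy i
  have h1 : 0 < 1 - t := by linarith [ht.2]
  have h2 := ht.1
  have := h i
  positivity

theorem exists_mem_edge_of_mem_diff_interior (hx : x ∈ T.carrier) (hx' : x ∉ interior T.carrier) :
    ∃ i, x ∈ T.edge i := by
  rw [mem_interior_iff] at hx'
  push Not at hx'
  obtain ⟨i, hi⟩ := hx'
  exact ⟨i, T.mem_edge_iff.2 ⟨hx, le_antisymm hi (T.edgeDist_nonneg_of_mem hx i)⟩⟩

end ConvexPolygon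

/-! ### Gradients of the Wachspress coordinates -/

/-- The linear functional `v ↦ ⟪a, v⟫`. -/
noncomputable abbrev innerL (a : Plane) : Plane →L[ℝ] ℝ := innerSL ℝ a

theorem grad_eq_of_hasFDerivAt {φ : Plane → ℝ} {x a : Plane} (h : HasFDerivAt φ (innerL a) x) :
    grad φ x = a := by
  rw [grad, h.fderiv]
  refine plane_ext ?_ ?_ <;> simp [innerL, unitVec, inner_plane]

theorem inner_grad (φ : Plane → ℝ) (x v : Plane) : ⟪grad φ x, v⟫ = fderiv ℝ φ x v := by
  have hv : v = v 0 • unitVec 0 + v 1 • unitVec 1 :=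
    plane_ext (by simp [unitVec]) (by simp [unitVec])
  conv_rhs => rw [hv]
  rw [inner_plane, map_add, map_smul, map_smul]
  simp [grad, mul_comm]

theorem hasFDerivAt_grad {φ : Plane → ℝ} {x : Plane} (h : DifferentiableAt ℝ φ x) :
    HasFDerivAt φ (innerL (grad φ x)) x := by
  convert h.hasFDerivAt using 1
  ext v
  exact inner_grad φ x v

theorem norm_grad (φ : Plane → ℝ) (x : Plane) : ‖grad φ x‖ = ‖fderiv ℝ φ x‖ := by
  have : fderiv ℝ φ x = innerL (grad φ x) := by
    ext v; exact (inner_grad φ x v).symm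
  rw [this, innerL, innerSL_apply_norm]

namespace ConvexPolygon

variable {T : ConvexPolygon} {x : Plane}

/-- `R_k = ñ_{k-1} + ñ_k`, the logarithmic gradient of the Wachspress weight of `v_k`. -/
noncomputable def logGrad (T : ConvexPolygon) (k : T.Idx) (x : Plane) : Plane :=
  T.scaledNormal (k - 1) x + T.scaledNormal k x

theorem hasFDerivAt_edgeDist (i : T.Idx) (x : Plane) :
    HasFDerivAt (T.edgeDist i) (innerL (-T.normal i)) x := by
  have h : HasFDerivAt (fun x => ⟪T.normal i, T.vert i⟫ - innerL (T.normal i) x)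
      (-innerL (T.normal i)) x :=
    ((innerL (T.normal i)).hasFDerivAt.const_sub _)
  convert h using 1
  · ext y
    rw [edgeDist, real_inner_comm, inner_sub_right]; rfl
  · ext v; simp [innerL]

theorem hasFDerivAt_weight (hx : ∀ i, 0 < T.edgeDist i x) (k : T.Idx) :
    HasFDerivAt (T.weight k) (innerL (T.weight k x • T.logGrad k x)) x := by
  have hinv : ∀ i, HasFDerivAt (fun y => (T.edgeDist i y)⁻¹)
      (innerL ((T.edgeDist i x)⁻¹ • T.scaledNormal i x)) x := fun i => by
    have := (hasDerivAt_inv (hx i).ne').comp_hasFDerivAt x (hasFDerivAt_edgeDist i x)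
    refine this.congr_fderiv ?_
    ext v
    simp [innerL, scaledNormal]
    ring
  have h := ((hinv (k - 1)).fun_mul (hinv k)).const_mul (det2 (T.normal (k - 1)) (T.normal k))
  have hw : T.weight k = fun y => det2 (T.normal (k - 1)) (T.normal k) *
      ((T.edgeDist (k - 1) y)⁻¹ * (T.edgeDist k y)⁻¹) := by
    ext y; exact T.weight_eq k y
  rw [hw]
  refine h.congr_fderiv ?_
  ext v
  simp [innerL, logGrad]
  ring

theorem hasFDerivAt_wachspress (hx : ∀ i, 0 < T.edgeDist i x) (k : T.Idx) :
    HasFDerivAt (T.wachspress k) (innerL (T.wachspress k x •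
      ∑ j, T.wachspress j x • (T.logGrad k x - T.logGrad j x))) x := by
  have hS : HasFDerivAt (fun y => ∑ j, T.weight j y)
      (∑ j, innerL (T.weight j x • T.logGrad j x)) x :=
    HasFDerivAt.fun_sum fun j _ => hasFDerivAt_weight hx j
  have hW := (sum_weight_pos hx).ne'
  have h := (hasFDerivAt_weight hx k).fun_mul ((hasDerivAt_inv hW).comp_hasFDerivAt x hS)
  have hl : T.wachspress k = fun y => T.weight k y * (∑ j, T.weight j y)⁻¹ := by
    ext y; exact div_eq_mul_inv _ _
  rw [hl]
  refine h.congr_fderiv ?_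
  have h1 := sum_wachspress hx
  have h2 : ∑ j, T.wachspress j x • (T.logGrad k x - T.logGrad j x) =
      T.logGrad k x - ∑ j, T.wachspress j x • T.logGrad j x := by
    simp only [smul_sub, Finset.sum_sub_distrib, ← Finset.sum_smul, h1, one_smul]
  rw [h2]
  ext v
  simp only [innerL, wachspress, map_smul, map_sub, map_sum, FunLike.coe_smul, Pi.smul_apply,
    FunLike.coe_sub, Pi.sub_apply, FunLike.coe_add, Pi.add_apply, Function.comp_apply, smul_eq_mul, FunLike.coe_sum, Finset.sum_apply]
  have h3 : ∑ j, (T.weight j x / ∑ j, T.weight j x) * (innerSL ℝ (T.logGrad j x)) v =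
      (∑ j, T.weight j x)⁻¹ * ∑ j, T.weight j x * (innerSL ℝ (T.logGrad j x)) v := by
    rw [Finset.mul_sum]
    exact Finset.sum_congr rfl fun j _ => by ring
  rw [h3]
  field_simp
  ring

theorem contDiffAt_wachspress (hx : ∀ i, 0 < T.edgeDist i x) (k : T.Idx) :
    ContDiffAt ℝ 2 (T.wachspress k) x := by
  have hd : ∀ i, ContDiffAt ℝ 2 (T.edgeDist i) x := fun i => by
    unfold edgeDist
    exact ContDiffAt.inner ℝ (contDiffAt_const.sub contDiffAt_id) contDiffAt_const
  have hw : ∀ k, ContDiffAt ℝ 2 (T.weight k) x := fun k => by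
    have : T.weight k = fun y => det2 (T.normal (k - 1)) (T.normal k) *
        ((T.edgeDist (k - 1) y)⁻¹ * (T.edgeDist k y)⁻¹) := by
      ext y; exact T.weight_eq k y
    rw [this]
    exact contDiffAt_const.mul (((hd _).inv (hx _).ne').mul ((hd _).inv (hx _).ne'))
  exact (hw k).div (ContDiffAt.sum fun j _ => hw j) (sum_weight_pos hx).ne'

/-- `H` bounds from below the distances of the vertices from the lines through the edges not
containing them. -/
def HeightBound (T : ConvexPolygon) (H : ℝ) : Prop :=
  0 < H ∧ ∀ i k : T.Idx, k ≠ i → k ≠ i + 1 → H ≤ T.edgeDist i (T.vert k)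

/-- By linear precision `d_i(x) = ∑_k λ_k(x) d_i(v_k)`; this compensates the singularity of the
scaled normals in the gradients of the coordinates. -/
theorem HeightBound.wachspress_mul_le {H : ℝ} (hH : T.HeightBound H)
    (hx : ∀ i, 0 < T.edgeDist i x) {i k : T.Idx} (h1 : k ≠ i) (h2 : k ≠ i + 1) :
    T.wachspress k x * (T.edgeDist i x)⁻¹ ≤ H⁻¹ := by
  have h := T.edgeDist_affine i Finset.univ (fun k => T.wachspress k x) T.vert (sum_wachspress hx)
  rw [sum_wachspress_smul_vert hx] at h
  have h3 : T.wachspress k x * H ≤ T.edgeDist i x := by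
    rw [h]
    refine le_trans (mul_le_mul_of_nonneg_left (hH.2 i k h1 h2) (wachspress_nonneg hx k)) ?_
    exact Finset.single_le_sum (f := fun k => T.wachspress k x * T.edgeDist i (T.vert k))
      (fun k _ => mul_nonneg (wachspress_nonneg hx k) (T.edgeDist_vert_nonneg i k))
      (Finset.mem_univ k)
  rw [← div_eq_mul_inv, div_le_iff₀ (hx i), inv_mul_eq_div, le_div_iff₀ hH.1]
  exact h3

theorem wachspress_le_one (hx : ∀ i, 0 < T.edgeDist i x) (k : T.Idx) : T.wachspress k x ≤ 1 := by
  rw [← sum_wachspress hx]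
  exact Finset.single_le_sum (f := fun k => T.wachspress k x)
    (fun k _ => wachspress_nonneg hx k) (Finset.mem_univ k)

theorem norm_scaledNormal (hx : ∀ i, 0 < T.edgeDist i x) (i : T.Idx) :
    ‖T.scaledNormal i x‖ = (T.edgeDist i x)⁻¹ := by
  rw [scaledNormal, norm_smul, norm_normal, mul_one, Real.norm_eq_abs,
    abs_of_pos (inv_pos.2 (hx i))]

theorem logGrad_eq_sum (k : T.Idx) (x : Plane) :
    T.logGrad k x = ∑ i, if k = i ∨ k = i + 1 then T.scaledNormal i x else 0 := by
  rw [Finset.sum_eq_add (a := k - 1) (b := k) (fin_sub_one_ne k) ?_ (by simp) (by simp)]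
  · simp [logGrad]
  · intro i _ hi
    rw [if_neg]
    rintro (h | h)
    · exact hi.2 h.symm
    · exact hi.1 (by rw [h]; simp)

/-- The scaled normal of an edge containing both or none of `v_k`, `v_j` cancels in the difference;
otherwise one of the two coordinates compensates its length `1 / d_i`. -/
theorem HeightBound.norm_logGrad_sub_le {H : ℝ} (hH : T.HeightBound H)
    (hx : ∀ i, 0 < T.edgeDist i x) (k j : T.Idx) :
    T.wachspress k x * T.wachspress j x * ‖T.logGrad k x - T.logGrad j x‖ ≤
      ((T.extra + 3 : ℕ) : ℝ) * H⁻¹ := by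
  have hk := wachspress_nonneg hx k
  have hj := wachspress_nonneg hx j
  have hH0 := inv_pos.2 hH.1
  rw [logGrad_eq_sum, logGrad_eq_sum, ← Finset.sum_sub_distrib]
  calc _ ≤ T.wachspress k x * T.wachspress j x * ∑ i, ‖(if k = i ∨ k = i + 1 then
          T.scaledNormal i x else 0) - if j = i ∨ j = i + 1 then T.scaledNormal i x else 0‖ := by
        gcongr; exact norm_sum_le _ _
    _ ≤ ∑ i : T.Idx, H⁻¹ := by
        rw [Finset.mul_sum]
        refine Finset.sum_le_sum fun i _ => ?_
        by_cases h1 : k = i ∨ k = i + 1 <;> by_cases h2 : j = i ∨ j = i + 1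
        · rw [if_pos h1, if_pos h2, sub_self, norm_zero, mul_zero]; exact hH0.le
        · rw [if_pos h1, if_neg h2, sub_zero, norm_scaledNormal hx, mul_assoc]
          push Not at h2
          have h3 := hH.wachspress_mul_le hx h2.1 h2.2
          have h4 := wachspress_le_one hx k
          nlinarith [mul_nonneg hj (inv_pos.2 (hx i)).le]
        · rw [if_neg h1, if_pos h2, zero_sub, norm_neg, norm_scaledNormal hx, mul_right_comm]
          push Not at h1
          have h3 := hH.wachspress_mul_le hx h1.1 h1.2
          have h4 := wachspress_le_one hx j
          nlinarith [mul_nonneg hk (inv_pos.2 (hx i)).le]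
        · rw [if_neg h1, if_neg h2, sub_self, norm_zero, mul_zero]; exact hH0.le
    _ = _ := by simp

theorem HeightBound.norm_grad_wachspress_le {H : ℝ} (hH : T.HeightBound H)
    (hx : ∀ i, 0 < T.edgeDist i x) (k : T.Idx) :
    ‖grad (T.wachspress k) x‖ ≤ ((T.extra + 3 : ℕ) : ℝ) ^ 2 * H⁻¹ := by
  rw [grad_eq_of_hasFDerivAt (hasFDerivAt_wachspress hx k), Finset.smul_sum]
  calc _ ≤ ∑ j : T.Idx, ((T.extra + 3 : ℕ) : ℝ) * H⁻¹ := by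
        refine norm_sum_le_of_le _ fun j _ => ?_
        rw [smul_smul, norm_smul, Real.norm_eq_abs, abs_of_nonneg
          (mul_nonneg (wachspress_nonneg hx k) (wachspress_nonneg hx j))]
        exact hH.norm_logGrad_sub_le hx k j
    _ = _ := by simp; ring

theorem exists_heightBound (T : ConvexPolygon) : ∃ H, T.HeightBound H := by
  classical
  let s : Finset (T.Idx × T.Idx) := Finset.univ.filter fun p => p.2 ≠ p.1 ∧ p.2 ≠ p.1 + 1
  have hs : s.Nonempty := ⟨(0, 0 - 1), by
    simp only [s, Finset.mem_filter, Finset.mem_univ, true_and]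
    exact ⟨fin_sub_one_ne 0, fin_sub_one_ne_add_one 0⟩⟩
  obtain ⟨p, hp, hmin⟩ := s.exists_min_image (fun p => T.edgeDist p.1 (T.vert p.2)) hs
  simp only [s, Finset.mem_filter, Finset.mem_univ, true_and] at hp
  refine ⟨_, T.edgeDist_vert_pos hp.1 hp.2, fun i k h1 h2 => hmin (i, k) ?_⟩
  simp [s, h1, h2]

/-! ### Continuous extension of the coordinates to the closed polygon -/

theorem closure_interior_carrier {y : Plane} (hy : y ∈ interior T.carrier) :
    closure (interior T.carrier) = T.carrier := by
  rw [T.convex_carrier.closure_interior_eq_closure_of_nonempty_interior ⟨y, hy⟩,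
    T.isClosed_carrier.closure_eq]

theorem exists_lipschitz_wachspress (T : ConvexPolygon) (k : T.Idx) :
    ∃ (K : NNReal) (g : Plane → ℝ), LipschitzWith K g ∧
      Set.EqOn (T.wachspress k) g (interior T.carrier) := by
  obtain ⟨H, hH⟩ := T.exists_heightBound
  have : LipschitzOnWith (((T.extra + 3 : ℕ) : ℝ) ^ 2 * H⁻¹).toNNReal (T.wachspress k)
      (interior T.carrier) := by
    refine T.convex_carrier.interior.lipschitzOnWith_of_nnnorm_fderiv_le (𝕜 := ℝ)
      (fun x hx => (hasFDerivAt_wachspress (T.mem_interior_iff.1 hx) k).differentiableAt)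
      fun x hx => ?_
    rw [← NNReal.coe_le_coe, coe_nnnorm, ← norm_grad]
    exact (hH.norm_grad_wachspress_le (T.mem_interior_iff.1 hx) k).trans (Real.le_coe_toNNReal _)
  obtain ⟨g, hg, hg'⟩ := this.extend_real
  exact ⟨_, g, hg, hg'⟩

/-- A Lipschitz continuous function on the plane which agrees with the Wachspress coordinate `λ_k`
in the interior of `T`. -/
noncomputable def coord (T : ConvexPolygon) (k : T.Idx) : Plane → ℝ :=
  (T.exists_lipschitz_wachspress k).choose_spec.choose

theorem exists_lipschitzWith_coord (T : ConvexPolygon) (k : T.Idx) :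
    ∃ K, LipschitzWith K (T.coord k) :=
  ⟨_, (T.exists_lipschitz_wachspress k).choose_spec.choose_spec.1⟩

theorem coord_eq (k : T.Idx) (hx : x ∈ interior T.carrier) : T.coord k x = T.wachspress k x :=
  ((T.exists_lipschitz_wachspress k).choose_spec.choose_spec.2 hx).symm

theorem continuous_coord (k : T.Idx) : Continuous (T.coord k) :=
  (T.exists_lipschitzWith_coord k).choose_spec.continuous

/-- Nonnegativity, partition of unity and linear precision extend to the closed polygon by
continuity. -/
theorem coord_spec {y : Plane} (hy : y ∈ interior T.carrier) (hx : x ∈ T.carrier) :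
    (∀ k, 0 ≤ T.coord k x) ∧ ∑ k, T.coord k x = 1 ∧ ∑ k, T.coord k x • T.vert k = x := by
  have hc := T.continuous_coord
  have : T.carrier ⊆ {x | (∀ k, 0 ≤ T.coord k x) ∧ ∑ k, T.coord k x = 1 ∧
      ∑ k, T.coord k x • T.vert k = x} := by
    rw [← closure_interior_carrier hy]
    refine closure_minimal (fun x hx => ?_) ?_
    · have hx' := T.mem_interior_iff.1 hx
      simp only [Set.mem_ofPred_eq, coord_eq _ hx]
      exact ⟨wachspress_nonneg hx', sum_wachspress hx', sum_wachspress_smul_vert hx'⟩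
    · simp only [Set.ofPred_and, Set.ofPred_forall]
      refine IsClosed.inter (isClosed_iInter fun k => isClosed_le continuous_const (hc k))
        (IsClosed.inter (isClosed_eq (by fun_prop) continuous_const)
          (isClosed_eq (by fun_prop) continuous_id))
  exact this hx

/-- The Wachspress interpolant of the vertex values `a`, extended continuously. -/
noncomputable def interp (T : ConvexPolygon) (a : T.Idx → ℝ) (x : Plane) : ℝ :=
  ∑ k, a k * T.coord k x

theorem exists_lipschitzWith_interp (T : ConvexPolygon) (a : T.Idx → ℝ) :
    ∃ K, LipschitzWith K (T.interp a) := by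
  choose K hK using T.exists_lipschitzWith_coord
  refine ⟨∑ k, ‖a k‖₊ * K k, ?_⟩
  have : ∀ s : Finset T.Idx, LipschitzWith (∑ k ∈ s, ‖a k‖₊ * K k)
      fun x => ∑ k ∈ s, a k * T.coord k x := by
    classical
    intro s
    induction s using Finset.induction_on with
    | empty => simp
    | insert k s hk ih =>
      simp only [Finset.sum_insert hk]
      exact ((lipschitzWith_smul (a k)).comp (hK k)).add ih
  exact this _

/-- On the edge `e_i` the interpolant is affine: there `d_i = 0`, so by linear precision only the
coordinates of the two end points are different from zero. -/
theorem interp_sub_of_mem_edge {y : Plane} (hy : y ∈ interior T.carrier) (a : T.Idx → ℝ)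
    {i : T.Idx} {z : Plane} (hx : x ∈ T.edge i) (hz : z ∈ T.edge i) :
    T.interp a x - T.interp a z =
      (a (i + 1) - a i) * ((T.edgeLength i)⁻¹ * ((T.edgeLength i)⁻¹ *
        ⟪T.vert (i + 1) - T.vert i, x - z⟫)) := by
  have key : ∀ x ∈ T.edge i, x = T.vert i + T.coord (i + 1) x • (T.vert (i + 1) - T.vert i) ∧
      T.interp a x = a i + T.coord (i + 1) x * (a (i + 1) - a i) := by
    intro x hx
    obtain ⟨hx, hd⟩ := T.mem_edge_iff.1 hx
    obtain ⟨h0, h1, h2⟩ := coord_spec hy hx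
    obtain ⟨h3, h4, h5⟩ := T.eq_combo_of_edgeDist_eq_zero h0 h1 (by rw [h2]; exact hd)
    have h6 : T.coord i x = 1 - T.coord (i + 1) x := by linarith
    constructor
    · conv_lhs => rw [← h2, h5, h6]
      module
    · rw [interp, Finset.sum_eq_add (a := i) (b := i + 1) (fin_add_one_ne i).symm
        (fun k _ hk => by rw [h3 k hk.1 hk.2, mul_zero]) (by simp) (by simp), h6]
      ring
  obtain ⟨hx1, hx2⟩ := key x hx
  obtain ⟨hz1, hz2⟩ := key z hz
  have h : x - z = (T.coord (i + 1) x - T.coord (i + 1) z) • (T.vert (i + 1) - T.vert i) := by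
    conv_lhs => rw [hx1, hz1]
    module
  rw [h, inner_smul_right, real_inner_self_eq_norm_sq, ← edgeLength_eq_norm, hx2, hz2]
  have := (T.edgeLength_pos i).ne'
  field_simp
  ring

end ConvexPolygon

/-! ### Consequences of shape regularity for one element -/

namespace ConvexPolygon

variable {T : ConvexPolygon}

theorem dist_le_diam {x y : Plane} (hx : x ∈ T.carrier) (hy : y ∈ T.carrier) :
    dist x y ≤ T.diam :=
  Metric.dist_le_diam_of_mem T.isCompact_carrier.isBounded hx hy

theorem edgeLength_le_diam (i : T.Idx) : T.edgeLength i ≤ T.diam :=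
  dist_le_diam (T.vert_mem_carrier _) (T.vert_mem_carrier _)

theorem diam_pos (T : ConvexPolygon) : 0 < T.diam :=
  (T.edgeLength_pos 0).trans_le (edgeLength_le_diam 0)

theorem le_edgeDist_of_starConvex {y : Plane} {r : ℝ} (hr : 0 < r)
    (h : ∀ z ∈ Metric.ball y r, StarConvex ℝ z T.carrier) (i : T.Idx) : r ≤ T.edgeDist i y := by
  refine le_of_forall_lt fun s hs => ?_
  by_contra! hlt
  have h0 : 0 ≤ T.edgeDist i y :=
    T.edgeDist_nonneg_of_mem ((h y (Metric.mem_ball_self hr)).mem ⟨_, T.vert_mem_carrier 0⟩) i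
  obtain ⟨t, ht1, ht2⟩ := exists_between (lt_of_le_of_lt hlt hs)
  have ht0 : 0 < t := h0.trans_lt ht1
  have hm : y + t • T.normal i ∈ T.carrier := by
    refine (h _ ?_).mem ⟨_, T.vert_mem_carrier 0⟩
    rw [Metric.mem_ball, dist_eq_norm, add_sub_cancel_left, norm_smul, norm_normal, mul_one,
      Real.norm_eq_abs, abs_of_pos ht0]
    exact ht2
  have := T.edgeDist_nonneg_of_mem hm i
  rw [edgeDist_add, inner_smul_left, real_inner_self_eq_norm_sq, norm_normal] at this
  simp at this
  linarith

/-- Every point of a convex polygon lies in the cone spanned at a vertex by its two edges. -/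
theorem exists_cone_combo {x : Plane} (hx : x ∈ T.carrier) (k : T.Idx) :
    ∃ a b : ℝ, 0 ≤ a ∧ 0 ≤ b ∧
      x - T.vert k = a • (T.vert (k + 1) - T.vert k) + b • (T.vert (k - 1) - T.vert k) := by
  have h1 : 0 ≤ det2 (T.vert (k + 1) - T.vert k) (x - T.vert k) := by
    rw [← edgeLength_mul_edgeDist]
    exact mul_nonneg (T.edgeLength_pos k).le (T.edgeDist_nonneg_of_mem hx k)
  have h2 : 0 ≤ det2 (T.vert k - T.vert (k - 1)) (x - T.vert (k - 1)) := by
    have := T.edgeLength_mul_edgeDist (k - 1) x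
    rw [fin_sub_one_add_one] at this
    rw [← this]
    exact mul_nonneg (T.edgeLength_pos _).le (T.edgeDist_nonneg_of_mem hx _)
  have h3 := T.convex_ccw k (k - 1) (fin_sub_one_ne k) (fin_sub_one_ne_add_one k)
  refine ⟨det2 (T.vert k - T.vert (k - 1)) (x - T.vert (k - 1)) /
      det2 (T.vert (k + 1) - T.vert k) (T.vert (k - 1) - T.vert k),
    det2 (T.vert (k + 1) - T.vert k) (x - T.vert k) /
      det2 (T.vert (k + 1) - T.vert k) (T.vert (k - 1) - T.vert k),
    div_nonneg h2 h3.le, div_nonneg h1 h3.le, ?_⟩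
  have h4 := h3.ne'
  refine plane_ext ?_ ?_ <;> simp <;> field_simp <;> simp [det2] <;> ring

/-- Among the vertices not on `e_i`, a neighbour of an end point of `e_i` is the closest one to
the line through `e_i`: otherwise the whole polygon, lying in the cone at the closest vertex,
would stay away from that line. -/
theorem heightBound_of_neighbours {H : ℝ} (hH : 0 < H)
    (h1 : ∀ i, H ≤ T.edgeDist i (T.vert (i - 1)))
    (h2 : ∀ i, H ≤ T.edgeDist i (T.vert (i + 1 + 1))) : T.HeightBound H := by
  classical
  refine ⟨hH, fun i k hk1 hk2 => ?_⟩
  let s : Finset T.Idx := Finset.univ.filter fun k => k ≠ i ∧ k ≠ i + 1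
  have hs : ∀ k, k ∈ s ↔ k ≠ i ∧ k ≠ i + 1 := fun k => by simp [s]
  obtain ⟨j, hj, hmin⟩ := s.exists_min_image (fun k => T.edgeDist i (T.vert k))
    ⟨k, (hs k).2 ⟨hk1, hk2⟩⟩
  refine le_trans ?_ (hmin k ((hs k).2 ⟨hk1, hk2⟩))
  obtain ⟨hj1, hj2⟩ := (hs j).1 hj
  by_cases h3 : j + 1 = i
  · have : j = i - 1 := by rw [← h3]; simp
    rw [this]; exact h1 i
  by_cases h4 : j - 1 = i + 1
  · have : j = i + 1 + 1 := by rw [← h4]; simp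
    rw [this]; exact h2 i
  exfalso
  have hp : 0 < T.edgeDist i (T.vert j) := T.edgeDist_vert_pos hj1 hj2
  have hn1 := hmin (j + 1) ((hs _).2 ⟨h3, fun h => hj1 (add_right_cancel h)⟩)
  have hn2 := hmin (j - 1) ((hs _).2 ⟨fun h => hj2 (by rw [← h]; simp), h4⟩)
  obtain ⟨a, b, ha, hb, hab⟩ := exists_cone_combo (T.vert_mem_carrier i) j
  have hd : ∀ y, ⟪y - T.vert j, T.normal i⟫ = T.edgeDist i (T.vert j) - T.edgeDist i y := by
    intro y
    simp only [edgeDist, ← inner_sub_left]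
    congr 1; abel
  have h5 := hd (T.vert i)
  rw [hab, inner_add_left, inner_smul_left, inner_smul_left, hd, hd, edgeDist_vert_self] at h5
  simp only [conj_trivial, sub_zero] at h5
  nlinarith [mul_nonneg ha (sub_nonneg.2 hn1), mul_nonneg hb (sub_nonneg.2 hn2)]

/-- The inner angle at the vertex `k` is bounded away from `0` by the ball condition and from `π`
by assumption. -/
theorem le_det2_at_vertex {y : Plane} {ρB θ : ℝ} (hρB : 0 < ρB) (hθ : 0 < θ)
    (hy : y ∈ T.carrier) (hd : ∀ i, ρB * T.diam ≤ T.edgeDist i y)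
    (ha : ∀ i, EuclideanGeometry.angle (T.vert (i - 1)) (T.vert i) (T.vert (i + 1)) ≤ Real.pi - θ)
    (k : T.Idx) :
    min ρB (Real.sin (min θ (Real.pi / 2))) * (T.edgeLength k * T.edgeLength (k - 1)) ≤
      det2 (T.vert (k + 1) - T.vert k) (T.vert (k - 1) - T.vert k) := by
  have hD := T.convex_ccw k (k - 1) (fin_sub_one_ne k) (fin_sub_one_ne_add_one k)
  obtain ⟨a, b, ha0, hb0, hab⟩ := exists_cone_combo hy k
  have hdk := hd k
  have hl : T.edgeLength (k - 1) = ‖T.vert (k - 1) - T.vert k‖ := by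
    rw [edgeLength_eq_norm, fin_sub_one_add_one, norm_sub_rev]
  have hp := T.edgeLength_pos k
  have hq := T.edgeLength_pos (k - 1)
  have hang := ha k
  rw [EuclideanGeometry.angle, vsub_eq_sub, vsub_eq_sub, InnerProductGeometry.angle_comm] at hang
  have hE := T.edgeLength_mul_edgeDist k y
  have hye : ‖y - T.vert k‖ ≤ T.diam := by
    rw [← dist_eq_norm]; exact dist_le_diam hy (T.vert_mem_carrier k)
  rw [hl] at hq ⊢
  rw [edgeLength_eq_norm] at hp hE ⊢
  rw [hab] at hE hye
  set p := T.vert (k + 1) - T.vert k with hpdef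
  set q := T.vert (k - 1) - T.vert k with hqdef
  rcases le_or_gt 0 ⟪p, q⟫ with hpq | hpq
  -- For a non-obtuse angle, `b ‖q‖ ≤ ‖y - v_k‖ ≤ h_T`, while `b det (p, q) / ‖p‖` is the distance
  -- of `y` to the edge.
  · refine le_trans (mul_le_mul_of_nonneg_right (min_le_left _ _) (by positivity)) ?_
    have h1 : det2 p (a • p + b • q) = b * det2 p q := by simp [det2]; ring
    rw [h1] at hE
    have h2 : b * ‖q‖ ≤ T.diam := by
      refine le_trans (le_trans ?_ hye) le_rfl
      refine abs_le_of_sq_le_sq' ?_ (norm_nonneg _) |>.2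
      rw [norm_add_sq_real, inner_smul_left, inner_smul_right, norm_smul, norm_smul,
        Real.norm_eq_abs, Real.norm_eq_abs, abs_of_nonneg ha0, abs_of_nonneg hb0]
      simp only [conj_trivial]
      nlinarith [mul_nonneg ha0 (mul_nonneg hb0 hpq), sq_nonneg (a * ‖p‖)]
    have hb : 0 < b := by
      rcases hb0.eq_or_lt with h | h
      · rw [← h, zero_mul] at hE
        have := mul_pos hp ((mul_pos hρB T.diam_pos).trans_le hdk)
        linarith
      · exact h
    refine le_of_mul_le_mul_left ?_ hb
    rw [← hE]
    calc b * (ρB * (‖p‖ * ‖q‖)) = ‖p‖ * (ρB * (b * ‖q‖)) := by ring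
      _ ≤ ‖p‖ * (ρB * T.diam) := by gcongr
      _ ≤ _ := by gcongr
  -- An obtuse angle lies between `π / 2` and `π - θ`, where the sine is decreasing.
  · refine le_trans (mul_le_mul_of_nonneg_right (min_le_right _ _) (by positivity)) ?_
    have h1 := InnerProductGeometry.sin_angle_mul_norm_mul_norm p q
    have h2 : det2 p q = Real.sin (InnerProductGeometry.angle p q) * (‖p‖ * ‖q‖) := by
      rw [h1, real_inner_self_eq_norm_sq, real_inner_self_eq_norm_sq, ← det2_sq_add_inner_sq]
      rw [show det2 p q ^ 2 + ⟪p, q⟫ ^ 2 - ⟪p, q⟫ * ⟪p, q⟫ = det2 p q ^ 2 by ring,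
        Real.sqrt_sq hD.le]
    rw [h2]
    have h3 : Real.pi / 2 < InnerProductGeometry.angle p q := by
      by_contra! h
      have h4 := InnerProductGeometry.cos_angle_mul_norm_mul_norm p q
      have h5 := Real.cos_nonneg_of_neg_pi_div_two_le_of_le
        (by linarith [InnerProductGeometry.angle_nonneg p q, Real.pi_pos]) h
      have : 0 ≤ ⟪p, q⟫ := h4 ▸ mul_nonneg h5 (by positivity)
      linarith
    refine mul_le_mul_of_nonneg_right ?_ (by positivity)
    rw [min_eq_left (by linarith), ← Real.sin_pi_sub (InnerProductGeometry.angle p q)]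
    exact Real.sin_le_sin_of_le_of_le_pi_div_two (by linarith [Real.pi_pos]) (by linarith)
      (by linarith)

/-- The constant `c` for which `c h_T` bounds the distances of vertices from the other edges. -/
noncomputable def heightConst (ρB ρE θ : ℝ) : ℝ :=
  min ρB (Real.sin (min θ (Real.pi / 2))) * ρE

theorem heightConst_pos {ρB ρE θ : ℝ} (hρB : 0 < ρB) (hρE : 0 < ρE) (hθ : 0 < θ) :
    0 < heightConst ρB ρE θ := by
  have h1 : 0 < min θ (Real.pi / 2) := lt_min hθ (by positivity)
  have h2 : min θ (Real.pi / 2) < Real.pi :=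
    (min_le_right _ _).trans_lt (by linarith [Real.pi_pos])
  exact mul_pos (lt_min hρB (Real.sin_pos_of_pos_of_lt_pi h1 h2)) hρE

theorem heightBound_of_regular {y : Plane} {ρB ρE θ : ℝ} (hρB : 0 < ρB) (hρE : 0 < ρE)
    (hθ : 0 < θ) (hy : y ∈ T.carrier) (hd : ∀ i, ρB * T.diam ≤ T.edgeDist i y)
    (hE : ∀ i, ρE * T.diam ≤ T.edgeLength i)
    (ha : ∀ i, EuclideanGeometry.angle (T.vert (i - 1)) (T.vert i) (T.vert (i + 1)) ≤
      Real.pi - θ) :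
    T.HeightBound (heightConst ρB ρE θ * T.diam) := by
  have hc := heightConst_pos hρB hρE hθ
  have hm : 0 < min ρB (Real.sin (min θ (Real.pi / 2))) := by
    have := hc; unfold heightConst at this
    exact pos_of_mul_pos_left this hρE.le
  refine heightBound_of_neighbours (mul_pos hc T.diam_pos) (fun i => ?_) fun i => ?_
  · have h := le_det2_at_vertex hρB hθ hy hd ha i
    rw [← edgeLength_mul_edgeDist] at h
    refine le_of_mul_le_mul_left (le_trans ?_ h) (T.edgeLength_pos i)
    have := mul_le_mul_of_nonneg_left (hE (i - 1)) (mul_nonneg hm.le (T.edgeLength_pos i).le)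
    unfold heightConst
    linarith
  · have h := le_det2_at_vertex hρB hθ hy hd ha (i + 1)
    rw [add_sub_cancel_right] at h
    have h2 : det2 (T.vert (i + 1 + 1) - T.vert (i + 1)) (T.vert i - T.vert (i + 1)) =
        T.edgeLength i * T.edgeDist i (T.vert (i + 1 + 1)) := by
      rw [edgeLength_mul_edgeDist]; simp [det2]; ring
    rw [h2] at h
    refine le_of_mul_le_mul_left (le_trans ?_ h) (T.edgeLength_pos i)
    have := mul_le_mul_of_nonneg_left (hE (i + 1)) (mul_nonneg hm.le (T.edgeLength_pos i).le)
    unfold heightConst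
    linarith

theorem HeightBound.le_dist_vert {H : ℝ} (hH : T.HeightBound H) {i k : T.Idx} (h : k ≠ i) :
    H ≤ dist (T.vert k) (T.vert i) := by
  have key : ∀ i k : T.Idx, k ≠ i → k ≠ i + 1 → H ≤ dist (T.vert k) (T.vert i) := by
    intro i k h1 h2
    refine (hH.2 i k h1 h2).trans ?_
    rw [edgeDist, dist_comm, dist_eq_norm]
    refine (real_inner_le_norm _ _).trans ?_
    rw [norm_normal, mul_one]
  by_cases h2 : k = i + 1
  · subst h2
    rw [dist_comm]
    exact key _ _ (fin_add_one_ne i).symm (fin_add_two_ne i).symm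
  · exact key i k h h2

/-- The vertices are separated, so their number is controlled by a comparison of areas. -/
theorem HeightBound.card_le {c : ℝ} (hc : 0 < c) (hH : T.HeightBound (c * T.diam)) :
    ((T.extra + 3 : ℕ) : ℝ) ≤ (2 / c + 1) ^ 2 := by
  have hh := T.diam_pos
  set r := c * T.diam / 2 with hr
  have hr0 : 0 < r := by positivity
  have hdisj : Pairwise fun i j : T.Idx =>
      Disjoint (Metric.ball (T.vert i) r) (Metric.ball (T.vert j) r) := by
    intro i j hij
    exact Metric.ball_disjoint_ball (by linarith [hH.le_dist_vert hij, hr])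
  have hsub : (⋃ i : T.Idx, Metric.ball (T.vert i) r) ⊆
      Metric.ball (T.vert 0) (T.diam + r) := by
    refine Set.iUnion_subset fun i => Metric.ball_subset_ball' ?_
    have : dist (T.vert i) (T.vert 0) ≤ T.diam :=
      dist_le_diam (T.vert_mem_carrier _) (T.vert_mem_carrier _)
    linarith
  have hvol := measure_mono (μ := volume) hsub
  rw [measure_iUnion hdisj fun i => measurableSet_ball] at hvol
  simp only [EuclideanSpace.volume_ball_fin_two] at hvol
  rw [tsum_fintype, Finset.sum_const, Finset.card_univ, Fintype.card_fin, nsmul_eq_mul,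
    ← mul_assoc, ENNReal.mul_le_mul_iff_left (by simp [Real.pi_pos]) (by simp),
    ← ENNReal.ofReal_pow hr0.le, ← ENNReal.ofReal_pow (by positivity),
    ← ENNReal.ofReal_natCast, ← ENNReal.ofReal_mul (by positivity),
    ENNReal.ofReal_le_ofReal_iff (by positivity)] at hvol
  have h2 : T.diam + r = (2 / c + 1) * r := by rw [hr]; field_simp
  rw [h2, mul_pow] at hvol
  exact le_of_mul_le_mul_right hvol (by positivity)

end ConvexPolygon

/-! ### Topology of the mesh: pairing of the primal edges -/

theorem segment_endpoints {a b c d : Plane} (h : segment ℝ a b = segment ℝ c d) :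
    (a = c ∧ b = d) ∨ (a = d ∧ b = c) := by
  by_cases hab : a = b
  · subst hab
    rw [segment_same] at h
    have hc : c ∈ ({a} : Set Plane) := h ▸ left_mem_segment ℝ c d
    have hd : d ∈ ({a} : Set Plane) := h ▸ right_mem_segment ℝ c d
    exact Or.inl ⟨hc.symm, hd.symm⟩
  have ha : a ∈ segment ℝ c d := h ▸ left_mem_segment ℝ a b
  have hb : b ∈ segment ℝ c d := h ▸ right_mem_segment ℝ a b
  have hc : c ∈ segment ℝ a b := h ▸ left_mem_segment ℝ c d
  have hd : d ∈ segment ℝ a b := h ▸ right_mem_segment ℝ c d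
  rw [segment_eq_image_lineMap] at ha hb hc hd
  obtain ⟨s, hs, rfl⟩ := hc
  obtain ⟨t, ht, rfl⟩ := hd
  obtain ⟨p, hp, hpa⟩ := ha
  obtain ⟨q, hq, hqb⟩ := hb
  rw [AffineMap.lineMap_apply_module', AffineMap.lineMap_apply_module',
    AffineMap.lineMap_apply_module'] at hpa hqb
  have hne : b - a ≠ 0 := sub_ne_zero.2 (Ne.symm hab)
  have h1 : (p * (t - s) + s) • (b - a) = 0 := by
    rw [← sub_eq_zero] at hpa; rw [← hpa]; module
  have h2 : (q * (t - s) + s - 1) • (b - a) = 0 := by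
    rw [← sub_eq_zero] at hqb; rw [← hqb]; module
  have h1 := (smul_eq_zero.1 h1).resolve_right hne
  have h2 := (smul_eq_zero.1 h2).resolve_right hne
  have hs0 := hs.1; have hs1 := hs.2; have ht0 := ht.1; have ht1 := ht.2
  have hp0 := hp.1; have hp1 := hp.2; have hq0 := hq.1; have hq1 := hq.2
  have h3 : (q - p) * (t - s) = 1 := by linarith
  rcases le_total s t with hst | hst
  · have h4 : t - s = 1 := by nlinarith
    have hs' : s = 0 := by linarith
    have ht' : t = 1 := by linarith
    left; simp [hs', ht']
  · have h4 : t - s = -1 := by nlinarith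
    have hs' : s = 1 := by linarith
    have ht' : t = 0 := by linarith
    right; simp [hs', ht']

namespace ConvexPolygon

/-- A point in the relative interior of an edge has positive distance to all the other edges. -/
theorem edgeDist_combo_pos (T : ConvexPolygon) {i k : T.Idx} (hk : k ≠ i) {a b : ℝ} (ha : 0 < a)
    (hb : 0 < b) (hab : a + b = 1) :
    0 < T.edgeDist k (a • T.vert i + b • T.vert (i + 1)) := by
  rw [T.edgeDist_combo k _ _ hab]
  by_cases h : i = k + 1
  · have h1 : 0 < T.edgeDist k (T.vert (i + 1)) := by
      refine T.edgeDist_vert_pos ?_ ?_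
      · rw [h]; exact fin_add_two_ne k
      · exact fun h2 => hk (add_right_cancel h2).symm
    have := T.edgeDist_vert_nonneg k i
    positivity
  · have h1 : 0 < T.edgeDist k (T.vert i) := T.edgeDist_vert_pos (Ne.symm hk) h
    have := T.edgeDist_vert_nonneg k (i + 1)
    positivity

end ConvexPolygon

namespace StaggeredMesh

variable {Ω : Set Plane} (M : StaggeredMesh Ω)

theorem isOpen_domain (M : StaggeredMesh Ω) : IsOpen Ω := M.domain_eq ▸ isOpen_interior

theorem interior_subset_domain (K : Fin M.card) : interior (M.elem K).carrier ⊆ Ω := by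
  conv_rhs => rw [M.domain_eq]
  exact interior_mono (Set.subset_iUnion (fun K => (M.elem K).carrier) K)

theorem isClosed_iUnion : IsClosed (⋃ K, (M.elem K).carrier) :=
  isClosed_iUnion_of_finite fun K => (M.elem K).isClosed_carrier

theorem closure_domain_subset : closure Ω ⊆ ⋃ K, (M.elem K).carrier := by
  conv_lhs => rw [M.domain_eq]
  exact closure_minimal interior_subset M.isClosed_iUnion

theorem domain_subset : Ω ⊆ ⋃ K, (M.elem K).carrier := subset_closure.trans M.closure_domain_subset

theorem carrier_subset_closure (K : Fin M.card) : (M.elem K).carrier ⊆ closure Ω := by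
  rw [← ConvexPolygon.closure_interior_carrier (M.center_mem K)]
  exact closure_mono (M.interior_subset_domain K)

theorem isBounded_domain (M : StaggeredMesh Ω) : Bornology.IsBounded Ω :=
  ((isCompact_iUnion fun K => (M.elem K).isCompact_carrier).isBounded).subset M.domain_subset

/-- A common point of two elements lies on an edge of each of them. -/
theorem interior_inter_carrier {K L : Fin M.card} (h : K ≠ L) :
    interior (M.elem K).carrier ∩ (M.elem L).carrier = ∅ := by
  rw [Set.eq_empty_iff_forall_notMem]
  rintro x ⟨hx, hx'⟩
  have hmem : x ∈ (M.elem K).carrier ∩ (M.elem L).carrier := ⟨interior_subset hx, hx'⟩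
  have hpos := (M.elem K).edgeDist_pos_of_mem_interior hx
  rcases M.conforming K L h with h1 | ⟨i, j, -, h1⟩ | ⟨i, j, -, h1⟩
  · rw [h1] at hmem; exact hmem
  · rw [h1, Set.mem_singleton_iff] at hmem
    have := hpos i
    rw [hmem, ConvexPolygon.edgeDist_vert_self] at this
    exact lt_irrefl _ this
  · rw [h1] at hmem
    exact (hpos i).ne' ((M.elem K).mem_edge_iff.1 hmem).2

theorem eq_of_mem_interior {K L : Fin M.card} {x : Plane} (hx : x ∈ interior (M.elem K).carrier)
    (hx' : x ∈ (M.elem L).carrier) : K = L := by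
  by_contra h
  have := M.interior_inter_carrier h
  exact (this ▸ (⟨hx, hx'⟩ : x ∈ interior (M.elem K).carrier ∩ (M.elem L).carrier) :
    x ∈ (∅ : Set Plane))

theorem fst_ne_of_primalEdge_eq {s t : M.Tri} (hst : s ≠ t)
    (h : M.primalEdge s = M.primalEdge t) : s.1 ≠ t.1 := by
  obtain ⟨K, i⟩ := s
  obtain ⟨L, j⟩ := t
  intro hKL
  change K = L at hKL
  subst hKL
  exact hst (congrArg (Sigma.mk K) ((M.elem K).edge_injective h))

/-- An edge shared by two elements is traversed in opposite directions: otherwise the elements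
would overlap on one side of it. -/
theorem vert_eq_of_primalEdge_eq {s t : M.Tri} (hst : s ≠ t)
    (h : M.primalEdge s = M.primalEdge t) :
    (M.elem s.1).vert s.2 = (M.elem t.1).vert (t.2 + 1) ∧
      (M.elem s.1).vert (s.2 + 1) = (M.elem t.1).vert t.2 := by
  have hne := M.fst_ne_of_primalEdge_eq hst h
  rcases segment_endpoints h with ⟨h1, h2⟩ | h1
  -- For equal orientation, the midpoint of the edge, moved slightly inwards, is interior to both
  -- elements.
  · exfalso
    have hm : ∀ r : M.Tri, ∀ᶠ ε : ℝ in 𝓝[>] 0, (M.elem r.1).vert r.2 = (M.elem s.1).vert s.2 →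
        (M.elem r.1).vert (r.2 + 1) = (M.elem s.1).vert (s.2 + 1) →
        ((1 / 2 : ℝ) • (M.elem s.1).vert s.2 + (1 / 2 : ℝ) • (M.elem s.1).vert (s.2 + 1)) +
          ε • (-(M.elem s.1).normal s.2) ∈ interior (M.elem r.1).carrier := by
      intro r
      set x := (1 / 2 : ℝ) • (M.elem s.1).vert s.2 + (1 / 2 : ℝ) • (M.elem s.1).vert (s.2 + 1)
      by_cases hr : (M.elem r.1).vert r.2 = (M.elem s.1).vert s.2 ∧
        (M.elem r.1).vert (r.2 + 1) = (M.elem s.1).vert (s.2 + 1)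
      swap
      · exact Eventually.of_forall fun ε h1 h2 => absurd ⟨h1, h2⟩ hr
      obtain ⟨hr1, hr2⟩ := hr
      have hn : (M.elem s.1).normal s.2 = (M.elem r.1).normal r.2 := by
        rw [ConvexPolygon.normal, ConvexPolygon.normal, ConvexPolygon.edgeLength,
          ConvexPolygon.edgeLength, hr1, hr2]
      have hev : ∀ k, ∀ᶠ ε : ℝ in 𝓝[>] 0,
          0 < (M.elem r.1).edgeDist k (x + ε • (-(M.elem s.1).normal s.2)) := by
        intro k
        by_cases hk : k = r.2
        · filter_upwards [self_mem_nhdsWithin] with ε hε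
          have : (M.elem r.1).edgeDist r.2 x = 0 := by
            simp only [x, ← hr1, ← hr2]
            rw [ConvexPolygon.edgeDist_combo _ _ _ _ (by norm_num),
              ConvexPolygon.edgeDist_vert_self, ConvexPolygon.edgeDist_vert_succ]
            simp
          rw [hk, ConvexPolygon.edgeDist_add, hn, inner_smul_left, inner_neg_left,
            real_inner_self_eq_norm_sq, ConvexPolygon.norm_normal, this]
          simpa using hε
        · have hpos : 0 < (M.elem r.1).edgeDist k x := by
            simp only [x, ← hr1, ← hr2]
            exact (M.elem r.1).edgeDist_combo_pos hk (by norm_num) (by norm_num) (by norm_num)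
          have hc : Continuous fun ε : ℝ =>
              (M.elem r.1).edgeDist k (x + ε • (-(M.elem s.1).normal s.2)) :=
            ((M.elem r.1).continuous_edgeDist k).comp (by fun_prop)
          have := hc.tendsto 0
          simp only [zero_smul, add_zero] at this
          exact (this.eventually (lt_mem_nhds hpos)).filter_mono nhdsWithin_le_nhds
      filter_upwards [eventually_all.2 hev] with ε hε _ _
      exact (M.elem r.1).mem_interior_iff.2 hε
    obtain ⟨ε, hs, ht⟩ := ((hm s).and (hm t)).exists
    exact hne (M.eq_of_mem_interior (hs rfl rfl) (interior_subset (ht h1.symm h2.symm)))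
  · exact h1

theorem primalLength_eq {s t : M.Tri} (hst : s ≠ t) (h : M.primalEdge s = M.primalEdge t) :
    M.primalLength s = M.primalLength t := by
  obtain ⟨h1, h2⟩ := M.vert_eq_of_primalEdge_eq hst h
  rw [primalLength, primalLength, ConvexPolygon.edgeLength, ConvexPolygon.edgeLength, h1, h2,
    dist_comm]

theorem primalNormal_eq_neg {s t : M.Tri} (hst : s ≠ t) (h : M.primalEdge s = M.primalEdge t) :
    M.primalNormal s = -M.primalNormal t := by
  obtain ⟨h1, h2⟩ := M.vert_eq_of_primalEdge_eq hst h
  have h3 := M.primalLength_eq hst h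
  rw [primalLength, primalLength] at h3
  rw [primalNormal, primalNormal, ConvexPolygon.normal, ConvexPolygon.normal, h3, h1, h2, ← smul_neg,
    neg_neg, ← rot_neg, neg_sub]

/-- At most two elements share an edge, since three of them cannot have pairwise opposite
orientations. -/
theorem primalEdge_unique {s t t' : M.Tri} (hs : s ≠ t) (hs' : s ≠ t')
    (h : M.primalEdge s = M.primalEdge t) (h' : M.primalEdge s = M.primalEdge t') : t = t' := by
  by_contra hne
  have h1 := (M.vert_eq_of_primalEdge_eq hs h).1
  have h2 := (M.vert_eq_of_primalEdge_eq hs' h').1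
  have h3 := (M.vert_eq_of_primalEdge_eq hne (h.symm.trans h')).2
  have h4 : (M.elem t'.1).vert (t'.2 + 1) = (M.elem t'.1).vert t'.2 := by
    rw [← h2, h1, h3]
  exact (M.elem t'.1).vert_succ_ne _ h4

/-- A point in the relative interior of a primal edge lies in no further element, unless that
element has the edge, too. -/
theorem exists_primalEdge_eq {s : M.Tri} {a b : ℝ} (ha : 0 < a) (hb : 0 < b) (hab : a + b = 1)
    {L : Fin M.card} (hL : s.1 ≠ L)
    (hx : a • (M.elem s.1).vert s.2 + b • (M.elem s.1).vert (s.2 + 1) ∈ (M.elem L).carrier) :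
    ∃ j, M.primalEdge s = M.primalEdge ⟨L, j⟩ := by
  set x := a • (M.elem s.1).vert s.2 + b • (M.elem s.1).vert (s.2 + 1)
  have hxe : x ∈ (M.elem s.1).edge s.2 := ⟨a, b, ha.le, hb.le, hab, rfl⟩
  have hmem : x ∈ (M.elem s.1).carrier ∩ (M.elem L).carrier :=
    ⟨(M.elem s.1).edge_subset_carrier _ hxe, hx⟩
  have hi : ∀ i, x ∈ (M.elem s.1).edge i → i = s.2 := by
    intro i hi
    by_contra hne
    exact ((M.elem s.1).edgeDist_combo_pos hne ha hb hab).ne' ((M.elem s.1).mem_edge_iff.1 hi).2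
  rcases M.conforming s.1 L hL with h1 | ⟨i, j, -, h1⟩ | ⟨i, j, h2, h1⟩
  · rw [h1] at hmem; exact hmem.elim
  · rw [h1, Set.mem_singleton_iff] at hmem
    have h3 := hi i (by rw [hmem]; exact (M.elem s.1).vert_mem_edge i)
    have h4 := hi (i - 1) (by
      rw [hmem]
      have := (M.elem s.1).vert_succ_mem_edge (i - 1)
      rwa [fin_sub_one_add_one] at this)
    exact absurd (h4.trans h3.symm) (fin_sub_one_ne i)
  · rw [h1] at hmem
    exact ⟨j, by rw [primalEdge, ← hi i hmem, h2]; rfl⟩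

/-- A primal edge which belongs to one element only is a boundary edge. -/
theorem primalEdge_subset_frontier {s : M.Tri}
    (h : ∀ t, s ≠ t → M.primalEdge s ≠ M.primalEdge t) : M.primalEdge s ⊆ frontier Ω := by
  have hopen : openSegment ℝ ((M.elem s.1).vert s.2) ((M.elem s.1).vert (s.2 + 1)) ⊆
      frontier Ω := by
    rintro x ⟨a, b, ha, hb, hab, rfl⟩
    set x := a • (M.elem s.1).vert s.2 + b • (M.elem s.1).vert (s.2 + 1) with hxdef
    have hxe : x ∈ (M.elem s.1).edge s.2 := ⟨a, b, ha.le, hb.le, hab, rfl⟩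
    refine ⟨M.carrier_subset_closure s.1 ((M.elem s.1).edge_subset_carrier _ hxe), fun hx => ?_⟩
    rw [interior_eq_iff_isOpen.2 M.isOpen_domain] at hx
    have hL : ∀ L, s.1 ≠ L → ∀ᶠ y in 𝓝 x, y ∉ (M.elem L).carrier := by
      intro L hL
      refine (M.elem L).isClosed_carrier.isOpen_compl.mem_nhds fun hxL => ?_
      obtain ⟨j, hj⟩ := M.exists_primalEdge_eq ha hb hab hL hxL
      exact h ⟨L, j⟩ (fun h => hL (by rw [h])) hj
    have hev : ∀ᶠ y in 𝓝 x, y ∈ (M.elem s.1).carrier := by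
      have h2 : ∀ᶠ y in 𝓝 x, ∀ L, s.1 ≠ L → y ∉ (M.elem L).carrier := by
        rw [eventually_all]
        intro L
        by_cases hs : s.1 = L
        · simp [hs]
        · simpa [hs] using hL L hs
      filter_upwards [M.isOpen_domain.mem_nhds hx, h2] with y hy1 hy2
      obtain ⟨L, hyL⟩ := Set.mem_iUnion.1 (M.domain_subset hy1)
      by_cases hs : s.1 = L
      · rwa [hs]
      · exact absurd hyL (hy2 L hs)
    have := (M.elem s.1).edgeDist_pos_of_mem_interior (mem_interior_iff_mem_nhds.2 hev) s.2
    exact this.ne' ((M.elem s.1).mem_edge_iff.1 hxe).2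
  rw [primalEdge, ConvexPolygon.edge, ← closure_openSegment]
  exact closure_minimal hopen isClosed_frontier

/-- The relative interior of a shared primal edge lies in the domain. -/
theorem mem_domain_of_shared {s t : M.Tri} (hst : s ≠ t) (h : M.primalEdge s = M.primalEdge t)
    {a b : ℝ} (ha : 0 < a) (hb : 0 < b) (hab : a + b = 1) :
    a • (M.elem s.1).vert s.2 + b • (M.elem s.1).vert (s.2 + 1) ∈ Ω := by
  obtain ⟨h1, h2⟩ := M.vert_eq_of_primalEdge_eq hst h
  set x := a • (M.elem s.1).vert s.2 + b • (M.elem s.1).vert (s.2 + 1) with hx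
  have hx' : x = b • (M.elem t.1).vert t.2 + a • (M.elem t.1).vert (t.2 + 1) := by
    rw [hx, h1, h2, add_comm]
  have hev : ∀ r : M.Tri, (∀ k, k ≠ r.2 → 0 < (M.elem r.1).edgeDist k x) →
      ∀ᶠ y in 𝓝 x, 0 ≤ (M.elem r.1).edgeDist r.2 y → y ∈ (M.elem r.1).carrier := by
    intro r hr
    have : ∀ᶠ y in 𝓝 x, ∀ k, k ≠ r.2 → 0 < (M.elem r.1).edgeDist k y := by
      rw [eventually_all]
      intro k
      by_cases hk : k = r.2
      · simp [hk]
      · filter_upwards [((M.elem r.1).continuous_edgeDist k).tendsto x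
          |>.eventually (lt_mem_nhds (hr k hk))] with y hy _ using hy
    filter_upwards [this] with y hy hy0
    refine (ConvexPolygon.mem_carrier_iff (M.center_mem r.1)).2 fun k => ?_
    by_cases hk : k = r.2
    · rw [hk]; exact hy0
    · exact (hy k hk).le
  -- The two elements lie on opposite sides of the edge.
  have hopp : ∀ y, (M.elem t.1).edgeDist t.2 y = -(M.elem s.1).edgeDist s.2 y := by
    intro y
    have hl := M.primalLength_eq hst h
    rw [primalLength, primalLength] at hl
    rw [ConvexPolygon.edgeDist_eq, ConvexPolygon.edgeDist_eq, hl, h1, h2]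
    simp [det2]; ring
  have key : x ∈ interior (⋃ K, (M.elem K).carrier) := by
    rw [mem_interior_iff_mem_nhds]
    filter_upwards [hev s fun k hk => (M.elem s.1).edgeDist_combo_pos hk ha hb hab,
      hev t fun k hk => by
        rw [hx']; exact (M.elem t.1).edgeDist_combo_pos hk hb ha (by linarith)] with y hy1 hy2
    rcases le_total 0 ((M.elem s.1).edgeDist s.2 y) with h3 | h3
    · exact Set.mem_iUnion.2 ⟨_, hy1 h3⟩
    · exact Set.mem_iUnion.2 ⟨_, hy2 (by rw [hopp]; linarith)⟩
  rwa [← M.domain_eq] at key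

theorem mem_interiorEdges {e : M.Tri × M.Tri} :
    e ∈ M.interiorEdges ↔ e.1.1 < e.2.1 ∧ M.primalEdge e.1 = M.primalEdge e.2 := by
  simp [interiorEdges]

theorem ne_of_mem_interiorEdges {e : M.Tri × M.Tri} (he : e ∈ M.interiorEdges) : e.1 ≠ e.2 :=
  fun h => (M.mem_interiorEdges.1 he).1.ne (by rw [h])

/-- A sum over all primal edges of all elements, without contribution of the boundary edges,
rearranged into a sum over the interior edges. -/
theorem sum_eq_sum_interiorEdges (A : M.Tri → ℝ)
    (hA : ∀ s, M.primalEdge s ⊆ frontier Ω → A s = 0) :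
    ∑ s, A s = ∑ e ∈ M.interiorEdges, (A e.1 + A e.2) := by
  classical
  have h1 : ∀ s, A s = ∑ t, if s ≠ t ∧ M.primalEdge s = M.primalEdge t then A s else 0 := by
    intro s
    by_cases h : ∃ t, s ≠ t ∧ M.primalEdge s = M.primalEdge t
    · obtain ⟨t, ht⟩ := h
      rw [Finset.sum_eq_single t, if_pos ht]
      · intro t' _ hne
        rw [if_neg]
        exact fun ht' => hne (M.primalEdge_unique ht'.1 ht.1 ht'.2 ht.2)
      · simp
    · have : A s = 0 := hA s (M.primalEdge_subset_frontier fun t hne heq => h ⟨t, hne, heq⟩)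
      simp [this]
  -- Each pair of triangles is counted according to which of the two elements has the smaller number.
  have h2 : ∀ s t : M.Tri, (if s ≠ t ∧ M.primalEdge s = M.primalEdge t then A s else 0) =
      (if s.1 < t.1 ∧ M.primalEdge s = M.primalEdge t then A s else 0) +
        if t.1 < s.1 ∧ M.primalEdge t = M.primalEdge s then A s else 0 := by
    intro s t
    by_cases h : M.primalEdge s = M.primalEdge t
    · by_cases hst : s = t
      · subst hst; simp
      · rcases lt_or_gt_of_ne (M.fst_ne_of_primalEdge_eq hst h) with hlt | hlt
        · simp [h, hst, hlt, hlt.not_gt]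
        · simp [h, hst, hlt, hlt.not_gt]
    · simp [h, Ne.symm h]
  rw [Finset.sum_congr rfl fun s _ => (h1 s).trans (Finset.sum_congr rfl fun t _ => h2 s t)]
  simp only [Finset.sum_add_distrib]
  congr 1
  · rw [interiorEdges, Finset.sum_filter, ← Finset.univ_product_univ, Finset.sum_product]
  · rw [Finset.sum_comm, interiorEdges, Finset.sum_filter, ← Finset.univ_product_univ,
      Finset.sum_product]

end StaggeredMesh

/-! ### Discrete integration by parts, incompressibility, and the inf-sup condition -/

theorem toEuclideanLin_coord (A : Matrix (Fin 2) (Fin 2) ℝ) (v : Plane) (i : Fin 2) :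
    Matrix.toEuclideanLin A v i = A i 0 * v 0 + A i 1 * v 1 := by
  fin_cases i <;> simp [Matrix.toLpLin_apply]

namespace StaggeredMesh

variable {Ω : Set Plane} (M : StaggeredMesh Ω)

theorem dualLength_pos (s : M.Tri) : 0 < M.dualLength s := by
  refine dist_pos.2 fun h => ?_
  have := (M.elem s.1).edgeDist_pos_of_mem_interior (M.center_mem s.1) s.2
  rw [h, ConvexPolygon.edgeDist_vert_self] at this
  exact lt_irrefl _ this

theorem dualLength_smul_dualNormal (s : M.Tri) :
    M.dualLength s • M.dualNormal s = rot ((M.elem s.1).vert s.2 - M.center s.1) := by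
  rw [dualNormal, smul_smul, mul_inv_cancel₀ (M.dualLength_pos s).ne', one_smul]

theorem hNorm_sq (v : M.Tri → Plane) : M.hNorm v ^ 2 = ∑ s, ‖M.dualJump v s‖ ^ 2 := by
  rw [hNorm, Real.sq_sqrt]
  · refine Finset.sum_congr rfl fun s _ => ?_
    rw [← mul_assoc, inv_mul_cancel₀ (M.dualLength_pos s).ne', one_mul]
  · refine Finset.sum_nonneg fun s _ => ?_
    have := M.dualLength_pos s
    positivity

/-- The next triangle of the same element in counterclockwise order. -/
def nextTri (s : M.Tri) : M.Tri := ⟨s.1, s.2 + 1⟩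

theorem prevTri_nextTri (s : M.Tri) : M.prevTri (M.nextTri s) = s :=
  congrArg (Sigma.mk s.1) (add_sub_cancel_right s.2 1)

theorem nextTri_prevTri (s : M.Tri) : M.nextTri (M.prevTri s) = s :=
  congrArg (Sigma.mk s.1) (sub_add_cancel s.2 1)

theorem sum_nextTri (f : M.Tri → ℝ) : ∑ s, f (M.nextTri s) = ∑ s, f s := by
  rw [Fintype.sum_sigma, Fintype.sum_sigma]
  exact Finset.sum_congr rfl fun K _ =>
    Equiv.sum_comp (Equiv.addRight (1 : (M.elem K).Idx)) fun i => f ⟨K, i⟩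

theorem sum_prevTri (f : M.Tri → ℝ) : ∑ s, f (M.prevTri s) = ∑ s, f s := by
  rw [← M.sum_nextTri fun s => f (M.prevTri s)]
  simp only [prevTri_nextTri]

variable {M}

/-- The discrete velocity gradient and its adjoint: the outer normals of a triangle, weighted with
the edge lengths, add up to zero. -/
theorem formBstar_eq_formB {u : M.Tri → Plane} {ψ : M.Tri → Matrix (Fin 2) (Fin 2) ℝ}
    (hu : M.IsVelocity u) (hψ : M.IsGradient ψ) : M.formBstar u ψ = M.formB ψ u := by
  let N : M.Tri → Plane := fun s => rot ((M.elem s.1).vert s.2 - M.center s.1)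
  have h1 : ∀ s, M.dualLength s * ⟪Matrix.toEuclideanLin (ψ s) (M.dualNormal s), M.dualJump u s⟫ =
      ⟪Matrix.toEuclideanLin (ψ (M.prevTri s)) (N s), u (M.prevTri s)⟫ -
        ⟪Matrix.toEuclideanLin (ψ s) (N s), u s⟫ := by
    intro s
    have h : Matrix.toEuclideanLin (ψ (M.prevTri s)) (N s) =
        Matrix.toEuclideanLin (ψ s) (N s) := by
      simp only [N, ← dualLength_smul_dualNormal, map_smul]
      rw [hψ s]
    rw [h, ← inner_sub_right]
    simp only [N, ← dualLength_smul_dualNormal, map_smul, inner_smul_left, conj_trivial]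
    rfl
  have h2 : M.formB ψ u =
      ∑ s, M.primalLength s * ⟪u s, Matrix.toEuclideanLin (ψ s) (M.primalNormal s)⟫ := by
    rw [formB, Finset.sum_congr rfl fun s _ => h1 s, Finset.sum_sub_distrib,
      ← M.sum_nextTri fun s =>
        ⟪Matrix.toEuclideanLin (ψ (M.prevTri s)) (N s), u (M.prevTri s)⟫,
      ← Finset.sum_sub_distrib, ← Finset.sum_neg_distrib]
    refine Finset.sum_congr rfl fun s _ => ?_
    have h3 : M.primalLength s • M.primalNormal s = N s - N (M.nextTri s) := by
      rw [primalLength, primalNormal, ConvexPolygon.edgeLength_smul_normal]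
      simp only [N, nextTri]
      rw [← rot_sub, ← rot_neg]
      congr 1; abel
    rw [prevTri_nextTri, ← inner_sub_left, ← map_sub, ← inner_neg_left, ← map_neg, neg_sub, ← h3,
      map_smul, inner_smul_left, real_inner_comm]
    rfl
  rw [h2, M.sum_eq_sum_interiorEdges _ fun s hs => by rw [hu.2 s hs, inner_zero_left, mul_zero],
    formBstar]
  refine Finset.sum_congr rfl fun e he => ?_
  have hne := M.ne_of_mem_interiorEdges he
  have heq := (M.mem_interiorEdges.1 he).2
  rw [← M.primalLength_eq hne heq, ← hu.1 _ _ heq, M.primalNormal_eq_neg hne.symm heq.symm, map_neg,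
    inner_neg_right, inner_sub_right]
  ring

theorem formb_eq {u : M.Tri → Plane} (hu : M.IsVelocity u) (q : Fin M.card → ℝ) :
    M.formb u q = -∑ K, q K * ∑ i, (M.elem K).edgeLength i * ⟪u ⟨K, i⟩, (M.elem K).normal i⟫ := by
  have h := M.sum_eq_sum_interiorEdges
    (fun s => q s.1 * (M.primalLength s * ⟪u s, M.primalNormal s⟫))
    fun s hs => by rw [hu.2 s hs, inner_zero_left, mul_zero, mul_zero]
  rw [Fintype.sum_sigma] at h
  simp only [Finset.mul_sum]
  refine (congrArg Neg.neg (h.trans ?_)).symm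
  refine Finset.sum_congr rfl fun e he => ?_
  have hne := M.ne_of_mem_interiorEdges he
  have heq := (M.mem_interiorEdges.1 he).2
  rw [← M.primalLength_eq hne heq, ← hu.1 _ _ heq, M.primalNormal_eq_neg hne.symm heq.symm,
    inner_neg_right]
  ring

theorem area_pos (K : Fin M.card) : 0 < (M.elem K).area :=
  ENNReal.toReal_pos (Measure.measure_pos_of_mem_nhds _ (mem_interior_iff_mem_nhds.1 (M.center_mem K))).ne'
    (M.elem K).isCompact_carrier.measure_lt_top.ne

/-- A discretely divergence-free velocity has zero total flux through the boundary of every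
element. -/
theorem sum_flux_eq_zero {u : M.Tri → Plane} (hu : M.IsVelocity u)
    (h : ∀ q, M.IsPressure q → M.formb u q = 0) (K : Fin M.card) :
    ∑ i, (M.elem K).edgeLength i * ⟪u ⟨K, i⟩, (M.elem K).normal i⟫ = 0 := by
  have key : ∀ q, M.formb u q = 0 := by
    intro q
    have hA : 0 < ∑ K, (M.elem K).area := Finset.sum_pos (fun K _ => area_pos K) ⟨K, by simp⟩
    -- Subtracting the mean value does not change the jumps.
    have h2 := h (fun L => q L - (∑ K, (M.elem K).area * q K) / ∑ K, (M.elem K).area) (by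
      simp only [IsPressure, mul_sub, Finset.sum_sub_distrib, ← Finset.sum_mul]
      field_simp
      ring)
    simpa [formb] using h2
  have h3 := key fun L => if L = K then 1 else 0
  rw [formb_eq hu] at h3
  simpa using h3

/-- Vertex values of the stream function of the reconstruction on the element `K`. -/
noncomputable def streamCoeff (M : StaggeredMesh Ω) (u : M.Tri → Plane) (K : Fin M.card)
    (k : (M.elem K).Idx) : ℝ :=
  ∑ i, ⟪u ⟨K, i⟩, (M.elem K).normal i⟫ * (M.elem K).cCoeff (M.center K) i k

/-- For zero total flux the affine parts of the basis functions cancel, and the reconstruction is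
the curl of the Wachspress interpolant of the stream function values. -/
theorem recon_eq {u : M.Tri → Plane} {K : Fin M.card}
    (h : ∑ i, (M.elem K).edgeLength i * ⟪u ⟨K, i⟩, (M.elem K).normal i⟫ = 0) (x : Plane) :
    M.recon u K x = ∑ k, M.streamCoeff u K k • curl ((M.elem K).wachspress k) x := by
  simp only [recon, ConvexPolygon.basisFun, smul_add, Finset.sum_add_distrib, smul_smul,
    ← Finset.sum_smul]
  have h1 : ∑ i, ⟪u ⟨K, i⟩, (M.elem K).normal i⟫ *
      ((M.elem K).edgeLength i / (2 * (M.elem K).area)) = 0 := by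
    rw [← zero_div (2 * (M.elem K).area), ← h, Finset.sum_div]
    exact Finset.sum_congr rfl fun i _ => by ring
  rw [h1, zero_smul, zero_add]
  simp only [Finset.smul_sum, smul_smul, streamCoeff, Finset.sum_smul]
  exact Finset.sum_comm

theorem streamCoeff_eq {u : M.Tri → Plane} {K : Fin M.card}
    (h : ∑ i, (M.elem K).edgeLength i * ⟪u ⟨K, i⟩, (M.elem K).normal i⟫ = 0)
    (k : (M.elem K).Idx) :
    M.streamCoeff u K k = -(1 / (((M.elem K).extra + 3 : ℕ) : ℝ)) * ∑ l : (M.elem K).Idx,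
      (l.val : ℝ) * ((M.elem K).edgeLength (k + l) *
        ⟪u ⟨K, k + l⟩, (M.elem K).normal (k + l)⟫) := by
  have hb : ∀ l, ∑ i, ⟪u ⟨K, i⟩, (M.elem K).normal i⟫ * (M.elem K).bCoeff (M.center K) i l =
      (M.elem K).edgeLength l * ⟪u ⟨K, l⟩, (M.elem K).normal l⟫ := by
    intro l
    simp only [ConvexPolygon.bCoeff, mul_sub, Finset.sum_sub_distrib, mul_ite, mul_zero,
      Finset.sum_ite_eq', Finset.mem_univ, if_true]
    have : ∑ i, ⟪u ⟨K, i⟩, (M.elem K).normal i⟫ * ((M.elem K).edgeLength i *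
        ((M.elem K).subArea (M.center K) l / (M.elem K).area)) = 0 := by
      rw [← zero_mul ((M.elem K).subArea (M.center K) l / (M.elem K).area), ← h, Finset.sum_mul]
      exact Finset.sum_congr rfl fun i _ => by ring
    rw [this, sub_zero, mul_comm]
  simp only [streamCoeff, ConvexPolygon.cCoeff]
  simp only [← hb, Finset.mul_sum]
  rw [Finset.sum_comm]
  exact Finset.sum_congr rfl fun l _ => Finset.sum_congr rfl fun i _ => by ring

theorem fin_sub_one_val {n : ℕ} (l : Fin (n + 3)) :
    (((l - 1 : Fin (n + 3)).val : ℕ) : ℝ) =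
      (l.val : ℝ) - 1 + if l = 0 then ((n + 3 : ℕ) : ℝ) else 0 := by
  by_cases h : l = 0
  · subst h
    rw [if_pos rfl, zero_sub, Fin.val_neg]
    simp
    ring
  · rw [if_neg h, Fin.val_sub_one_of_ne_zero h, Nat.cast_sub]
    · simp
    · exact Nat.one_le_iff_ne_zero.2 fun h' => h (Fin.ext h')

/-- The increment of the stream function along an edge is minus the flux through it. -/
theorem streamCoeff_succ_sub {u : M.Tri → Plane} {K : Fin M.card}
    (h : ∑ i, (M.elem K).edgeLength i * ⟪u ⟨K, i⟩, (M.elem K).normal i⟫ = 0)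
    (k : (M.elem K).Idx) :
    M.streamCoeff u K (k + 1) - M.streamCoeff u K k =
      -((M.elem K).edgeLength k * ⟪u ⟨K, k⟩, (M.elem K).normal k⟫) := by
  rw [streamCoeff_eq h, streamCoeff_eq h]
  set R : (M.elem K).Idx → ℝ := fun i => (M.elem K).edgeLength i *
    ⟪u ⟨K, i⟩, (M.elem K).normal i⟫ with hR
  change -(1 / (((M.elem K).extra + 3 : ℕ) : ℝ)) * ∑ l : (M.elem K).Idx, (l.val : ℝ) * R (k + 1 + l) -
    -(1 / (((M.elem K).extra + 3 : ℕ) : ℝ)) * ∑ l : (M.elem K).Idx, (l.val : ℝ) * R (k + l) = -R k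
  -- After an index shift the two sums differ by `m R_k` only, as the total flux vanishes.
  have h1 : ∑ l : (M.elem K).Idx, (l.val : ℝ) * R (k + 1 + l) =
      ∑ l : (M.elem K).Idx, ((l - 1 : (M.elem K).Idx).val : ℝ) * R (k + l) := by
    rw [← Equiv.sum_comp (Equiv.addRight (1 : (M.elem K).Idx))
      fun l => ((l - 1 : (M.elem K).Idx).val : ℝ) * R (k + l)]
    refine Finset.sum_congr rfl fun l _ => ?_
    simp only [Equiv.coe_addRight, add_sub_cancel_right]
    rw [add_assoc, add_comm 1 l]
  have h2 : ∑ l : (M.elem K).Idx, R (k + l) = 0 :=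
    (Equiv.sum_comp (Equiv.addLeft k) R).trans h
  have hm : ((((M.elem K).extra + 3 : ℕ) : ℝ)) ≠ 0 := by positivity
  rw [h1]
  simp only [fin_sub_one_val, add_mul, sub_mul, one_mul, Finset.sum_add_distrib,
    Finset.sum_sub_distrib, h2, ite_mul, zero_mul, Finset.sum_ite_eq', Finset.mem_univ, if_true,
    add_zero]
  field_simp
  ring

theorem abs_streamCoeff_le {u : M.Tri → Plane} {K : Fin M.card}
    (h : ∑ i, (M.elem K).edgeLength i * ⟪u ⟨K, i⟩, (M.elem K).normal i⟫ = 0)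
    (k : (M.elem K).Idx) :
    |M.streamCoeff u K k| ≤ (M.elem K).diam * ∑ i, ‖u ⟨K, i⟩‖ := by
  rw [streamCoeff_eq h, abs_mul, abs_neg, abs_of_nonneg (by positivity), one_div,
    inv_mul_le_iff₀ (by positivity)]
  refine (Finset.abs_sum_le_sum_abs _ _).trans ?_
  rw [← Equiv.sum_comp (Equiv.addLeft k) fun i => ‖u ⟨K, i⟩‖, Finset.mul_sum, Finset.mul_sum]
  refine Finset.sum_le_sum fun l _ => ?_
  rw [abs_mul, abs_of_nonneg (by positivity), abs_mul, abs_of_pos ((M.elem K).edgeLength_pos _)]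
  have h1 : |⟪u ⟨K, k + l⟩, (M.elem K).normal (k + l)⟫| ≤ ‖u ⟨K, k + l⟩‖ := by
    refine (abs_real_inner_le_norm _ _).trans ?_
    rw [ConvexPolygon.norm_normal, mul_one]
  have h2 : (l.val : ℝ) ≤ (((M.elem K).extra + 3 : ℕ) : ℝ) := by exact_mod_cast l.isLt.le
  have h3 := (M.elem K).edgeLength_pos (k + l)
  have h4 := ConvexPolygon.edgeLength_le_diam (T := M.elem K) (k + l)
  have h5 := (M.elem K).diam_pos.le
  simp only [Equiv.coe_addLeft]
  gcongr

/-- Twice the area of the triangle `s`. -/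
noncomputable def triDet (M : StaggeredMesh Ω) (s : M.Tri) : ℝ :=
  det2 ((M.elem s.1).vert s.2 - M.center s.1) ((M.elem s.1).vert (s.2 + 1) - M.center s.1)

theorem triDet_eq (s : M.Tri) : M.triDet s =
    (M.elem s.1).edgeLength s.2 * (M.elem s.1).edgeDist s.2 (M.center s.1) := by
  rw [ConvexPolygon.edgeLength_mul_edgeDist, triDet]; simp [det2]; ring

theorem triDet_pos (s : M.Tri) : 0 < M.triDet s := by
  rw [triDet_eq]
  exact mul_pos ((M.elem s.1).edgeLength_pos _)
    ((M.elem s.1).edgeDist_pos_of_mem_interior (M.center_mem _) _)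

theorem norm_vert_sub_center_le (K : Fin M.card) (i : (M.elem K).Idx) :
    ‖(M.elem K).vert i - M.center K‖ ≤ (M.elem K).diam := by
  rw [← dist_eq_norm]
  exact ConvexPolygon.dist_le_diam ((M.elem K).vert_mem_carrier _) (interior_subset (M.center_mem K))

theorem carrier_subset_closedBall (K : Fin M.card) :
    (M.elem K).carrier ⊆ Metric.closedBall (M.center K) (M.elem K).diam := fun _ hx =>
  ConvexPolygon.dist_le_diam hx (interior_subset (M.center_mem K))

theorem volume_real_le_of_subset {A : Set Plane} {y : Plane} {r : ℝ} (hr : 0 ≤ r)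
    (h : A ⊆ Metric.closedBall y r) : volume.real A ≤ Real.pi * r ^ 2 := by
  refine (measureReal_mono h (isCompact_closedBall y r).measure_lt_top.ne).trans ?_
  rw [measureReal_def, EuclideanSpace.volume_closedBall_fin_two]
  simp [ENNReal.toReal_ofReal hr, ENNReal.toReal_ofReal Real.pi_pos.le, mul_comm]

theorem triArea_le (s : M.Tri) : M.triArea s ≤ Real.pi * (M.elem s.1).diam ^ 2 := by
  refine volume_real_le_of_subset (M.elem s.1).diam_pos.le
    (Set.Subset.trans ?_ (carrier_subset_closedBall s.1))
  refine convexHull_min ?_ (M.elem s.1).convex_carrier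
  rintro x (rfl | rfl | rfl)
  exacts [interior_subset (M.center_mem _), (M.elem s.1).vert_mem_carrier _,
    (M.elem s.1).vert_mem_carrier _]

/-- The matrix field whose normal components on the dual edges are minus the jumps of `u`, scaled
by the inverse edge lengths. -/
noncomputable def testGradient (M : StaggeredMesh Ω) (u : M.Tri → Plane) (s : M.Tri) :
    Matrix (Fin 2) (Fin 2) ℝ := fun i j =>
  (M.triDet s)⁻¹ * (M.dualJump u (M.nextTri s) i * ((M.elem s.1).vert s.2 - M.center s.1) j -
    M.dualJump u s i * ((M.elem s.1).vert (s.2 + 1) - M.center s.1) j)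

theorem testGradient_apply (u : M.Tri → Plane) (s : M.Tri) :
    Matrix.toEuclideanLin (M.testGradient u s) (rot ((M.elem s.1).vert s.2 - M.center s.1)) =
        -M.dualJump u s ∧
      Matrix.toEuclideanLin (M.testGradient u s)
          (rot ((M.elem s.1).vert (s.2 + 1) - M.center s.1)) =
        -M.dualJump u (M.nextTri s) := by
  have hD := (triDet_pos s).ne'
  have hD' := triDet.eq_def M s
  rw [det2] at hD'
  constructor <;> ext i <;>
    rw [toEuclideanLin_coord] <;>
    simp only [testGradient, rot_zero_coord, rot_one_coord] <;> field_simp <;>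
    rw [hD'] <;> simp <;> ring

theorem testGradient_isGradient (u : M.Tri → Plane) : M.IsGradient (M.testGradient u) := by
  intro s
  have h1 := (testGradient_apply u s).1
  have h2 := (testGradient_apply u (M.prevTri s)).2
  have h4 : (M.elem (M.prevTri s).1).vert ((M.prevTri s).2 + 1) = (M.elem s.1).vert s.2  :=
    congrArg (M.elem s.1).vert (sub_add_cancel s.2 1)
  rw [nextTri_prevTri, h4] at h2
  rw [dualNormal, map_smul, map_smul, h1]
  exact congrArg _ h2

theorem formB_testGradient (u : M.Tri → Plane) : M.formB (M.testGradient u) u = M.hNorm u ^ 2 := by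
  rw [hNorm_sq, formB, ← Finset.sum_neg_distrib]
  refine Finset.sum_congr rfl fun s _ => ?_
  have h1 := (testGradient_apply u s).1
  have h2 : M.dualLength s * ⟪Matrix.toEuclideanLin (M.testGradient u s) (M.dualNormal s),
      M.dualJump u s⟫ = ⟪Matrix.toEuclideanLin (M.testGradient u s)
        (M.dualLength s • M.dualNormal s), M.dualJump u s⟫ := by
    rw [map_smul, inner_smul_left]; rfl
  rw [h2, dualLength_smul_dualNormal, h1, inner_neg_left, neg_neg, real_inner_self_eq_norm_sq]

theorem matInner_testGradient_le {κ : ℝ} (hκ : 0 < κ)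
    (hD : ∀ s, κ * (M.elem s.1).diam ^ 2 ≤ M.triDet s) (u : M.Tri → Plane) :
    M.matInner (M.testGradient u) (M.testGradient u) ≤
      4 * Real.pi / κ ^ 2 * M.hNorm u ^ 2 := by
  have key : ∀ s, M.triArea s * ∑ i, ∑ j, M.testGradient u s i j * M.testGradient u s i j ≤
      2 * Real.pi / κ ^ 2 * (‖M.dualJump u (M.nextTri s)‖ ^ 2 + ‖M.dualJump u s‖ ^ 2) := by
    intro s
    set p := (M.elem s.1).vert s.2 - M.center s.1 with hp
    set q := (M.elem s.1).vert (s.2 + 1) - M.center s.1 with hq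
    set a := M.dualJump u (M.nextTri s) with ha
    set b := M.dualJump u s with hb
    set h := (M.elem s.1).diam with hh
    have hh0 : 0 < h := (M.elem s.1).diam_pos
    have hp2 : ‖p‖ ≤ h := norm_vert_sub_center_le _ _
    have hq2 : ‖q‖ ≤ h := norm_vert_sub_center_le _ _
    have h1 : ∑ i, ∑ j, M.testGradient u s i j * M.testGradient u s i j ≤
        ((M.triDet s)⁻¹) ^ 2 * (2 * (‖a‖ ^ 2 * ‖p‖ ^ 2 + ‖b‖ ^ 2 * ‖q‖ ^ 2)) := by
      simp only [Fin.sum_univ_two, testGradient, ← hp, ← hq, ← ha, ← hb, norm_sq_plane]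
      have hs := sq_nonneg ((M.triDet s)⁻¹)
      have : 0 ≤ ((M.triDet s)⁻¹) ^ 2 * ((a 0 * p 0 + b 0 * q 0) ^ 2 + (a 0 * p 1 + b 0 * q 1) ^ 2 +
          (a 1 * p 0 + b 1 * q 0) ^ 2 + (a 1 * p 1 + b 1 * q 1) ^ 2) := by positivity
      linarith
    have h2 : (M.triDet s)⁻¹ ≤ (κ * h ^ 2)⁻¹ := inv_anti₀ (by positivity) (hD s)
    have h3 : 0 < (M.triDet s)⁻¹ := inv_pos.2 (triDet_pos s)
    have hA : 0 ≤ M.triArea s := measureReal_nonneg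
    calc _ ≤ (Real.pi * h ^ 2) * (((κ * h ^ 2)⁻¹) ^ 2 * (2 * (‖a‖ ^ 2 * h ^ 2 + ‖b‖ ^ 2 * h ^ 2))) := by
          refine mul_le_mul (triArea_le s) (h1.trans ?_) ?_ (by positivity)
          · gcongr
          · exact Finset.sum_nonneg fun i _ => Finset.sum_nonneg fun j _ => mul_self_nonneg _
      _ = _ := by field_simp
  refine (Finset.sum_le_sum fun s _ => key s).trans ?_
  rw [← Finset.mul_sum, Finset.sum_add_distrib, M.sum_nextTri fun s => ‖M.dualJump u s‖ ^ 2,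
    hNorm_sq]
  exact le_of_eq (by ring)

theorem matInner_sq_le (ω ψ : M.Tri → Matrix (Fin 2) (Fin 2) ℝ) :
    M.matInner ω ψ ^ 2 ≤ M.matInner ω ω * M.matInner ψ ψ := by
  have hA : ∀ s, 0 ≤ M.triArea s := fun s => measureReal_nonneg
  have hform : ∀ ω ψ, M.matInner ω ψ = ∑ t : M.Tri × Fin 2 × Fin 2,
      (√(M.triArea t.1) * ω t.1 t.2.1 t.2.2) * (√(M.triArea t.1) * ψ t.1 t.2.1 t.2.2) := by
    intro ω ψ
    rw [matInner, Fintype.sum_prod_type]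
    refine Finset.sum_congr rfl fun s _ => ?_
    rw [Fintype.sum_prod_type, Finset.mul_sum]
    refine Finset.sum_congr rfl fun i _ => ?_
    rw [Finset.mul_sum]
    refine Finset.sum_congr rfl fun j _ => ?_
    dsimp only
    rw [mul_mul_mul_comm, Real.mul_self_sqrt (hA s)]
  rw [hform, hform, hform]
  have := Finset.sum_mul_sq_le_sq_mul_sq Finset.univ
    (fun t : M.Tri × Fin 2 × Fin 2 => √(M.triArea t.1) * ω t.1 t.2.1 t.2.2)
    (fun t => √(M.triArea t.1) * ψ t.1 t.2.1 t.2.2)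
  simpa only [sq] using this

/-- The discrete gradient controls the discrete `H¹` norm. -/
theorem hNorm_le_of_constitutive {κ : ℝ} (hκ : 0 < κ)
    (hD : ∀ s, κ * (M.elem s.1).diam ^ 2 ≤ M.triDet s) {ν : ℝ} (hν : 0 < ν)
    {u : M.Tri → Plane} {ω : M.Tri → Matrix (Fin 2) (Fin 2) ℝ} (hu : M.IsVelocity u)
    (h : ∀ ψ, M.IsGradient ψ → M.formBstar u ψ = ν⁻¹ * M.matInner ω ψ) :
    M.hNorm u ^ 2 ≤ 4 * Real.pi / κ ^ 2 * (ν⁻¹ ^ 2 * M.matInner ω ω) := by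
  have h1 := h _ (testGradient_isGradient u)
  rw [formBstar_eq_formB hu (testGradient_isGradient u), formB_testGradient] at h1
  have h2 := matInner_sq_le ω (M.testGradient u)
  have h3 := matInner_testGradient_le hκ hD u
  have h4 : 0 ≤ M.matInner ω ω := Finset.sum_nonneg fun s _ => mul_nonneg measureReal_nonneg
    (Finset.sum_nonneg fun i _ => Finset.sum_nonneg fun j _ => mul_self_nonneg _)
  rcases (sq_nonneg (M.hNorm u)).eq_or_lt with h0 | h0
  · rw [← h0]; positivity
  · refine le_of_mul_le_mul_right ?_ h0
    have h5 : M.hNorm u ^ 2 * M.hNorm u ^ 2 = ν⁻¹ ^ 2 * M.matInner ω (M.testGradient u) ^ 2 := by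
      rw [h1]; ring
    rw [h5]
    have h6 : 0 ≤ ν⁻¹ ^ 2 := sq_nonneg _
    calc _ ≤ ν⁻¹ ^ 2 * (M.matInner ω ω * (4 * Real.pi / κ ^ 2 * M.hNorm u ^ 2)) :=
          mul_le_mul_of_nonneg_left (h2.trans (mul_le_mul_of_nonneg_left h3 h4)) h6
      _ = _ := by ring

/-! ### A discrete Poincaré inequality -/

/-- The algebraic form of `∫ |u|² div x dx`, integrated by parts: the divergence theorem on a
triangle for the field `x` is an identity between determinants, the contributions of the primal
edges cancel in pairs, and those of the dual edges contain the jumps of `|u|²`. -/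
theorem sum_triDet_mul_normSq {u : M.Tri → Plane} (hu : M.IsVelocity u) :
    ∑ s, M.triDet s * ‖u s‖ ^ 2 =
      ∑ s, det2 (M.center s.1) ((M.elem s.1).vert s.2 - M.center s.1) *
        (‖u s‖ ^ 2 - ‖u (M.prevTri s)‖ ^ 2) := by
  let d : M.Tri → ℝ := fun s => det2 (M.center s.1) ((M.elem s.1).vert s.2 - M.center s.1)
  let e : M.Tri → ℝ := fun s =>
    det2 ((M.elem s.1).vert s.2) ((M.elem s.1).vert (s.2 + 1)) * ‖u s‖ ^ 2
  have h1 : ∀ s, M.triDet s * ‖u s‖ ^ 2 =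
      d s * ‖u s‖ ^ 2 + e s - d (M.nextTri s) * ‖u (M.prevTri (M.nextTri s))‖ ^ 2 := by
    intro s
    rw [prevTri_nextTri]
    simp only [triDet, d, e, det2, nextTri]
    simp; ring
  have h2 : ∑ s, e s = 0 := by
    rw [M.sum_eq_sum_interiorEdges e fun s hs => by simp [e, hu.2 s hs]]
    refine Finset.sum_eq_zero fun p hp => ?_
    have hne := M.ne_of_mem_interiorEdges hp
    have heq := (M.mem_interiorEdges.1 hp).2
    obtain ⟨h3, h4⟩ := M.vert_eq_of_primalEdge_eq hne heq
    simp only [e, h3, h4, hu.1 _ _ heq, det2]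
    ring
  rw [Finset.sum_congr rfl fun s _ => h1 s, Finset.sum_sub_distrib, Finset.sum_add_distrib, h2,
    M.sum_nextTri fun s => d s * ‖u (M.prevTri s)‖ ^ 2, add_zero, ← Finset.sum_sub_distrib]
  exact Finset.sum_congr rfl fun s _ => by simp only [d]; ring

theorem sum_diam_sq_mul_normSq_le {κ R : ℝ} (hκ : 0 < κ)
    (hD : ∀ s, κ * (M.elem s.1).diam ^ 2 ≤ M.triDet s) (hR : ∀ K, ‖M.center K‖ ≤ R)
    {u : M.Tri → Plane} (hu : M.IsVelocity u) :
    ∑ s, (M.elem s.1).diam ^ 2 * ‖u s‖ ^ 2 ≤ (2 * R / κ) ^ 2 * M.hNorm u ^ 2 := by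
  set X := ∑ s, (M.elem s.1).diam ^ 2 * ‖u s‖ ^ 2 with hX
  have hX0 : 0 ≤ X := Finset.sum_nonneg fun s _ => by positivity
  have h1 : κ * X ≤ R * ∑ s, ‖M.dualJump u s‖ *
      ((M.elem s.1).diam * (‖u s‖ + ‖u (M.prevTri s)‖)) := by
    calc κ * X ≤ ∑ s, M.triDet s * ‖u s‖ ^ 2 := by
          rw [hX, Finset.mul_sum]
          refine Finset.sum_le_sum fun s _ => ?_
          rw [← mul_assoc]
          exact mul_le_mul_of_nonneg_right (hD s) (sq_nonneg _)
      _ ≤ _ := by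
          rw [sum_triDet_mul_normSq hu, Finset.mul_sum]
          refine Finset.sum_le_sum fun s _ => ?_
          have ha : |det2 (M.center s.1) ((M.elem s.1).vert s.2 - M.center s.1)| ≤
              R * (M.elem s.1).diam := by
            refine (abs_det2_le _ _).trans ?_
            have := norm_vert_sub_center_le s.1 s.2
            have := hR s.1
            gcongr
            exact (norm_nonneg _).trans this
          have hb : |‖u s‖ ^ 2 - ‖u (M.prevTri s)‖ ^ 2| ≤
              ‖M.dualJump u s‖ * (‖u s‖ + ‖u (M.prevTri s)‖) := by
            rw [sq_sub_sq, abs_mul, mul_comm, abs_of_nonneg (by positivity : 0 ≤ ‖u s‖ + _)]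
            refine mul_le_mul_of_nonneg_right ?_ (by positivity)
            rw [dualJump, norm_sub_rev]
            exact abs_norm_sub_norm_le _ _
          calc _ ≤ |det2 (M.center s.1) ((M.elem s.1).vert s.2 - M.center s.1)| *
                |‖u s‖ ^ 2 - ‖u (M.prevTri s)‖ ^ 2| := by rw [← abs_mul]; exact le_abs_self _
            _ ≤ (R * (M.elem s.1).diam) * (‖M.dualJump u s‖ * (‖u s‖ + ‖u (M.prevTri s)‖)) :=
                mul_le_mul ha hb (abs_nonneg _) ((abs_nonneg _).trans ha)
            _ = _ := by ring
  have h2 : ∑ s, ((M.elem s.1).diam * (‖u s‖ + ‖u (M.prevTri s)‖)) ^ 2 ≤ 4 * X := by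
    have : ∀ s, ((M.elem s.1).diam * (‖u s‖ + ‖u (M.prevTri s)‖)) ^ 2 ≤
        2 * ((M.elem s.1).diam ^ 2 * ‖u s‖ ^ 2) +
          2 * ((M.elem (M.prevTri s).1).diam ^ 2 * ‖u (M.prevTri s)‖ ^ 2) := by
      intro s
      change _ ≤ _ + 2 * ((M.elem s.1).diam ^ 2 * _)
      nlinarith [sq_nonneg ((M.elem s.1).diam * (‖u s‖ - ‖u (M.prevTri s)‖))]
    refine (Finset.sum_le_sum fun s _ => this s).trans ?_
    rw [Finset.sum_add_distrib, ← Finset.mul_sum, ← Finset.mul_sum,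
      M.sum_prevTri fun s => (M.elem s.1).diam ^ 2 * ‖u s‖ ^ 2]
    linarith
  have h3 := Finset.sum_mul_sq_le_sq_mul_sq Finset.univ (fun s => ‖M.dualJump u s‖)
    fun s => (M.elem s.1).diam * (‖u s‖ + ‖u (M.prevTri s)‖)
  rw [← hNorm_sq] at h3
  rcases hX0.eq_or_lt with h0 | h0
  · rw [← h0]; positivity
  refine le_of_mul_le_mul_right ?_ h0
  have h4 : (κ * X) ^ 2 ≤ R ^ 2 * (M.hNorm u ^ 2 * (4 * X)) := by
    calc (κ * X) ^ 2 ≤ (R * ∑ s, ‖M.dualJump u s‖ *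
          ((M.elem s.1).diam * (‖u s‖ + ‖u (M.prevTri s)‖))) ^ 2 :=
          pow_le_pow_left₀ (by positivity) h1 2
      _ = R ^ 2 * (∑ s, ‖M.dualJump u s‖ *
          ((M.elem s.1).diam * (‖u s‖ + ‖u (M.prevTri s)‖))) ^ 2 := by ring
      _ ≤ _ := by gcongr; exact h3.trans (mul_le_mul_of_nonneg_left h2 (sq_nonneg _))
  have h5 : (2 * R / κ) ^ 2 * M.hNorm u ^ 2 * X = R ^ 2 * (M.hNorm u ^ 2 * (4 * X)) / κ ^ 2 := by
    field_simp; ring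
  rw [h5, le_div_iff₀ (by positivity)]
  linarith

end StaggeredMesh

/-! ### Lipschitz stream functions and weak gradients -/

theorem norm_curl (φ : Plane → ℝ) (x : Plane) : ‖curl φ x‖ = ‖fderiv ℝ φ x‖ := by
  rw [curl, norm_rot, norm_grad]

theorem curl_congr {φ ψ : Plane → ℝ} {x : Plane} (h : φ =ᶠ[𝓝 x] ψ) : curl φ x = curl ψ x := by
  rw [curl, curl, grad, grad, h.fderiv_eq]

/-- The curl as a function of the derivative. -/
noncomputable def curlOfFDeriv (A : Plane →L[ℝ] ℝ) : Plane := rot !₂[A (unitVec 0), A (unitVec 1)]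

theorem continuous_curlOfFDeriv : Continuous curlOfFDeriv := by
  have h : ∀ e : Plane, Continuous fun A : Plane →L[ℝ] ℝ => A e := fun e => by fun_prop
  unfold curlOfFDeriv rot
  refine (PiLp.continuous_toLp 2 _).comp (continuous_pi fun i => ?_)
  fin_cases i
  · exact (h _).neg
  · exact h _

theorem measurable_curl (φ : Plane → ℝ) : Measurable (curl φ) :=
  continuous_curlOfFDeriv.measurable.comp (measurable_fderiv ℝ φ)

theorem contDiff_fderiv_apply {φ : Plane → ℝ} (h : ContDiff ℝ (⊤ : ℕ∞) φ) (e : Plane) :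
    ContDiff ℝ (⊤ : ℕ∞) fun x => fderiv ℝ φ x e :=
  (h.fderiv_right (m := ((⊤ : ℕ∞) : WithTop ℕ∞)) (by simp)).clm_apply contDiff_const

theorem fderiv_fderiv_comm {φ : Plane → ℝ} {x : Plane} (h : ContDiffAt ℝ 2 φ x) (a b : Plane) :
    fderiv ℝ (fun y => fderiv ℝ φ y a) x b = fderiv ℝ (fun y => fderiv ℝ φ y b) x a := by
  have hd : DifferentiableAt ℝ (fderiv ℝ φ) x :=
    (h.fderiv_right (m := 1) (by norm_num)).differentiableAt (by norm_num)
  have hs : IsSymmSndFDerivAt ℝ φ x := h.isSymmSndFDerivAt (by simp)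
  rw [fderiv_clm_apply hd (differentiableAt_const a), fderiv_clm_apply hd (differentiableAt_const b)]
  simpa using hs.eq b a

theorem IsTestFunction.mul_fderiv {Ω : Set Plane} {S θ : Plane → ℝ} (hS : IsTestFunction Ω S)
    (hθ : ContDiff ℝ (⊤ : ℕ∞) θ) (e : Plane) :
    IsTestFunction Ω fun x => θ x * fderiv ℝ S x e := by
  have hsub : Function.support (fun x => θ x * fderiv ℝ S x e) ⊆ tsupport S := by
    intro x hx
    refine support_fderiv_subset ℝ (f := S) ?_
    intro h
    apply hx
    simp [h]
  exact ⟨hθ.mul (contDiff_fderiv_apply hS.1 e), hS.2.1.mono' hsub,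
    (closure_minimal hsub (isClosed_tsupport S)).trans hS.2.2⟩

section

variable {Ω : Set Plane}

theorem integrableOn_of_memLp {E : Type*} [NormedAddCommGroup E] {χ : Plane → E}
    (hb : Bornology.IsBounded Ω) (h : MemLp χ 2 (volume.restrict Ω)) : IntegrableOn χ Ω := by
  have : IsFiniteMeasure (volume.restrict Ω) :=
    ⟨by rw [Measure.restrict_apply_univ]; exact hb.measure_lt_top⟩
  exact h.integrable (by norm_num)

theorem integrableOn_continuous_mul {χ a : Plane → ℝ} (hb : Bornology.IsBounded Ω)
    (hΩ : MeasurableSet Ω) (h : IntegrableOn χ Ω) (ha : Continuous a) :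
    IntegrableOn (fun x => a x * χ x) Ω := by
  obtain ⟨C, hC⟩ := (hb.isCompact_closure).exists_bound_of_continuousOn ha.continuousOn
  refine Integrable.bdd_mul (c := C) h ha.aestronglyMeasurable ?_
  filter_upwards [ae_restrict_mem hΩ] with x hx using hC x (subset_closure hx)

/-- The weak gradient of `θ χ`, as computed by the product rule, is orthogonal to the curls of
test functions. -/
theorem integral_inner_curl_eq_zero_of_isTestFunction (hb : Bornology.IsBounded Ω)
    (hΩ : IsOpen Ω) {χ : Plane → ℝ} {G : Plane → Plane} (hχ : HasWeakGradient Ω χ G)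
    {θ : Plane → ℝ} (hθ : ContDiff ℝ (⊤ : ℕ∞) θ) {S : Plane → ℝ} (hS : IsTestFunction Ω S) :
    ∫ x in Ω, ⟪curl S x, θ x • G x + χ x • grad θ x⟫ = 0 := by
  have hχi := integrableOn_of_memLp hb hχ.1
  have hGi := integrableOn_of_memLp hb hχ.2.1
  have hGc : ∀ i, IntegrableOn (fun x => G x i) Ω := fun i =>
    (EuclideanSpace.proj i : Plane →L[ℝ] ℝ).integrable_comp hGi
  have hd : ∀ e : Plane, ContDiff ℝ (⊤ : ℕ∞) fun x => fderiv ℝ S x e :=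
    contDiff_fderiv_apply hS.1
  have hdθ : ∀ e : Plane, ContDiff ℝ (⊤ : ℕ∞) fun x => fderiv ℝ θ x e :=
    contDiff_fderiv_apply hθ
  have h0 := hχ.2.2 _ (hS.mul_fderiv hθ (unitVec 1)) 0
  have h1 := hχ.2.2 _ (hS.mul_fderiv hθ (unitVec 0)) 1
  have hder : ∀ a b x, fderiv ℝ (fun x => θ x * fderiv ℝ S x a) x b =
      θ x * fderiv ℝ (fun y => fderiv ℝ S y a) x b + fderiv ℝ S x a * fderiv ℝ θ x b := by
    intro a b x
    rw [fderiv_fun_mul (hθ.differentiable (by simp) x) ((hd a).differentiable (by simp) x)]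
    simp
  have hd2 : ∀ a b : Plane, Continuous fun x => fderiv ℝ (fun y => fderiv ℝ S y a) x b :=
    fun a b => (contDiff_fderiv_apply (hd a) b).continuous
  have i0 : IntegrableOn (fun x => χ x * fderiv ℝ (fun x => θ x * fderiv ℝ S x (unitVec 1)) x
      (unitVec 0)) Ω := by
    simp only [hder, mul_comm (χ _)]
    exact integrableOn_continuous_mul hb hΩ.measurableSet hχi
      ((hθ.continuous.mul (hd2 _ _)).add ((hd _).continuous.mul (hdθ _).continuous))
  have i1 : IntegrableOn (fun x => χ x * fderiv ℝ (fun x => θ x * fderiv ℝ S x (unitVec 0)) x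
      (unitVec 1)) Ω := by
    simp only [hder, mul_comm (χ _)]
    exact integrableOn_continuous_mul hb hΩ.measurableSet hχi
      ((hθ.continuous.mul (hd2 _ _)).add ((hd _).continuous.mul (hdθ _).continuous))
  have j0 : IntegrableOn (fun x => G x 0 * (θ x * fderiv ℝ S x (unitVec 1))) Ω := by
    simp only [mul_comm (G _ _)]
    exact integrableOn_continuous_mul hb hΩ.measurableSet (hGc 0)
      (hθ.continuous.mul (hd _).continuous)
  have j1 : IntegrableOn (fun x => G x 1 * (θ x * fderiv ℝ S x (unitVec 0))) Ω := by
    simp only [mul_comm (G _ _)]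
    exact integrableOn_continuous_mul hb hΩ.measurableSet (hGc 1)
      (hθ.continuous.mul (hd _).continuous)
  have hpt : ∀ x, ⟪curl S x, θ x • G x + χ x • grad θ x⟫ =
      (χ x * fderiv ℝ (fun x => θ x * fderiv ℝ S x (unitVec 0)) x (unitVec 1) +
        G x 1 * (θ x * fderiv ℝ S x (unitVec 0))) -
      (χ x * fderiv ℝ (fun x => θ x * fderiv ℝ S x (unitVec 1)) x (unitVec 0) +
        G x 0 * (θ x * fderiv ℝ S x (unitVec 1))) := by
    intro x
    rw [hder, hder, fderiv_fderiv_comm (contDiff_infty.1 hS.1 2).contDiffAt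
      (unitVec 0) (unitVec 1), inner_plane]
    simp [curl, grad]
    ring
  simp only [hpt]
  have hsub := integral_sub (i1.add j1) (i0.add j0)
  simp only [Pi.add_apply] at hsub
  rw [hsub, integral_add i1 j1, integral_add i0 j0, h0, h1]
  ring

/-! ### Mollification -/

theorem hasFDerivAt_mollify {S : Plane → ℝ} {L : NNReal} (hS : LipschitzWith L S)
    (φ : ContDiffBump (0 : Plane)) (x : Plane) :
    HasFDerivAt (convolution (φ.normed volume) S (ContinuousLinearMap.lsmul ℝ ℝ) volume)
      (convolution (φ.normed volume) (fderiv ℝ S) (ContinuousLinearMap.lsmul ℝ ℝ) volume x) x := by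
  have hφc : Continuous (φ.normed volume) := φ.continuous_normed
  have hint : Integrable (φ.normed volume) volume := φ.integrable_normed
  have h := hasFDerivAt_integral_of_dominated_loc_of_lip (𝕜 := ℝ) (μ := volume) (x₀ := x)
    (s := Set.univ) (F := fun x t => φ.normed volume t * S (x - t))
    (F' := fun t => φ.normed volume t • fderiv ℝ S (x - t))
    (bound := fun t => φ.normed volume t * L) univ_mem ?_ ?_ ?_ ?_ ?_ ?_
  · exact h.2
  · exact Eventually.of_forall fun y =>
      (hφc.mul (hS.continuous.comp (by fun_prop))).aestronglyMeasurable
  · refine Continuous.integrable_of_hasCompactSupport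
      (hφc.mul (hS.continuous.comp (by fun_prop))) ?_
    exact φ.hasCompactSupport_normed.mul_right
  · exact (hφc.measurable.smul ((measurable_fderiv ℝ S).comp
      (measurable_const.sub measurable_id))).aestronglyMeasurable
  · refine Eventually.of_forall fun t => LipschitzOnWith.of_dist_le_mul fun y _ z _ => ?_
    have h1 := φ.nonneg_normed (μ := volume) t
    rw [dist_eq_norm, ← mul_sub, norm_mul, Real.norm_eq_abs, abs_of_nonneg h1,
      Real.coe_nnabs, abs_of_nonneg (by positivity), mul_assoc]
    refine mul_le_mul_of_nonneg_left ?_ h1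
    rw [← dist_eq_norm]
    simpa using hS.dist_le_mul (y - t) (z - t)
  · exact hint.mul_const _
  · have hae : ∀ᵐ t : Plane, DifferentiableAt ℝ S (x - t) :=
      (quasiMeasurePreserving_sub_left volume x).ae hS.ae_differentiableAt
    filter_upwards [hae] with t ht
    have h1 : HasFDerivAt (fun y => S (y - t)) (fderiv ℝ S (x - t)) x := by
      have := ht.hasFDerivAt.comp x ((hasFDerivAt_id x).sub_const t)
      exact this
    exact h1.const_mul _

theorem lipschitz_fderiv_locallyIntegrable {S : Plane → ℝ} {L : NNReal} (hS : LipschitzWith L S) :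
    LocallyIntegrable (fderiv ℝ S) volume := by
  refine LocallyIntegrable.mono (locallyIntegrable_const (L : ℝ))
    (measurable_fderiv ℝ S).aestronglyMeasurable (Eventually.of_forall fun x => ?_)
  exact (norm_fderiv_le_of_lipschitz ℝ hS).trans (le_abs_self _)

theorem norm_mollify_fderiv_le {S : Plane → ℝ} {L : NNReal} (hS : LipschitzWith L S)
    (φ : ContDiffBump (0 : Plane)) (x : Plane) :
    ‖convolution (φ.normed volume) (fderiv ℝ S) (ContinuousLinearMap.lsmul ℝ ℝ) volume x‖ ≤ L := by
  have h1 : ∫ t, φ.normed volume t * (L : ℝ) = L := by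
    rw [integral_mul_const, φ.integral_normed, one_mul]
  rw [← h1]
  refine norm_integral_le_of_norm_le (φ.integrable_normed.mul_const _)
    (Eventually.of_forall fun t => ?_)
  have h2 := φ.nonneg_normed (μ := volume) t
  rw [ContinuousLinearMap.lsmul_apply, norm_smul, Real.norm_eq_abs, abs_of_nonneg h2]
  exact mul_le_mul_of_nonneg_left (norm_fderiv_le_of_lipschitz ℝ hS) h2

/-- The orthogonality to curls of test functions extends to Lipschitz stream functions with
compact support, by mollification. -/
theorem integral_inner_curl_eq_zero_of_tsupport (hΩ : IsOpen Ω) {H : Plane → Plane}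
    (hH : IntegrableOn H Ω)
    (h0 : ∀ S, IsTestFunction Ω S → ∫ x in Ω, ⟪curl S x, H x⟫ = 0) {S : Plane → ℝ} {L : NNReal}
    (hS : LipschitzWith L S) (hc : HasCompactSupport S) (hsub : tsupport S ⊆ Ω) :
    ∫ x in Ω, ⟪curl S x, H x⟫ = 0 := by
  obtain ⟨δ, hδ, hδsub⟩ := IsCompact.exists_cthickening_subset_open hc hΩ hsub
  let φ : ℕ → ContDiffBump (0 : Plane) := fun n =>
    ⟨δ / (n + 1) / 2, δ / (n + 1), by positivity, by
      have : 0 < δ / ((n : ℝ) + 1) := by positivity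
      linarith⟩
  have hφ : Tendsto (fun n => (φ n).rOut) atTop (𝓝 0) := by
    have := (tendsto_one_div_add_atTop_nhds_zero_nat (𝕜 := ℝ)).const_mul δ
    simpa [φ, div_eq_mul_inv] using this
  let Sn : ℕ → Plane → ℝ := fun n =>
    convolution ((φ n).normed volume) S (ContinuousLinearMap.lsmul ℝ ℝ) volume
  have hder : ∀ n x, fderiv ℝ (Sn n) x = convolution ((φ n).normed volume) (fderiv ℝ S)
      (ContinuousLinearMap.lsmul ℝ ℝ) volume x := fun n x =>
    (hasFDerivAt_mollify hS (φ n) x).fderiv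
  have htest : ∀ n, IsTestFunction Ω (Sn n) := by
    intro n
    refine ⟨(φ n).hasCompactSupport_normed.contDiff_convolution_left _ (φ n).contDiff_normed
      hS.continuous.locallyIntegrable, (φ n).hasCompactSupport_normed.convolution _ hc, ?_⟩
    refine (closure_minimal ?_ Metric.isClosed_cthickening).trans hδsub
    refine (support_convolution_subset _).trans ?_
    rw [(φ n).support_normed_eq]
    rintro _ ⟨a, ha, b, hb, rfl⟩
    refine Metric.mem_cthickening_of_dist_le _ b δ _ (subset_closure hb) ?_
    rw [Metric.mem_ball, dist_zero_right] at ha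
    rw [dist_eq_norm]
    simp only [add_sub_cancel_right]
    refine ha.le.trans ?_
    exact div_le_self hδ.le (by simp)
  have hae := ContDiffBump.ae_convolution_tendsto_right_of_locallyIntegrable (μ := volume) (K := 2)
    (φ := φ) hφ (Eventually.of_forall fun n => le_of_eq (by simp only [φ]; ring))
    (lipschitz_fderiv_locallyIntegrable hS)
  have hlim : Tendsto (fun n => ∫ x in Ω, ⟪curl (Sn n) x, H x⟫) atTop
      (𝓝 (∫ x in Ω, ⟪curl S x, H x⟫)) := by
    refine tendsto_integral_of_dominated_convergence (fun x => L * ‖H x‖)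
      (fun n => (measurable_curl _).aestronglyMeasurable.inner hH.1) (hH.norm.const_mul _)
      (fun n => Eventually.of_forall fun x => ?_) ?_
    · refine (norm_inner_le_norm _ _).trans (mul_le_mul_of_nonneg_right ?_ (norm_nonneg _))
      rw [norm_curl, hder]
      exact norm_mollify_fderiv_le hS (φ n) x
    · filter_upwards [ae_restrict_of_ae hae] with x hx
      refine Tendsto.inner ?_ tendsto_const_nhds
      have h2 : ∀ n, curl (Sn n) x = curlOfFDeriv (convolution ((φ n).normed volume) (fderiv ℝ S)
          (ContinuousLinearMap.lsmul ℝ ℝ) volume x) := fun n => by rw [← hder]; rfl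
      simp only [h2]
      exact (continuous_curlOfFDeriv.tendsto _).comp hx
  simp only [h0 _ (htest _)] at hlim
  exact tendsto_nhds_unique hlim tendsto_const_nhds

/-! ### Cutting off near the boundary -/

/-- A cutoff function: zero at distance at most `t` from the complement of `Ω`, and one at distance
at least `2 t`. -/
noncomputable def cutoff (Ω : Set Plane) (t : ℝ) (x : Plane) : ℝ :=
  max 0 (min 1 (Metric.infDist x Ωᶜ / t - 1))

theorem abs_cutoff_sub_le {t : ℝ} (ht : 0 < t) (x y : Plane) :
    |cutoff Ω t x - cutoff Ω t y| ≤ dist x y / t := by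
  have h1 : |Metric.infDist x Ωᶜ - Metric.infDist y Ωᶜ| ≤ dist x y := by
    simpa [Real.dist_eq] using (Metric.lipschitz_infDist_pt Ωᶜ).dist_le_mul x y
  refine (abs_max_sub_max_le_max _ _ _ _).trans ?_
  rw [sub_self, abs_zero]
  refine max_le (by positivity) ?_
  refine (abs_min_sub_min_le_max _ _ _ _).trans ?_
  rw [sub_self, abs_zero]
  refine max_le (by positivity) ?_
  rw [show Metric.infDist x Ωᶜ / t - 1 - (Metric.infDist y Ωᶜ / t - 1) =
    (Metric.infDist x Ωᶜ - Metric.infDist y Ωᶜ) / t by ring, abs_div, abs_of_pos ht]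
  gcongr

theorem cutoff_eq_one {t : ℝ} (ht : 0 < t) {x : Plane} (hx : 2 * t ≤ Metric.infDist x Ωᶜ) :
    cutoff Ω t x = 1 := by
  have : 2 ≤ Metric.infDist x Ωᶜ / t := (le_div_iff₀ ht).2 hx
  rw [cutoff, min_eq_left (by linarith), max_eq_right zero_le_one]

theorem cutoff_eq_zero {t : ℝ} (ht : 0 < t) {x : Plane} (hx : Metric.infDist x Ωᶜ ≤ t) :
    cutoff Ω t x = 0 := by
  have : Metric.infDist x Ωᶜ / t ≤ 1 := (div_le_one ht).2 hx
  rw [cutoff, max_eq_left]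
  exact (min_le_right _ _).trans (by linarith)

theorem cutoff_mem (t : ℝ) (x : Plane) : 0 ≤ cutoff Ω t x ∧ cutoff Ω t x ≤ 1 :=
  ⟨le_max_left _ _, max_le zero_le_one (min_le_left _ _)⟩

/-- The Lipschitz constant of the cut-off function does not depend on `t`, since a Lipschitz
function vanishing off `Ω` is of order `t` where the cutoff varies. -/
theorem lipschitzWith_mul_cutoff {S : Plane → ℝ} {L : NNReal} (hS : LipschitzWith L S)
    (hne : (Ωᶜ).Nonempty) (hz : ∀ x ∉ Ω, S x = 0) {t : ℝ} (ht : 0 < t) :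
    LipschitzWith (3 * L) fun x => S x * cutoff Ω t x := by
  have hSd : ∀ y, |S y| ≤ L * Metric.infDist y Ωᶜ := by
    intro y
    have hL : (0 : ℝ) ≤ L := L.2
    refine le_of_forall_pos_le_add fun ε hε => ?_
    obtain ⟨z, hz1, hz2⟩ := (Metric.infDist_lt_iff hne (r := Metric.infDist y Ωᶜ + ε / (L + 1))).1
      (lt_add_of_pos_right _ (by positivity))
    have h1 := hS.dist_le_mul y z
    rw [hz z hz1, Real.dist_eq, sub_zero] at h1
    refine h1.trans ((mul_le_mul_of_nonneg_left hz2.le hL).trans ?_)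
    rw [mul_add]
    gcongr
    rw [← mul_div_assoc, div_le_iff₀ (by positivity)]
    nlinarith
  have key : ∀ x y, Metric.infDist y Ωᶜ ≤ Metric.infDist x Ωᶜ →
      |S x * cutoff Ω t x - S y * cutoff Ω t y| ≤ 3 * L * dist x y := by
    intro x y hxy
    have h1 : |S x - S y| ≤ L * dist x y := by
      simpa [Real.dist_eq] using hS.dist_le_mul x y
    have h2 : |S y| * |cutoff Ω t x - cutoff Ω t y| ≤ 2 * L * dist x y := by
      by_cases h : 2 * t ≤ Metric.infDist y Ωᶜ
      · rw [cutoff_eq_one ht h, cutoff_eq_one ht (h.trans hxy), sub_self, abs_zero, mul_zero]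
        positivity
      · push Not at h
        calc _ ≤ (L * (2 * t)) * (dist x y / t) := by
              refine mul_le_mul ((hSd y).trans ?_) (abs_cutoff_sub_le ht x y) (abs_nonneg _)
                (by positivity)
              gcongr
          _ = _ := by field_simp
    have h3 := cutoff_mem (Ω := Ω) t x
    calc _ = |(S x - S y) * cutoff Ω t x + S y * (cutoff Ω t x - cutoff Ω t y)| := by
          congr 1; ring
      _ ≤ |S x - S y| * 1 + 2 * L * dist x y := by
          refine (abs_add_le _ _).trans ?_
          rw [abs_mul, abs_mul, abs_of_nonneg h3.1]
          gcongr
          exact h3.2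
      _ ≤ _ := by linarith
  refine LipschitzWith.of_dist_le_mul fun x y => ?_
  rw [Real.dist_eq]
  push_cast
  rcases le_total (Metric.infDist y Ωᶜ) (Metric.infDist x Ωᶜ) with h | h
  · exact key x y h
  · rw [abs_sub_comm, dist_comm]; exact key y x h

/-- The orthogonality extends to Lipschitz stream functions vanishing off `Ω`. -/
theorem integral_inner_curl_eq_zero_of_lipschitz (hb : Bornology.IsBounded Ω) (hΩ : IsOpen Ω)
    {H : Plane → Plane} (hH : IntegrableOn H Ω)
    (h0 : ∀ S, IsTestFunction Ω S → ∫ x in Ω, ⟪curl S x, H x⟫ = 0) {S : Plane → ℝ} {L : NNReal}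
    (hS : LipschitzWith L S) (hz : ∀ x ∉ Ω, S x = 0) :
    ∫ x in Ω, ⟪curl S x, H x⟫ = 0 := by
  have hne : (Ωᶜ).Nonempty := by
    rw [Set.nonempty_compl]
    rintro rfl
    exact NormedSpace.unbounded_univ ℝ Plane hb
  let t : ℕ → ℝ := fun n => 1 / ((n : ℝ) + 1)
  have ht : ∀ n, 0 < t n := fun n => Nat.one_div_pos_of_nat
  have htl : Tendsto t atTop (𝓝 0) := tendsto_one_div_add_atTop_nhds_zero_nat
  have hL : ∀ n, LipschitzWith (3 * L) fun x => S x * cutoff Ω (t n) x := fun n =>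
    lipschitzWith_mul_cutoff hS hne hz (ht n)
  have hsup : ∀ n, tsupport (fun x => S x * cutoff Ω (t n) x) ⊆
      {x | t n ≤ Metric.infDist x Ωᶜ} := by
    intro n
    refine closure_minimal (fun x hx => ?_)
      (isClosed_le continuous_const (Metric.continuous_infDist_pt _))
    by_contra h
    exact hx (by simp only [cutoff_eq_zero (ht n) (not_le.1 h).le, mul_zero])
  have hsub : ∀ n, tsupport (fun x => S x * cutoff Ω (t n) x) ⊆ Ω := by
    intro n x hx
    by_contra hxΩ
    have h1 : t n ≤ Metric.infDist x Ωᶜ := hsup n hx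
    rw [Metric.infDist_zero_of_mem (show x ∈ Ωᶜ from hxΩ)] at h1
    exact absurd (ht n) (not_lt.2 h1)
  have hzero : ∀ n, ∫ x in Ω, ⟪curl (fun x => S x * cutoff Ω (t n) x) x, H x⟫ = 0 := fun n =>
    integral_inner_curl_eq_zero_of_tsupport hΩ hH h0 (hL n)
      (Metric.isCompact_of_isClosed_isBounded (isClosed_tsupport _) (hb.subset (hsub n))) (hsub n)
  have hlim : Tendsto (fun n => ∫ x in Ω, ⟪curl (fun x => S x * cutoff Ω (t n) x) x, H x⟫) atTop
      (𝓝 (∫ x in Ω, ⟪curl S x, H x⟫)) := by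
    refine tendsto_integral_of_dominated_convergence (fun x => (3 * L : NNReal) * ‖H x‖)
      (fun n => (measurable_curl _).aestronglyMeasurable.inner hH.1) (hH.norm.const_mul _)
      (fun n => Eventually.of_forall fun x => ?_) ?_
    · refine (norm_inner_le_norm _ _).trans (mul_le_mul_of_nonneg_right ?_ (norm_nonneg _))
      rw [norm_curl]
      exact norm_fderiv_le_of_lipschitz ℝ (hL n)
    · filter_upwards [ae_restrict_mem hΩ.measurableSet] with x hx
      have hpos : 0 < Metric.infDist x Ωᶜ := by
        rw [← hΩ.isClosed_compl.notMem_iff_infDist_pos hne]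
        exact fun h => h hx
      refine tendsto_const_nhds.congr' ?_
      have h2 : ∀ᶠ n in atTop, 2 * t n < Metric.infDist x Ωᶜ := by
        have := htl.const_mul 2
        rw [mul_zero] at this
        exact this.eventually (gt_mem_nhds hpos)
      filter_upwards [h2] with n hn
      congr 1
      refine curl_congr ?_
      filter_upwards [((Metric.continuous_infDist_pt Ωᶜ).tendsto x).eventually (lt_mem_nhds hn)]
        with y hy
      rw [cutoff_eq_one (ht n) hy.le, mul_one]
  simp only [hzero] at hlim
  exact tendsto_nhds_unique hlim tendsto_const_nhds

/-! ### Gluing Lipschitz functions -/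

/-- A function on the plane which is `K`-Lipschitz on each of finitely many closed sets covering
the plane is `K`-Lipschitz. -/
theorem lipschitzWith_of_finite_closed_cover {ι : Type*} [Finite ι] {A : ι → Set Plane}
    (hA : ∀ i, IsClosed (A i)) (hcov : ⋃ i, A i = Set.univ) {f : Plane → ℝ} {K : NNReal}
    (hf : ∀ i, LipschitzOnWith K f (A i)) : LipschitzWith K f := by
  have hcont : Continuous f :=
    (locallyFinite_of_finite A).continuous hcov hA fun i => (hf i).continuousOn
  refine LipschitzWith.of_le_add_mul K fun y x => ?_
  let γ : ℝ → Plane := fun t => x + t • (y - x)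
  have hγ : Continuous γ := by fun_prop
  let s : Set ℝ := {t | f (γ t) ≤ f x + K * (t * dist y x)}
  have hs : IsClosed (s ∩ Set.Icc 0 1) :=
    (isClosed_le (hcont.comp hγ) (by fun_prop)).inter isClosed_Icc
  have hsub : Set.Icc (0 : ℝ) 1 ⊆ s := by
    refine hs.Icc_subset_of_forall_exists_gt (by simp [s, γ]) ?_
    rintro t₀ ⟨ht₀, ht₀'⟩ t₁ ht₁
    have hex : ∃ i, ∃ᶠ t in 𝓝[>] t₀, γ t ∈ A i := by
      by_contra! h
      obtain ⟨t, ht⟩ := (eventually_all.2 h).exists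
      obtain ⟨i, hi⟩ := Set.mem_iUnion.1 (hcov ▸ Set.mem_univ (γ t))
      exact ht i hi
    obtain ⟨i, hi⟩ := hex
    have hi0 : γ t₀ ∈ A i :=
      (hA i).mem_of_frequently_of_tendsto hi (hγ.continuousAt.tendsto.mono_left nhdsWithin_le_nhds)
    obtain ⟨t, ht1, ht2⟩ := (hi.and_eventually (Ioc_mem_nhdsGT ht₁)).exists
    refine ⟨t, ?_, ht2⟩
    have h1 := (hf i).dist_le_mul _ ht1 _ hi0
    have h2 : dist (γ t) (γ t₀) = (t - t₀) * dist y x := by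
      rw [dist_eq_norm, dist_eq_norm]
      have : γ t - γ t₀ = (t - t₀) • (y - x) := by simp only [γ]; module
      rw [this, norm_smul, Real.norm_eq_abs, abs_of_pos (sub_pos.2 ht2.1)]
    rw [h2, Real.dist_eq] at h1
    have h3 := le_abs_self (f (γ t) - f (γ t₀))
    have h4 : f (γ t₀) ≤ f x + K * (t₀ * dist y x) := ht₀
    change f (γ t) ≤ f x + K * (t * dist y x)
    linarith
  have h1 : f (γ 1) ≤ f x + K * (1 * dist y x) := hsub (Set.right_mem_Icc.2 zero_le_one)
  have h2 : γ 1 = y := by simp [γ]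
  rwa [h2, one_mul] at h1

end

/-! ### Orthogonality of the reconstruction to gradients -/

theorem grad_sum {ι : Type*} (s : Finset ι) (φ : ι → Plane → ℝ) {x : Plane}
    (h : ∀ i ∈ s, DifferentiableAt ℝ (φ i) x) :
    grad (fun y => ∑ i ∈ s, φ i y) x = ∑ i ∈ s, grad (φ i) x := by
  refine grad_eq_of_hasFDerivAt ?_
  refine (HasFDerivAt.fun_sum fun i hi => hasFDerivAt_grad (h i hi)).congr_fderiv ?_
  simp [innerL]

theorem grad_const_mul (c : ℝ) {φ : Plane → ℝ} {x : Plane} (h : DifferentiableAt ℝ φ x) :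
    grad (fun y => c * φ y) x = c • grad φ x := by
  refine grad_eq_of_hasFDerivAt ?_
  refine ((hasFDerivAt_grad h).const_mul c).congr_fderiv ?_
  simp [innerL]

theorem grad_sub_const (c : ℝ) (φ : Plane → ℝ) (x : Plane) :
    grad (fun y => φ y - c) x = grad φ x := by
  rw [grad, grad, fderiv_sub_const]

theorem grad_congr {φ ψ : Plane → ℝ} {x : Plane} (h : φ =ᶠ[𝓝 x] ψ) : grad φ x = grad ψ x := by
  rw [grad, grad, h.fderiv_eq]

theorem ConvexPolygon.curl_interp {T : ConvexPolygon} (a : T.Idx → ℝ) {x : Plane}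
    (hx : x ∈ interior T.carrier) :
    curl (T.interp a) x = ∑ k, a k • curl (T.wachspress k) x := by
  have hd : ∀ k, DifferentiableAt ℝ (T.wachspress k) x := fun k =>
    (hasFDerivAt_wachspress (T.mem_interior_iff.1 hx) k).differentiableAt
  have h1 : T.interp a =ᶠ[𝓝 x] fun y => ∑ k, a k * T.wachspress k y := by
    filter_upwards [isOpen_interior.mem_nhds hx] with y hy
    simp only [interp, coord_eq _ hy]
  rw [curl_congr h1, curl, grad_sum _ _ fun k _ => (hd k).const_mul _]
  simp only [grad_const_mul _ (hd _), rot_sum_smul]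
  rfl

/-- A radial cutoff: one at distance at most `r / 2` from `x`, zero at distance at least `r`. -/
noncomputable def radialCutoff (x : Plane) (r : ℝ) (y : Plane) : ℝ :=
  max 0 (min 1 (2 - 2 * dist y x / r))

theorem radialCutoff_eq_one {x y : Plane} {r : ℝ} (hr : 0 < r) (h : dist y x < r / 2) :
    radialCutoff x r y = 1 := by
  have : 2 * dist y x / r ≤ 1 := (div_le_one hr).2 (by linarith)
  rw [radialCutoff, min_eq_left (by linarith), max_eq_right zero_le_one]

theorem mem_ball_of_radialCutoff_ne {x y : Plane} {r : ℝ} (hr : 0 < r)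
    (h : radialCutoff x r y ≠ 0) : y ∈ Metric.ball x r := by
  by_contra hy
  apply h
  have : 2 ≤ 2 * dist y x / r := (le_div_iff₀ hr).2 (by
    rw [Metric.mem_ball, not_lt] at hy; linarith)
  rw [radialCutoff, max_eq_left]
  exact (min_le_right _ _).trans (by linarith)

theorem abs_radialCutoff_le (x y : Plane) (r : ℝ) : |radialCutoff x r y| ≤ 1 := by
  rw [radialCutoff, abs_of_nonneg (le_max_left _ _)]
  exact max_le zero_le_one (min_le_left _ _)

theorem abs_radialCutoff_sub_le {r : ℝ} (hr : 0 < r) (x y z : Plane) :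
    |radialCutoff x r y - radialCutoff x r z| ≤ 2 / r * dist y z := by
  refine (abs_max_sub_max_le_max _ _ _ _).trans ?_
  rw [sub_self, abs_zero]
  refine max_le (by positivity) ?_
  refine (abs_min_sub_min_le_max _ _ _ _).trans ?_
  rw [sub_self, abs_zero]
  refine max_le (by positivity) ?_
  rw [show 2 - 2 * dist y x / r - (2 - 2 * dist z x / r) = 2 / r * (dist z x - dist y x) by ring,
    abs_mul, abs_of_pos (by positivity)]
  refine mul_le_mul_of_nonneg_left ?_ (by positivity)
  rw [dist_comm y z]
  exact abs_dist_sub_le z y x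

theorem eventually_mem_imp_mem {ι : Type*} [Finite ι] {A : ι → Set Plane}
    (hA : ∀ i, IsClosed (A i)) (x : Plane) : ∀ᶠ y in 𝓝 x, ∀ i, y ∈ A i → x ∈ A i := by
  rw [eventually_all]
  intro i
  by_cases h : x ∈ A i
  · exact Eventually.of_forall fun _ _ => h
  · filter_upwards [(hA i).isOpen_compl.mem_nhds h] with y hy hy' using absurd hy' hy

namespace StaggeredMesh

variable {Ω : Set Plane} {M : StaggeredMesh Ω}

/-- The stream function of the reconstruction on the element `K`, extended continuously to the
closed element. It is determined up to a constant only, which differs from element to element. -/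
noncomputable def stream (M : StaggeredMesh Ω) (u : M.Tri → Plane) (K : Fin M.card) : Plane → ℝ :=
  (M.elem K).interp (M.streamCoeff u K)

/-- The total flux of `u` through the boundary of every element vanishes. -/
def FluxFree (M : StaggeredMesh Ω) (u : M.Tri → Plane) : Prop :=
  ∀ K, ∑ i, (M.elem K).edgeLength i * ⟪u ⟨K, i⟩, (M.elem K).normal i⟫ = 0

theorem curl_stream {u : M.Tri → Plane} (hf : M.FluxFree u) {K : Fin M.card} {x : Plane}
    (hx : x ∈ interior (M.elem K).carrier) : curl (M.stream u K) x = M.recon u K x := by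
  rw [recon_eq (hf K), stream, ConvexPolygon.curl_interp _ hx]

theorem stream_sub_of_mem_edge {u : M.Tri → Plane} (hf : M.FluxFree u) {s : M.Tri} {x y : Plane}
    (hx : x ∈ M.primalEdge s) (hy : y ∈ M.primalEdge s) :
    M.stream u s.1 y - M.stream u s.1 x =
      -((M.primalLength s)⁻¹ * ⟪u s, M.primalNormal s⟫ *
        ⟪(M.elem s.1).vert (s.2 + 1) - (M.elem s.1).vert s.2, y - x⟫) := by
  rw [stream, ConvexPolygon.interp_sub_of_mem_edge (M.center_mem s.1) _ hy hx,
    streamCoeff_succ_sub (hf s.1)]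
  have := ((M.elem s.1).edgeLength_pos s.2).ne'
  rw [primalLength, primalNormal]
  field_simp

/-- Continuity of the normal fluxes: across a shared edge the stream functions of the two elements
differ by a constant. -/
theorem stream_sub_eq {u : M.Tri → Plane} (hu : M.IsVelocity u) (hf : M.FluxFree u)
    {K L : Fin M.card} {x y : Plane} (hxK : x ∈ (M.elem K).carrier) (hxL : x ∈ (M.elem L).carrier)
    (hyK : y ∈ (M.elem K).carrier) (hyL : y ∈ (M.elem L).carrier) :
    M.stream u K y - M.stream u K x = M.stream u L y - M.stream u L x := by
  by_cases hKL : K = L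
  · subst hKL; rfl
  have hx : x ∈ (M.elem K).carrier ∩ (M.elem L).carrier := ⟨hxK, hxL⟩
  have hy : y ∈ (M.elem K).carrier ∩ (M.elem L).carrier := ⟨hyK, hyL⟩
  rcases M.conforming K L hKL with h1 | ⟨i, j, -, h1⟩ | ⟨i, j, h2, h1⟩
  · rw [h1] at hx; exact hx.elim
  · rw [h1, Set.mem_singleton_iff] at hx hy
    rw [hx, hy]; ring
  · rw [h1] at hx hy
    have hst : (⟨K, i⟩ : M.Tri) ≠ ⟨L, j⟩ := fun h => hKL (congrArg Sigma.fst h)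
    have heq : M.primalEdge ⟨K, i⟩ = M.primalEdge ⟨L, j⟩ := h2
    have hK := stream_sub_of_mem_edge hf (s := ⟨K, i⟩) hx hy
    have hL := stream_sub_of_mem_edge hf (s := ⟨L, j⟩) (h2.subset hx) (h2.subset hy)
    obtain ⟨h3, h4⟩ := M.vert_eq_of_primalEdge_eq hst heq
    rw [M.primalLength_eq hst heq, M.primalNormal_eq_neg hst heq, hu.1 _ _ heq, h3, h4,
      ← neg_sub ((M.elem L).vert (j + 1)), inner_neg_right, inner_neg_left] at hK
    refine hK.trans (Eq.trans ?_ hL.symm)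
    ring

/-- The stream function is constant along boundary edges. The interior edges have only their end
points off `Ω`, which the hypothesis `hv` excludes. -/
theorem stream_eq_of_notMem {u : M.Tri → Plane} (hu : M.IsVelocity u) (hf : M.FluxFree u)
    {s : M.Tri} {x y : Plane} (hx : x ∈ M.primalEdge s) (hy : y ∈ M.primalEdge s) (hyΩ : y ∉ Ω)
    (hv : ∀ i, y = (M.elem s.1).vert i → y = x) : M.stream u s.1 y = M.stream u s.1 x := by
  by_cases h : ∃ t, s ≠ t ∧ M.primalEdge s = M.primalEdge t
  · obtain ⟨t, hst, heq⟩ := h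
    obtain ⟨a, b, ha, hb, hab, hy'⟩ := hy
    suffices y = x by rw [this]
    rcases ha.eq_or_lt with ha0 | ha0
    · refine hv (s.2 + 1) ?_
      have : b = 1 := by linarith
      rw [← hy', ← ha0, this, zero_smul, zero_add, one_smul]
    rcases hb.eq_or_lt with hb0 | hb0
    · refine hv s.2 ?_
      have : a = 1 := by linarith
      rw [← hy', ← hb0, this, zero_smul, add_zero, one_smul]
    exact absurd (hy' ▸ M.mem_domain_of_shared hst heq ha0 hb0 hab) hyΩ
  · push Not at h
    have h0 := hu.2 s (M.primalEdge_subset_frontier h)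
    have := stream_sub_of_mem_edge hf hx hy
    rw [h0, inner_zero_left, mul_zero, zero_mul, neg_zero] at this
    linarith

/-- Near every point the reconstruction is the curl of a single Lipschitz function vanishing
off `Ω`: the stream functions of the elements around the point `x`, normalized to vanish at `x`,
fit together. -/
theorem exists_local_stream {u : M.Tri → Plane} (hu : M.IsVelocity u) (hf : M.FluxFree u)
    (x : Plane) : ∃ (r : ℝ) (S : Plane → ℝ) (L : NNReal), 0 < r ∧ LipschitzWith L S ∧
      (∀ y ∉ Ω, S y = 0) ∧
      ∀ K, ∀ y ∈ interior (M.elem K).carrier, y ∈ Metric.ball x r →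
        curl S y = M.recon u K y := by
  classical
  -- The ball meets only those elements, edges and vertices which contain `x`.
  obtain ⟨r, hr, hball⟩ := Metric.eventually_nhds_iff_ball.1
    ((eventually_mem_imp_mem (fun K => (M.elem K).isClosed_carrier) x).and
      ((eventually_mem_imp_mem (A := M.primalEdge)
        (fun s : M.Tri => (M.elem s.1).isClosed_edge s.2) x).and
      (eventually_mem_imp_mem (A := fun s : M.Tri => ({(M.elem s.1).vert s.2} : Set Plane))
        (fun s => isClosed_singleton) x)))
  let κ := radialCutoff x r
  let S : Plane → ℝ := fun y => if h : ∃ K, y ∈ (M.elem K).carrier then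
    κ y * (M.stream u h.choose y - M.stream u h.choose x) else 0
  have hS : ∀ K, ∀ y ∈ (M.elem K).carrier, S y = κ y * (M.stream u K y - M.stream u K x) := by
    intro K y hy
    have h : ∃ K, y ∈ (M.elem K).carrier := ⟨K, hy⟩
    simp only [S, dif_pos h]
    by_cases hκ : κ y = 0
    · rw [hκ, zero_mul, zero_mul]
    · have hb := (hball y (mem_ball_of_radialCutoff_ne hr hκ)).1
      rw [stream_sub_eq hu hf (hb _ h.choose_spec) (hb K hy) h.choose_spec hy]
  have hS0 : ∀ y ∉ Ω, S y = 0 := by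
    intro y hy
    by_cases h : ∃ K, y ∈ (M.elem K).carrier
    · obtain ⟨K, hK⟩ := h
      rw [hS K y hK]
      by_cases hκ : κ y = 0
      · rw [hκ, zero_mul]
      · obtain ⟨-, hb2, hb3⟩ := hball y (mem_ball_of_radialCutoff_ne hr hκ)
        obtain ⟨i, hi⟩ := ConvexPolygon.exists_mem_edge_of_mem_diff_interior hK
          fun h => hy (M.interior_subset_domain K h)
        rw [stream_eq_of_notMem (s := ⟨K, i⟩) hu hf (hb2 ⟨K, i⟩ hi) hi hy fun j hj =>
          hj.trans (hb3 ⟨K, j⟩ hj).symm, sub_self, mul_zero]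
    · simp only [S, dif_neg h]
  have hLip : ∀ K, ∃ L : NNReal, LipschitzOnWith L S (M.elem K).carrier := by
    intro K
    obtain ⟨L, hL⟩ := (M.elem K).exists_lipschitzWith_interp (M.streamCoeff u K)
    have hg : LipschitzWith L fun y => M.stream u K y - M.stream u K x := by
      refine LipschitzWith.of_dist_le_mul fun y z => ?_
      rw [dist_sub_right]
      exact hL.dist_le_mul y z
    obtain ⟨B, hB⟩ := (M.elem K).isCompact_carrier.exists_bound_of_continuousOn
      hg.continuous.continuousOn
    refine ⟨(2 / r * |B| + L).toNNReal, LipschitzOnWith.of_dist_le_mul fun y hy z hz => ?_⟩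
    rw [hS K y hy, hS K z hz, Real.coe_toNNReal _ (by positivity), Real.dist_eq]
    have h1 := abs_radialCutoff_sub_le hr x y z
    have h2 := abs_radialCutoff_le x z r
    have h3 : |M.stream u K y - M.stream u K x| ≤ |B| := (hB y hy).trans (le_abs_self B)
    have h4 := hg.dist_le_mul y z
    rw [Real.dist_eq] at h4
    set g := fun y => M.stream u K y - M.stream u K x
    calc |κ y * g y - κ z * g z| = |(κ y - κ z) * g y + κ z * (g y - g z)| := by congr 1; ring
      _ ≤ 2 / r * dist y z * |B| + 1 * (L * dist y z) := by
          refine (abs_add_le _ _).trans ?_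
          rw [abs_mul, abs_mul]
          gcongr
      _ = _ := by ring
  choose Lc hLc using hLip
  have hLS : LipschitzWith (∑ K, Lc K) S := by
    refine lipschitzWith_of_finite_closed_cover (ι := Option (Fin M.card))
      (A := fun o => o.elim Ωᶜ fun K => (M.elem K).carrier) ?_ ?_ ?_
    · rintro (_ | K)
      exacts [M.isOpen_domain.isClosed_compl, (M.elem K).isClosed_carrier]
    · refine Set.eq_univ_of_forall fun y => ?_
      by_cases hy : y ∈ Ω
      · obtain ⟨K, hK⟩ := Set.mem_iUnion.1 (M.domain_subset hy)
        exact Set.mem_iUnion.2 ⟨some K, hK⟩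
      · exact Set.mem_iUnion.2 ⟨none, hy⟩
    · rintro (_ | K)
      · refine LipschitzOnWith.of_dist_le_mul fun y hy z hz => ?_
        rw [hS0 y hy, hS0 z hz, dist_self]
        positivity
      · exact (hLc K).weaken (Finset.single_le_sum (fun _ _ => zero_le) (Finset.mem_univ K))
  refine ⟨r / 2, S, _, by positivity, hLS, hS0, fun K y hy hyb => ?_⟩
  have h1 : S =ᶠ[𝓝 y] fun z => M.stream u K z - M.stream u K x := by
    filter_upwards [isOpen_interior.mem_nhds hy, Metric.isOpen_ball.mem_nhds hyb] with z hz hzb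
    rw [hS K z (interior_subset hz)]
    simp only [κ, radialCutoff_eq_one hr hzb, one_mul]
  rw [curl_congr h1, curl, grad_sub_const, ← curl, curl_stream hf hy]

/-- The skeleton of the mesh is a null set. -/
theorem integral_domain {h : Plane → ℝ} (hh : IntegrableOn h Ω) :
    ∫ x in Ω, h x = ∑ K, ∫ x in interior (M.elem K).carrier, h x := by
  have hdisj : Pairwise fun K L =>
      Disjoint (interior (M.elem K).carrier) (interior (M.elem L).carrier) := by
    intro K L hKL
    rw [Set.disjoint_iff_inter_eq_empty]
    exact Set.subset_empty_iff.1 ((Set.inter_subset_inter_right _ interior_subset).trans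
      (M.interior_inter_carrier hKL).subset)
  have hae : Ω =ᵐ[volume] ⋃ K, interior (M.elem K).carrier := by
    rw [ae_eq_set]
    refine ⟨?_, ?_⟩
    · refine measure_mono_null (t := ⋃ K, frontier (M.elem K).carrier) ?_ ?_
      · rintro x ⟨hx, hx'⟩
        obtain ⟨K, hK⟩ := Set.mem_iUnion.1 (M.domain_subset hx)
        exact Set.mem_iUnion.2 ⟨K, subset_closure hK, fun h => hx' (Set.mem_iUnion.2 ⟨K, h⟩)⟩
      · exact measure_iUnion_null fun K => (M.elem K).convex_carrier.addHaar_frontier _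
    · rw [Set.sdiff_eq_empty.2 (Set.iUnion_subset M.interior_subset_domain), measure_empty]
  rw [setIntegral_congr_set hae]
  exact integral_iUnion_fintype (fun K => isOpen_interior.measurableSet) hdisj
    fun K => hh.mono_set (M.interior_subset_domain K)

/-- The reconstruction of a discretely divergence-free velocity is orthogonal to all gradients. -/
theorem sum_integral_inner_recon_eq_zero {u : M.Tri → Plane} (hu : M.IsVelocity u)
    (hf : M.FluxFree u) {χ : Plane → ℝ} {G : Plane → Plane} (hχ : HasWeakGradient Ω χ G) :
    ∑ K, ∫ x in interior (M.elem K).carrier, ⟪G x, M.recon u K x⟫ = 0 := by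
  have hb := M.isBounded_domain
  have hΩ := M.isOpen_domain
  choose r S L hr hL hS0 hcurl using exists_local_stream hu hf
  obtain ⟨t, -, ht⟩ := hb.isCompact_closure.elim_nhds_subcover (fun x => Metric.ball x (r x))
    fun x _ => Metric.ball_mem_nhds x (hr x)
  obtain ⟨θ, hθ⟩ := SmoothPartitionOfUnity.exists_isSubordinate (modelWithCornersSelf ℝ Plane)
    (isClosed_closure (s := Ω)) (fun i : t => Metric.ball (i : Plane) (r i))
    (fun i => Metric.isOpen_ball) (by rw [Set.iUnion_subtype]; exact ht)
  have hθs : ∀ i, ContDiff ℝ (⊤ : ℕ∞) (θ i) := fun i => (θ i).contMDiff.contDiff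
  have hsum : ∀ x ∈ Ω, ∑ i, θ i x = 1 := fun x hx => by
    rw [← finsum_eq_sum_of_fintype]; exact θ.sum_eq_one (subset_closure hx)
  have hgrad : ∀ x ∈ Ω, ∑ i, grad (θ i) x = 0 := by
    intro x hx
    rw [← grad_sum _ _ fun i _ => ((hθs i).differentiable (by simp)) x]
    have h1 : (fun y => ∑ i, θ i y) =ᶠ[𝓝 x] fun _ => (1 : ℝ) := by
      filter_upwards [hΩ.mem_nhds hx] with y hy using hsum y hy
    rw [grad_congr h1, grad]
    refine plane_ext ?_ ?_ <;> simp
  let H : t → Plane → Plane := fun i x => θ i x • G x + χ x • grad (θ i) x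
  have hχi := integrableOn_of_memLp hb hχ.1
  have hGi := integrableOn_of_memLp hb hχ.2.1
  have hgc : ∀ i, Continuous (grad (θ i)) := by
    intro i
    refine (PiLp.continuous_toLp 2 _).comp (continuous_pi fun j => ?_)
    fin_cases j
    · exact (contDiff_fderiv_apply (hθs i) _).continuous
    · exact (contDiff_fderiv_apply (hθs i) _).continuous
  have hHi : ∀ i, IntegrableOn (H i) Ω := by
    intro i
    obtain ⟨C, hC⟩ := hb.isCompact_closure.exists_bound_of_continuousOn
      (hθs i).continuous.continuousOn
    obtain ⟨D, hD⟩ := hb.isCompact_closure.exists_bound_of_continuousOn (hgc i).continuousOn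
    refine Integrable.add ?_ ?_
    · refine Integrable.bdd_smul hGi C (hθs i).continuous.aestronglyMeasurable ?_
      filter_upwards [ae_restrict_mem hΩ.measurableSet] with x hx using hC x (subset_closure hx)
    · refine Integrable.smul_bdd hχi D (hgc i).aestronglyMeasurable ?_
      filter_upwards [ae_restrict_mem hΩ.measurableSet] with x hx using hD x (subset_closure hx)
  have hzero : ∀ i : t, ∫ x in Ω, ⟪curl (S i) x, H i x⟫ = 0 := fun i =>
    integral_inner_curl_eq_zero_of_lipschitz hb hΩ (hHi i)
      (fun S hS => integral_inner_curl_eq_zero_of_isTestFunction hb hΩ hχ (hθs i) hS)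
      (hL i) (hS0 i)
  have hint : ∀ i : t, IntegrableOn (fun x => ⟪curl (S i) x, H i x⟫) Ω := by
    intro i
    refine Integrable.mono' ((hHi i).norm.const_mul (L i : ℝ))
      ((measurable_curl _).aestronglyMeasurable.inner (hHi i).1) (Eventually.of_forall fun x => ?_)
    refine (norm_inner_le_norm _ _).trans (mul_le_mul_of_nonneg_right ?_ (norm_nonneg _))
    rw [norm_curl]
    exact norm_fderiv_le_of_lipschitz ℝ (hL i)
  have hpt : ∀ (i : t) K, ∀ x ∈ interior (M.elem K).carrier,
      ⟪curl (S i) x, H i x⟫ = ⟪M.recon u K x, H i x⟫ := by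
    intro i K x hx
    by_cases hxt : x ∈ tsupport (θ i)
    · rw [hcurl i K x hx (hθ i hxt)]
    · have h1 : θ i =ᶠ[𝓝 x] fun _ => (0 : ℝ) := notMem_tsupport_iff_eventuallyEq.1 hxt
      have h2 : H i x = 0 := by
        simp only [H]
        rw [h1.eq_of_nhds, grad_congr h1, grad]
        refine plane_ext ?_ ?_ <;> simp
      rw [h2, inner_zero_right, inner_zero_right]
  have hK : ∀ K, ∫ x in interior (M.elem K).carrier, ⟪G x, M.recon u K x⟫ =
      ∑ i : t, ∫ x in interior (M.elem K).carrier, ⟪curl (S i) x, H i x⟫ := by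
    intro K
    rw [← integral_finsetSum _ fun i _ => (hint i).mono_set (M.interior_subset_domain K)]
    refine setIntegral_congr_fun isOpen_interior.measurableSet fun x hx => ?_
    have hxΩ := M.interior_subset_domain K hx
    simp only [hpt _ K x hx]
    rw [← inner_sum, real_inner_comm]
    simp only [H]
    rw [Finset.sum_add_distrib, ← Finset.sum_smul, ← Finset.smul_sum, hsum x hxΩ, hgrad x hxΩ,
      one_smul, smul_zero, add_zero]
  rw [Finset.sum_congr rfl fun K _ => hK K, Finset.sum_comm]
  exact Finset.sum_eq_zero fun i _ => by rw [← integral_domain (hint i), hzero i]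

end StaggeredMesh

/-! ### Bounds for the reconstruction and the load -/

theorem integral_normSq_eq_l2Norm_sq {Ω : Set Plane} {g : Plane → Plane}
    (hg : MemLp g 2 (volume.restrict Ω)) : ∫ x in Ω, ‖g x‖ ^ 2 = l2Norm Ω g ^ 2 := by
  rw [l2Norm, hg.eLpNorm_eq_integral_rpow_norm (by norm_num) (by norm_num)]
  have h0 : 0 ≤ ∫ x in Ω, ‖g x‖ ^ 2 := integral_nonneg fun x => sq_nonneg _
  simp only [ENNReal.toReal_ofNat, Real.rpow_ofNat]
  rw [ENNReal.toReal_ofReal (by positivity), ← Real.rpow_natCast, ← Real.rpow_mul h0]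
  norm_num

theorem div_curl_eq_zero {φ : Plane → ℝ} {x : Plane} (h : ContDiffAt ℝ 2 φ x) :
    div (curl φ) x = 0 := by
  have hd : DifferentiableAt ℝ (fderiv ℝ φ) x :=
    (h.fderiv_right (m := 1) (by norm_num)).differentiableAt (by norm_num)
  have hc : DifferentiableAt ℝ (curl φ) x := by
    rw [differentiableAt_euclidean]
    intro i
    fin_cases i
    · exact (hd.clm_apply (differentiableAt_const (unitVec 1))).neg
    · exact hd.clm_apply (differentiableAt_const (unitVec 0))
  have hi : ∀ (i : Fin 2) (v : Plane), (fderiv ℝ (curl φ) x v) i =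
      fderiv ℝ (fun y => curl φ y i) x v := by
    intro i v
    have := ((EuclideanSpace.proj i : Plane →L[ℝ] ℝ).hasFDerivAt.comp x hc.hasFDerivAt).fderiv
    exact (DFunLike.congr_fun this v).symm
  rw [div, Fin.sum_univ_two, hi, hi]
  have h0 : (fun y => curl φ y 0) = fun y => -fderiv ℝ φ y (unitVec 1) := rfl
  have h1 : (fun y => curl φ y 1) = fun y => fderiv ℝ φ y (unitVec 0) := rfl
  rw [h0, h1, fderiv_fun_neg, fderiv_fderiv_comm h (unitVec 0) (unitVec 1)]
  simp

theorem ConvexPolygon.contDiffAt_interp {T : ConvexPolygon} (a : T.Idx → ℝ) {x : Plane}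
    (hx : x ∈ interior T.carrier) : ContDiffAt ℝ 2 (T.interp a) x := by
  have h1 : T.interp a =ᶠ[𝓝 x] fun y => ∑ k, a k * T.wachspress k y := by
    filter_upwards [isOpen_interior.mem_nhds hx] with y hy
    simp only [ConvexPolygon.interp, ConvexPolygon.coord_eq _ hy]
  refine ContDiffAt.congr_of_eventuallyEq ?_ h1
  exact ContDiffAt.sum fun k _ => contDiffAt_const.mul
    (ConvexPolygon.contDiffAt_wachspress (T.mem_interior_iff.1 hx) k)

namespace StaggeredMesh

variable {Ω : Set Plane} {M : StaggeredMesh Ω}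

theorem formbstar_eq_zero {u : M.Tri → Plane} (hf : M.FluxFree u) (p : Fin M.card → ℝ) :
    M.formbstar p u = 0 := by
  rw [formbstar, neg_eq_zero]
  refine Finset.sum_eq_zero fun K _ => ?_
  rw [setIntegral_congr_fun (g := fun _ => (0 : ℝ)) isOpen_interior.measurableSet, integral_zero]
  intro x hx
  have h1 : M.recon u K =ᶠ[𝓝 x] curl (M.stream u K) := by
    filter_upwards [isOpen_interior.mem_nhds hx] with y hy using (curl_stream hf hy).symm
  have h2 : div (M.recon u K) x = div (curl (M.stream u K)) x := by
    rw [div, div, h1.fderiv_eq]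
  have h3 : div (curl (M.stream u K)) x = 0 :=
    div_curl_eq_zero (ConvexPolygon.contDiffAt_interp _ hx)
  simp only [h2, h3, mul_zero]

theorem measurable_recon {u : M.Tri → Plane} (hf : M.FluxFree u) (K : Fin M.card) :
    Measurable (M.recon u K) := by
  have : M.recon u K = fun x =>
      ∑ k, M.streamCoeff u K k • curl ((M.elem K).wachspress k) x := by
    ext1 x; exact recon_eq (hf K) x
  rw [this]
  refine Finset.measurable_sum _ fun k _ => ?_
  exact (measurable_curl _).const_smul (M.streamCoeff u K k)

/-- The gradients of the coordinates are of order `1 / h_T`, the stream function values are of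
order `h_T |u|`. -/
theorem norm_recon_le {u : M.Tri → Plane} (hf : M.FluxFree u) {K : Fin M.card} {c : ℝ}
    (hc : 0 < c) (hH : (M.elem K).HeightBound (c * (M.elem K).diam)) {x : Plane}
    (hx : x ∈ interior (M.elem K).carrier) :
    ‖M.recon u K x‖ ≤ (((M.elem K).extra + 3 : ℕ) : ℝ) ^ 3 / c * ∑ i, ‖u ⟨K, i⟩‖ := by
  have hx' := (M.elem K).mem_interior_iff.1 hx
  have hh := (M.elem K).diam_pos
  rw [recon_eq (hf K)]
  calc _ ≤ ∑ k : (M.elem K).Idx, ((M.elem K).diam * ∑ i, ‖u ⟨K, i⟩‖) *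
        ((((M.elem K).extra + 3 : ℕ) : ℝ) ^ 2 * (c * (M.elem K).diam)⁻¹) := by
        refine norm_sum_le_of_le _ fun k _ => ?_
        rw [norm_smul, Real.norm_eq_abs, curl, norm_rot]
        exact mul_le_mul (abs_streamCoeff_le (hf K) k) (hH.norm_grad_wachspress_le hx' k)
          (norm_nonneg _) (mul_nonneg hh.le (Finset.sum_nonneg fun _ _ => norm_nonneg _))
    _ = _ := by
        rw [Finset.sum_const, Finset.card_univ, Fintype.card_fin, nsmul_eq_mul]
        field_simp

theorem integrableOn_inner_recon {u : M.Tri → Plane} (hf : M.FluxFree u) (K : Fin M.card)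
    {g : Plane → Plane} (hg : IntegrableOn g Ω) :
    IntegrableOn (fun x => ⟪g x, M.recon u K x⟫) (interior (M.elem K).carrier) := by
  obtain ⟨H, hH⟩ := (M.elem K).exists_heightBound
  have hh := (M.elem K).diam_pos
  have hH' : (M.elem K).HeightBound (H / (M.elem K).diam * (M.elem K).diam) := by
    rwa [div_mul_cancel₀ _ hh.ne']
  have hgK := hg.mono_set (M.interior_subset_domain K)
  refine Integrable.mono' (hgK.norm.mul_const
      ((((M.elem K).extra + 3 : ℕ) : ℝ) ^ 3 / (H / (M.elem K).diam) * ∑ i, ‖u ⟨K, i⟩‖))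
    (hgK.1.inner (measurable_recon hf K).aestronglyMeasurable) ?_
  filter_upwards [ae_restrict_mem isOpen_interior.measurableSet] with x hx
  refine (norm_inner_le_norm _ _).trans (mul_le_mul_of_nonneg_left ?_ (norm_nonneg _))
  exact norm_recon_le hf (div_pos hH.1 hh) hH' hx

/-- Pressure robustness: the gradient part of the force does not contribute to the load. -/
theorem load_eq {u : M.Tri → Plane} (hu : M.IsVelocity u) (hf : M.FluxFree u)
    {f g G : Plane → Plane} {χ : Plane → ℝ} {lam : ℝ} (hg : MemLp g 2 (volume.restrict Ω))
    (hχ : HasWeakGradient Ω χ G) (hfg : f =ᵐ[volume.restrict Ω] fun x => g x + lam • G x) :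
    M.load f u = M.load g u := by
  have hgi := integrableOn_of_memLp M.isBounded_domain hg
  have hGi := integrableOn_of_memLp M.isBounded_domain hχ.2.1
  have h1 : ∀ K, ∫ x in interior (M.elem K).carrier, ⟪f x, M.recon u K x⟫ =
      (∫ x in interior (M.elem K).carrier, ⟪g x, M.recon u K x⟫) +
        lam * ∫ x in interior (M.elem K).carrier, ⟪G x, M.recon u K x⟫ := by
    intro K
    rw [← integral_const_mul, ← integral_add (integrableOn_inner_recon hf K hgi)
      ((integrableOn_inner_recon hf K hGi).const_mul lam)]
    refine integral_congr_ae ?_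
    filter_upwards [ae_restrict_of_ae_restrict_of_subset (M.interior_subset_domain K) hfg] with x hx
    rw [hx, inner_add_left, inner_smul_left]
    rfl
  rw [load, Finset.sum_congr rfl fun K _ => h1 K, Finset.sum_add_distrib, ← Finset.mul_sum,
    sum_integral_inner_recon_eq_zero hu hf hχ, mul_zero, add_zero]
  rfl

/-- The Cauchy–Schwarz inequality for the load, in the form of Young's inequality. -/
theorem two_mul_load_le {u : M.Tri → Plane} (hf : M.FluxFree u) {g : Plane → Plane}
    (hg : MemLp g 2 (volume.restrict Ω)) {B : Fin M.card → ℝ}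
    (hB : ∀ K, ∀ x ∈ interior (M.elem K).carrier, ‖M.recon u K x‖ ≤ B K) {t : ℝ} (ht : 0 < t) :
    2 * M.load g u ≤
      t * ∑ K, B K ^ 2 * (Real.pi * (M.elem K).diam ^ 2) + l2Norm Ω g ^ 2 / t := by
  have hgi := integrableOn_of_memLp M.isBounded_domain hg
  have hsq : IntegrableOn (fun x => ‖g x‖ ^ 2) Ω := hg.integrable_norm_pow (by norm_num)
  rw [← integral_normSq_eq_l2Norm_sq hg, integral_domain hsq, load, Finset.mul_sum, Finset.mul_sum,
    Finset.sum_div, ← Finset.sum_add_distrib]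
  refine Finset.sum_le_sum fun K _ => ?_
  have hsqK := hsq.mono_set (M.interior_subset_domain K)
  have hfin : volume (interior (M.elem K).carrier) ≠ ⊤ :=
    ((M.elem K).isCompact_carrier.isBounded.subset interior_subset).measure_lt_top.ne
  have hvol : volume.real (interior (M.elem K).carrier) ≤ Real.pi * (M.elem K).diam ^ 2 :=
    volume_real_le_of_subset (M.elem K).diam_pos.le
      (interior_subset.trans (carrier_subset_closedBall K))
  rw [← integral_const_mul]
  calc _ ≤ ∫ x in interior (M.elem K).carrier, (t * B K ^ 2 + ‖g x‖ ^ 2 / t) := by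
        refine setIntegral_mono_on ((integrableOn_inner_recon hf K hgi).const_mul 2)
          ((integrableOn_const hfin).add (hsqK.div_const t)) isOpen_interior.measurableSet
          fun x hx => ?_
        have h1 : ⟪g x, M.recon u K x⟫ ≤ ‖g x‖ * B K :=
          (real_inner_le_norm _ _).trans (mul_le_mul_of_nonneg_left (hB K x hx) (norm_nonneg _))
        have h2 : 0 ≤ (t * B K - ‖g x‖) ^ 2 / t := by positivity
        have h3 : (t * B K - ‖g x‖) ^ 2 / t =
            t * B K ^ 2 + ‖g x‖ ^ 2 / t - 2 * (‖g x‖ * B K) := by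
          field_simp; ring
        linarith
    _ = volume.real (interior (M.elem K).carrier) * (t * B K ^ 2) +
          (∫ x in interior (M.elem K).carrier, ‖g x‖ ^ 2) / t := by
        have hc : IntegrableOn (fun _ => t * B K ^ 2) (interior (M.elem K).carrier) :=
          integrableOn_const hfin
        rw [integral_add hc (hsqK.div_const t), setIntegral_const, integral_div, smul_eq_mul]
    _ ≤ _ := by
        have := mul_le_mul_of_nonneg_right hvol (show 0 ≤ t * B K ^ 2 by positivity)
        linarith

/-! ### The a priori bound -/

/-- The quantitative content of mesh regularity: lower bounds for the areas of the triangles and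
for the heights of the polygons. -/
theorem IsRegular.bounds {ρB ρE θ : ℝ} (hρB : 0 < ρB) (hρE : 0 < ρE) (hθ : 0 < θ)
    (hM : M.IsRegular ρB ρE θ) :
    (∀ s : M.Tri, ρE * ρB * (M.elem s.1).diam ^ 2 ≤ M.triDet s) ∧
      ∀ K, (M.elem K).HeightBound (ConvexPolygon.heightConst ρB ρE θ * (M.elem K).diam) := by
  have hd : ∀ K i, ρB * (M.elem K).diam ≤ (M.elem K).edgeDist i (M.center K) := fun K =>
    ConvexPolygon.le_edgeDist_of_starConvex (mul_pos hρB (M.elem K).diam_pos) (hM K).1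
  refine ⟨fun s => ?_, fun K => ConvexPolygon.heightBound_of_regular hρB hρE hθ
    (interior_subset (M.center_mem K)) (hd K) (hM K).2.1 (hM K).2.2⟩
  rw [triDet_eq]
  have h1 := (hM s.1).2.1 s.2
  have h2 := hd s.1 s.2
  have hh := (M.elem s.1).diam_pos
  calc _ = (ρE * (M.elem s.1).diam) * (ρB * (M.elem s.1).diam) := by ring
    _ ≤ _ := mul_le_mul h1 h2 (by positivity) ((M.elem s.1).edgeLength_pos _).le

theorem sum_recon_bound_le {c κ R : ℝ} (hc : 0 < c) (hκ : 0 < κ)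
    (hD : ∀ s, κ * (M.elem s.1).diam ^ 2 ≤ M.triDet s) (hR : ∀ K, ‖M.center K‖ ≤ R)
    (hH : ∀ K, (M.elem K).HeightBound (c * (M.elem K).diam)) {u : M.Tri → Plane}
    (hu : M.IsVelocity u) :
    ∑ K, ((((M.elem K).extra + 3 : ℕ) : ℝ) ^ 3 / c * ∑ i, ‖u ⟨K, i⟩‖) ^ 2 *
        (Real.pi * (M.elem K).diam ^ 2) ≤
      ((2 / c + 1) ^ 2) ^ 7 / c ^ 2 * Real.pi * (2 * R / κ) ^ 2 * M.hNorm u ^ 2 := by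
  have h1 := sum_diam_sq_mul_normSq_le hκ hD hR hu
  rw [mul_assoc _ ((2 * R / κ) ^ 2)]
  refine le_trans ?_ (mul_le_mul_of_nonneg_left h1 (by positivity))
  rw [Fintype.sum_sigma, Finset.mul_sum]
  refine Finset.sum_le_sum fun K _ => ?_
  have hm := (hH K).card_le hc
  set m : ℝ := (((M.elem K).extra + 3 : ℕ) : ℝ) with hmdef
  have hm0 : 0 ≤ m := by positivity
  have h2 : (∑ i, ‖u ⟨K, i⟩‖) ^ 2 ≤ m * ∑ i, ‖u ⟨K, i⟩‖ ^ 2 := by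
    have := sq_sum_le_card_mul_sum_sq (s := Finset.univ) (f := fun i => ‖u ⟨K, i⟩‖)
    rwa [Finset.card_univ, Fintype.card_fin] at this
  have h3 : m ^ 7 ≤ ((2 / c + 1) ^ 2) ^ 7 := pow_le_pow_left₀ hm0 hm 7
  simp only [← Finset.mul_sum]
  calc _ = m ^ 6 / c ^ 2 * Real.pi * (M.elem K).diam ^ 2 * (∑ i, ‖u ⟨K, i⟩‖) ^ 2 := by ring
    _ ≤ m ^ 6 / c ^ 2 * Real.pi * (M.elem K).diam ^ 2 * (m * ∑ i, ‖u ⟨K, i⟩‖ ^ 2) := by gcongr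
    _ = m ^ 7 / c ^ 2 * Real.pi * ((M.elem K).diam ^ 2 * ∑ i, ‖u ⟨K, i⟩‖ ^ 2) := by ring
    _ ≤ _ := by
        have : 0 ≤ ∑ i, ‖u ⟨K, i⟩‖ ^ 2 := Finset.sum_nonneg fun _ _ => sq_nonneg _
        gcongr

theorem IsSolution.hNorm_sq_le {ν : ℝ} (hν : 0 < ν) {f g G : Plane → Plane} {χ : Plane → ℝ}
    {lam : ℝ} (hg : MemLp g 2 (volume.restrict Ω)) (hχ : HasWeakGradient Ω χ G)
    (hfg : f =ᵐ[volume.restrict Ω] fun x => g x + lam • G x)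
    {ω : M.Tri → Matrix (Fin 2) (Fin 2) ℝ} {u : M.Tri → Plane} {p : Fin M.card → ℝ}
    (h : M.IsSolution ν f ω u p) {c κ R : ℝ} (hc : 0 < c) (hκ : 0 < κ)
    (hD : ∀ s, κ * (M.elem s.1).diam ^ 2 ≤ M.triDet s) (hR : ∀ K, ‖M.center K‖ ≤ R)
    (hH : ∀ K, (M.elem K).HeightBound (c * (M.elem K).diam)) {A B : ℝ} (hA : 0 < A) (hB : 0 < B)
    (hA' : 4 * Real.pi / κ ^ 2 ≤ A)
    (hB' : ((2 / c + 1) ^ 2) ^ 7 / c ^ 2 * Real.pi * (2 * R / κ) ^ 2 ≤ B) :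
    M.hNorm u ^ 2 ≤ A ^ 2 * B * (ν⁻¹ ^ 2 * l2Norm Ω g ^ 2) := by
  have hu := h.velocity_mem
  have hf : M.FluxFree u := sum_flux_eq_zero hu h.incompressible
  set N := M.hNorm u ^ 2 with hN
  have hN0 : 0 ≤ N := sq_nonneg _
  have h1 : ν⁻¹ * M.matInner ω ω = M.load g u := by
    rw [← h.constitutive ω h.gradient_mem, formBstar_eq_formB hu h.gradient_mem,
      ← load_eq hu hf hg hχ hfg, ← h.momentum u hu, formbstar_eq_zero hf, add_zero]
  have h0 : 0 ≤ M.matInner ω ω := Finset.sum_nonneg fun s _ => mul_nonneg measureReal_nonneg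
    (Finset.sum_nonneg fun i _ => Finset.sum_nonneg fun j _ => mul_self_nonneg _)
  have h2 : N ≤ A * ν⁻¹ * M.load g u := by
    rw [← h1]
    refine (hNorm_le_of_constitutive hκ hD hν hu h.constitutive).trans ?_
    calc _ ≤ A * (ν⁻¹ ^ 2 * M.matInner ω ω) := by gcongr
      _ = _ := by ring
  -- The weight in Young's inequality is such that half of `‖u‖_h²` can be absorbed.
  have h3 := two_mul_load_le hf hg (fun K x hx => norm_recon_le hf hc (hH K) hx)
    (t := ν / (A * B)) (by positivity)
  have h4 : ν / (A * B) * ∑ K, ((((M.elem K).extra + 3 : ℕ) : ℝ) ^ 3 / c * ∑ i, ‖u ⟨K, i⟩‖) ^ 2 *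
      (Real.pi * (M.elem K).diam ^ 2) ≤ ν / (A * B) * (B * N) := by
    refine mul_le_mul_of_nonneg_left ?_ (by positivity)
    refine (sum_recon_bound_le hc hκ hD hR hH hu).trans ?_
    gcongr
  have h5 : A * ν⁻¹ * (2 * M.load g u) ≤
      A * ν⁻¹ * (ν / (A * B) * (B * N) + l2Norm Ω g ^ 2 / (ν / (A * B))) :=
    mul_le_mul_of_nonneg_left (by linarith) (by positivity)
  have h6 : A * ν⁻¹ * (ν / (A * B) * (B * N) + l2Norm Ω g ^ 2 / (ν / (A * B))) =
      N + A ^ 2 * B * (ν⁻¹ ^ 2 * l2Norm Ω g ^ 2) := by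
    field_simp
  linarith

end StaggeredMesh
end PRSDG

theorem mainTheorem4 (Ω : Set PRSDG.Plane) (ρB ρE θ : ℝ)
    (hρB : 0 < ρB) (hρE : 0 < ρE) (hθ : 0 < θ) :
    ∃ C : ℝ, 0 < C ∧
      ∀ M : PRSDG.StaggeredMesh Ω, M.IsRegular ρB ρE θ →
      ∀ ν : ℝ, 0 < ν →
      ∀ f g : PRSDG.Plane → PRSDG.Plane, MemLp f 2 (volume.restrict Ω) →
        PRSDG.IsSolenoidalPart Ω g →
      ∀ (χ : PRSDG.Plane → ℝ) (gradχ : PRSDG.Plane → PRSDG.Plane),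
        PRSDG.HasWeakGradient Ω χ gradχ → PRSDG.l2Norm Ω gradχ = 1 →
      ∀ lam : ℝ, 0 ≤ lam →
        (f =ᵐ[volume.restrict Ω] fun x => g x + lam • gradχ x) →
      ∀ (ω : M.Tri → Matrix (Fin 2) (Fin 2) ℝ) (u : M.Tri → PRSDG.Plane) (p : Fin M.card → ℝ),
        M.IsSolution ν f ω u p →
        M.hNorm u ≤ C * ν⁻¹ * PRSDG.l2Norm Ω g := by
  -- A domain which has a mesh is bounded, so only bounded sets matter for the choice of `C`.
  by_cases hΩ : Bornology.IsBounded Ω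
  swap
  · exact ⟨1, one_pos, fun M => absurd M.isBounded_domain hΩ⟩
  obtain ⟨R, hR⟩ := hΩ.exists_norm_le
  set c := PRSDG.ConvexPolygon.heightConst ρB ρE θ
  have hc : 0 < c := PRSDG.ConvexPolygon.heightConst_pos hρB hρE hθ
  have hκ : 0 < ρE * ρB := mul_pos hρE hρB
  set A := 4 * Real.pi / (ρE * ρB) ^ 2
  have hA : 0 < A := by have := Real.pi_pos; positivity
  set B := ((2 / c + 1) ^ 2) ^ 7 / c ^ 2 * Real.pi * (2 * R / (ρE * ρB)) ^ 2 + 1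
  have hB : 1 ≤ B := le_add_of_nonneg_left (by have := Real.pi_pos; positivity)
  refine ⟨A * B, by positivity, ?_⟩
  intro M hM ν hν f g hf _ χ gradχ hχ _ lam _ hfg ω u p hsol
  obtain ⟨hD, hH⟩ := hM.bounds hρB hρE hθ
  -- Here `‖g‖_{L²}` has to be finite, since `l2Norm` would otherwise be zero.
  have hg2 : MemLp g 2 (volume.restrict Ω) := by
    refine (hf.sub (hχ.2.1.const_smul lam)).ae_eq ?_
    filter_upwards [hfg] with x hx
    simp [hx]
  have h := hsol.hNorm_sq_le hν hg2 hχ hfg hc hκ hD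
    (fun K => hR _ (M.interior_subset_domain K (M.center_mem K))) hH hA (by positivity) le_rfl
    (le_add_of_nonneg_right zero_le_one)
  have hl : 0 ≤ PRSDG.l2Norm Ω g := ENNReal.toReal_nonneg
  -- The factor `B ≥ 1` avoids the square root of `B` in the constant.
  have hB2 : B ≤ B ^ 2 := by nlinarith
  refine abs_le_of_sq_le_sq' ?_ (by positivity) |>.2
  calc M.hNorm u ^ 2 ≤ A ^ 2 * B * (ν⁻¹ ^ 2 * PRSDG.l2Norm Ω g ^ 2) := h
    _ ≤ A ^ 2 * B ^ 2 * (ν⁻¹ ^ 2 * PRSDG.l2Norm Ω g ^ 2) := by gcongr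
    _ = _ := by ring
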